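/- **Setting.** Let $G=(V,E,\sigma)$ be a finite network (parallel edges allowed, no loops) with edge weights $\sigma\in\mathbb R^E_{>0}$, drawn in the plane without crossings: vertices are distinct points, edges are simple arcs joining their ends, an edge contains no vertices other than its ends, and two edges meet only in common ends. Let $\mathcal C$ be a Jordan curve encircling $G$ in the closed outer face of $G$, i.e. $G\subset\overline D$, where $\overline D$ is the closed Jordan domain bounded by $\mathcal C$. Let $S_1,S_2\subset\mathcal C$ be disjoint closed arcs, and let $A=\{v\in V: v\in S_1\}$, $B=\{v\in V: v\in S_2\}$. Call one of the two components of $\mathcal C\setminus(S_1\cup S_2)$ the bottom. (If $\overline D$ is mapped homeomorphically onto a rectangle so that $S_1,S_2$ become the left and right sides, the bottom becomes the bottom or the top side.) A path is a sequence of edges $(x_{k-1}x_k)_{k=1}^n$ with $x_0,\dots,x_n$ distinct; $\Gamma(A,B)$ is the set of all paths with $x_0\in A$, $x_n\in B$. Assume that $\Gamma(A,B)\neq\emptyset$ (in particular $A,B\ne\emptyset$). **Modulus.** For a family $\Gamma$ of paths, $\operatorname{Mod}_{2,\sigma}(\Gamma)=\inf\sum_{e}\sigma(e)\rho(e)^2$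 over all admissible densities, i.e. all $\rho:E\to[0,\infty)$ with $\sum_{e\in\gamma}\rho(e)\ge1$ for all $\gamma\in\Gamma$; an admissible $\rho$ attaining the infimum is extremal. A subfamily $\Gamma\subset\Gamma(A,B)$ is minimal if $\operatorname{Mod}_{2,\sigma}(\Gamma)=\operatorname{Mod}_{2,\sigma}(\Gamma(A,B))$ and $\operatorname{Mod}_{2,\sigma}(\Gamma\setminus\{\gamma\})<\operatorname{Mod}_{2,\sigma}(\Gamma(A,B))$ for every $\gamma\in\Gamma$. A probability mass function (pmf) $\mu$ on $\Gamma(A,B)$ is optimal if it minimizes $\sum_{e}\sigma(e)^{-1}\,\mathbb P_\mu(e\in\underline\gamma)^2$ among all pmfs on $\Gamma(A,B)$, where $\underline\gamma$ is a random path with law $\mu$. **Crossing.** Let $\gamma$ be a path from $a\in A$ to $b\in B$. The region below $\gamma$ is the union of the components of $\overline D\setminus\gamma$ that meet the open arc of $\mathcal C$ from $a$ to $b$ containing the bottom. An edge is below $\gamma$ if it is contained in the union of $\gamma$ and the region below $\gamma$. Two paths from $A$ to $B$ are non-crossing if all edges of one of them are below the other; a family is non-crossing if any two of its paths are. A top path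 of a subgraph $H$ of $G$ is a path from $A$ to $B$ in $H$, meeting $A$ only in its first and $B$ only in its last vertex, such that all edges of $H$ are below it. **Non-crossing Minimal Subfamily Algorithm.** Start with $r(e)=\sigma(e)\rho^*(e)$, $e\in E$, where $\rho^*$ is the extremal density of $\Gamma(A,B)$. Repeat: remove the edges with $r(e)=0$; if the remaining graph has no top path, terminate; otherwise add its top path $\gamma$ to the output family, put $m(\gamma)=\min_{e\in\gamma}r(e)$, and replace $r(e)$ by $r(e)-m(\gamma)$ for all $e\in\gamma$. The output is the family of the paths found and the pmf $\gamma\mapsto m(\gamma)/M$ on it, where $M=\sum_\gamma m(\gamma)$. **Proposition.** There is a unique subfamily $\Gamma\subset\Gamma(A,B)$ such that (i) $\Gamma$ is non-crossing; (ii) $\Gamma$ supports a pmf $\mu$ (i.e. $\mu=0$ outside $\Gamma$) that is optimal for $\Gamma(A,B)$; (iii) $\Gamma$ is a minimal subfamily of $\Gamma(A,B)$. The pmf $\mu$ in (ii) is unique. Moreover, the extremal density $\rho^*$ exists and is unique, the algorithm terminates with a well-defined output (it finds each path only once and is never faced with a choice between different top paths), its output is $\Gamma$ and $\mu$, with all $m(\gamma)>0$,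 and $M=\operatorname{Mod}_{2,\sigma}(\Gamma)$. -/

import Mathlib

/-- A weighted multigraph without loops: vertices `V`, edges `E`, edge `e` joins `fst e` and
`snd e` (the order is only a bookkeeping device, edges are undirected) and carries the weight
`σ e > 0`.  Parallel edges are allowed. -/
structure Network (V E : Type*) where
  fst : E → V
  snd : E → V
  fst_ne_snd : ∀ e, fst e ≠ snd e
  σ : E → ℝ
  σ_pos : ∀ e, 0 < σ e

namespace Network

variable {V E : Type*} (G : Network V E)

/-- The edge `e` joins `x` and `y`. -/
def Joins (e : E) (x y : V) : Prop :=
  (G.fst e = x ∧ G.snd e = y) ∨ (G.fst e = y ∧ G.snd e = x)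

/-- The vertex `v` is an end of some edge of `γ`. -/
def Meets (γ : Finset E) (v : V) : Prop :=
  ∃ e ∈ γ, G.fst e = v ∨ G.snd e = v

/-- `γ` is the set of edges `ε 0, …, ε (n - 1)` of a path from `x` to `y`, whose vertices
`x = v 0, v 1, …, v n = y` are all distinct.

Paths are represented by their edge sets: an edge set determines the sequence of edges up to
reversal, hence, when `A` and `B` are disjoint, it determines the path from `A` to `B`. -/
def IsPathFrom (x y : V) (γ : Finset E) : Prop :=
  ∃ (n : ℕ) (v : Fin (n + 1) → V) (ε : Fin n → E),
    Function.Injective v ∧ v 0 = x ∧ v (Fin.last n) = y ∧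
    (∀ k : Fin n, G.Joins (ε k) (v k.castSucc) (v k.succ)) ∧
    (γ : Set E) = Set.range ε

/-- The family `Γ(A, B)` of all paths from `A` to `B`. -/
def pathFamily (A B : Set V) : Set (Finset E) :=
  {γ | ∃ a ∈ A, ∃ b ∈ B, G.IsPathFrom a b γ}

/-- The usage matrix: `1` if the edge `e` belongs to `γ`, and `0` otherwise. -/
noncomputable def usage (γ : Finset E) (e : E) : ℝ :=
  Set.indicator (γ : Set E) (fun _ => (1 : ℝ)) e

variable [Fintype E]

/-- `ρ` is a density which is admissible for the family `Γ`. -/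
def Admissible (Γ : Set (Finset E)) (ρ : E → ℝ) : Prop :=
  (∀ e, 0 ≤ ρ e) ∧ ∀ γ ∈ Γ, 1 ≤ ∑ e, usage γ e * ρ e

/-- The discrete `(2, σ)`-modulus of a family. -/
noncomputable def modulus (Γ : Set (Finset E)) : ℝ :=
  sInf ((fun ρ : E → ℝ => ∑ e, G.σ e * ρ e ^ 2) '' {ρ | Admissible Γ ρ})

/-- `ρ` is an extremal density for the family `Γ`. -/
def IsExtremal (Γ : Set (Finset E)) (ρ : E → ℝ) : Prop :=
  Admissible Γ ρ ∧ ∑ e, G.σ e * ρ e ^ 2 = G.modulus Γ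

/-- `Γ'` is a minimal subfamily of `Γ`. -/
def IsMinimalSubfamily (Γ' Γ : Set (Finset E)) : Prop :=
  Γ' ⊆ Γ ∧ G.modulus Γ' = G.modulus Γ ∧ ∀ γ ∈ Γ', G.modulus (Γ' \ {γ}) < G.modulus Γ

/-- The probability mass functions on the family `Γ`, extended by `0` outside `Γ`. -/
def pmfs (Γ : Set (Finset E)) : Set (Finset E → ℝ) :=
  {μ | μ ∈ stdSimplex ℝ (Finset E) ∧ ∀ γ, γ ∉ Γ → μ γ = 0}

/-- The expected usage of the edge `e` by a random path with law `μ`. -/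
noncomputable def expectedUsage (μ : Finset E → ℝ) (e : E) : ℝ :=
  ∑ γ : Finset E, μ γ * usage γ e

/-- The pmf `μ` on `Γ` is optimal for the probabilistic interpretation of the `(2, σ)`-modulus
of `Γ`: it minimizes `∑ e, σ(e)⁻¹ * 𝔼_μ[usage of e] ^ 2` over all pmfs on `Γ`. -/
def IsOptimalPMF (Γ : Set (Finset E)) (μ : Finset E → ℝ) : Prop :=
  μ ∈ pmfs Γ ∧
    IsMinOn (fun ν : Finset E → ℝ => ∑ e, (G.σ e)⁻¹ * expectedUsage ν e ^ 2) (pmfs Γ) μ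

end Network

/-- A Jordan curve `c` (a `1`-periodic parametrization) with two disjoint closed arcs
`S₁ = c [t₀, t₁]` and `S₂ = c [t₂, t₃]`.  The curve runs through `S₁`, then through the open
"bottom" arc `c (t₁, t₂)`, then through `S₂`, then through the open "top" arc `c (t₃, t₀ + 1)`,
as the counterclockwise boundary of a rectangle with left side `S₁` and right side `S₂` does.
(A clockwise curve is allowed as well; it gives the mirror image of this picture.) -/
structure MarkedJordanCurve where
  c : ℝ → ℂ
  continuous_c : Continuous c
  periodic_c : Function.Periodic c 1
  injOn_c : Set.InjOn c (Set.Ico 0 1)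
  t₀ : ℝ
  t₁ : ℝ
  t₂ : ℝ
  t₃ : ℝ
  t₀_lt_t₁ : t₀ < t₁
  t₁_lt_t₂ : t₁ < t₂
  t₂_lt_t₃ : t₂ < t₃
  t₃_lt : t₃ < t₀ + 1

namespace MarkedJordanCurve

variable (J : MarkedJordanCurve)

/-- The left arc. -/
def S₁ : Set ℂ := J.c '' Set.Icc J.t₀ J.t₁

/-- The right arc. -/
def S₂ : Set ℂ := J.c '' Set.Icc J.t₂ J.t₃

/-- The closed Jordan domain bounded by the curve: the curve, together with the points whose
component in the complement of the curve is bounded (`connectedComponentIn F z` is empty for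
`z ∉ F`, so points of the curve are included). -/
def closedDomain : Set ℂ :=
  {z | Bornology.IsBounded (connectedComponentIn (Set.range J.c)ᶜ z)}

end MarkedJordanCurve

/-- A plane network with boundary.  The network is drawn in the plane: vertices are distinct
points, edges are simple arcs joining their ends, an edge contains no vertex besides its ends, and
two different edges meet in common ends only.  The drawing is encircled by a Jordan curve, which
may touch it; so the curve lies in the closed outer face of the drawing. -/
structure PlaneNetwork (V E : Type*) extends Network V E where
  pos : V → ℂ
  pos_injective : Function.Injective pos
  arc : ∀ e, Path (pos (fst e)) (pos (snd e))
  arc_injective : ∀ e, Function.Injective (arc e)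
  arc_vertex : ∀ e s v, arc e s = pos v → s = 0 ∨ s = 1
  arc_disjoint : ∀ e e', e ≠ e' → ∀ s s', arc e s = arc e' s' → s = 0 ∨ s = 1
  curve : MarkedJordanCurve
  pos_mem : ∀ v, pos v ∈ curve.closedDomain
  arc_mem : ∀ e s, arc e s ∈ curve.closedDomain

namespace PlaneNetwork

variable {V E : Type*} (N : PlaneNetwork V E)

/-- The boundary vertices on the left arc. -/
def A : Set V := {v | N.pos v ∈ N.curve.S₁}

/-- The boundary vertices on the right arc. -/
def B : Set V := {v | N.pos v ∈ N.curve.S₂}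

/-- The family `Γ(A, B)` of all paths from `A` to `B`. -/
def abPaths : Set (Finset E) := N.toNetwork.pathFamily N.A N.B

/-- The subset of the plane covered by the edges of `γ`. -/
def trace (γ : Finset E) : Set ℂ := ⋃ e ∈ γ, Set.range (N.arc e)

/-- The part of the closed Jordan domain strictly below the path `γ` that starts at the boundary
point `c s` on the left arc and ends at the boundary point `c t` on the right arc: the union of
those components of the closed domain slit along `γ` that meet the boundary arc `c (s, t)`, which
runs from the start of `γ` along the bottom to the end of `γ`. -/
def regionBelow (γ : Finset E) (s t : ℝ) : Set ℂ :=
  {z | z ∈ N.curve.closedDomain \ N.trace γ ∧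
    (connectedComponentIn (N.curve.closedDomain \ N.trace γ) z ∩
      N.curve.c '' Set.Ioo s t).Nonempty}

/-- The edge `e` is (weakly) below the path `γ` from `A` to `B`: it is contained in the union of
`γ` and the region below `γ`. -/
def EdgeBelow (e : E) (γ : Finset E) : Prop :=
  ∃ s ∈ Set.Icc N.curve.t₀ N.curve.t₁, ∃ t ∈ Set.Icc N.curve.t₂ N.curve.t₃,
    ∃ a b, N.pos a = N.curve.c s ∧ N.pos b = N.curve.c t ∧ N.toNetwork.IsPathFrom a b γ ∧
      Set.range (N.arc e) ⊆ N.trace γ ∪ N.regionBelow γ s t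

/-- Two paths from `A` to `B` are non-crossing if one of them is on top of the subgraph formed by
both, i.e. all edges of the other one are below it. -/
def NonCrossing (γ γ' : Finset E) : Prop :=
  (∀ e ∈ γ', N.EdgeBelow e γ) ∨ (∀ e ∈ γ, N.EdgeBelow e γ')

/-- `γ` is a top path of the subgraph with edge set `H`: a path from `A` to `B` in `H`, meeting `A`
only in its first and `B` only in its last vertex (so that it slits the domain into a part above
and a part below it), such that all edges of `H` are below `γ`. -/
def IsTopPath (H : Set E) (γ : Finset E) : Prop :=
  (γ : Set E) ⊆ H ∧ γ ∈ N.abPaths ∧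
    {a ∈ N.A | N.toNetwork.Meets γ a}.Subsingleton ∧
    {b ∈ N.B | N.toNetwork.Meets γ b}.Subsingleton ∧
    ∀ e ∈ H, N.EdgeBelow e γ

/-- A complete run of the Non-crossing Minimal Subfamily Algorithm, started with the residual
weights `r`, with the list of the paths found (in this order) and of their weights `m`.

The current graph consists of the edges with `r e ≠ 0`.  If it has no top path, the algorithm
terminates.  Otherwise a top path `γ` is recorded with the weight `m`, the minimum of `r` on `γ`,
this weight is subtracted from `r` on all edges of `γ`, and the algorithm continues. -/
inductive AlgorithmRun : (E → ℝ) → List (Finset E × ℝ) → Prop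
  | halt (r : E → ℝ) (h : ¬ ∃ γ, N.IsTopPath {e | r e ≠ 0} γ) : AlgorithmRun r []
  | step (r : E → ℝ) (γ : Finset E) (m : ℝ) (out : List (Finset E × ℝ))
      (hγ : N.IsTopPath {e | r e ≠ 0} γ)
      (hm : IsLeast (r '' (γ : Set E)) m)
      (hout : AlgorithmRun (fun e => r e - m * Network.usage γ e) out) :
      AlgorithmRun r ((γ, m) :: out)

end PlaneNetwork

section

open Set Filter Topology Metric Complex

theorem IsPreconnected.eq_of_locally_eq {α β : Type*} [TopologicalSpace α] {S : Set α}
    (hS : IsPreconnected S) {f : α → β} (h : ∀ z ∈ S, ∀ᶠ z' in 𝓝[S] z, f z' = f z)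
    {x y : α} (hx : x ∈ S) (hy : y ∈ S) : f x = f y := by
  let _ : TopologicalSpace β := ⊥
  have : DiscreteTopology β := ⟨rfl⟩
  refine hS.constant (fun z hz => ?_) hx hy
  have : Tendsto f (𝓝[S] z) (pure (f z)) := tendsto_pure.2 (h z hz)
  exact this.mono_right (pure_le_nhds _)

theorem IsPreconnected.iff_of_locally_iff {α : Type*} [TopologicalSpace α] {S : Set α}
    (hS : IsPreconnected S) {P : α → Prop} (h : ∀ z ∈ S, ∀ᶠ z' in 𝓝[S] z, (P z' ↔ P z))
    {x y : α} (hx : x ∈ S) (hy : y ∈ S) : P x ↔ P y := by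
  have := hS.eq_of_locally_eq (f := P) (fun z hz => (h z hz).mono fun z' h => propext h) hx hy
  rw [this]

namespace Complex

theorem eq_zero_of_exp_eq_one {w : ℂ} (h : exp w = 1) (hw : ‖w‖ < 1) : w = 0 := by
  obtain ⟨n, rfl⟩ := exp_eq_one_iff.1 h
  by_cases hn : n = 0
  · simp [hn]
  · exfalso
    have h1 : (1 : ℝ) ≤ |(n : ℝ)| := by exact_mod_cast Int.one_le_abs hn
    have h2 : ‖(n : ℂ) * (2 * Real.pi * I)‖ = |(n : ℝ)| * (2 * Real.pi) := by
      simp [abs_of_pos Real.pi_pos]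
    rw [h2] at hw
    nlinarith [Real.pi_gt_three]

/-- A continuous function on a connected set with constant exponential is constant. -/
theorem eq_of_exp_eq_const {α : Type*} [TopologicalSpace α] {S : Set α} (hS : IsPreconnected S)
    {f : α → ℂ} (hf : ContinuousOn f S) {c : ℂ} (h : ∀ z ∈ S, exp (f z) = c)
    {x y : α} (hx : x ∈ S) (hy : y ∈ S) : f x = f y := by
  refine hS.eq_of_locally_eq (fun z hz => ?_) hx hy
  have h1 : ∀ᶠ z' in 𝓝[S] z, dist (f z') (f z) < 1 :=
    (hf z hz).eventually (Metric.ball_mem_nhds _ one_pos)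
  filter_upwards [h1, self_mem_nhdsWithin] with z' h2 h3
  rw [← sub_eq_zero]
  refine eq_zero_of_exp_eq_one ?_ (by rwa [dist_eq_norm] at h2)
  rw [exp_sub, h _ h3, h _ hz, div_self]
  rw [← h _ hz]
  exact exp_ne_zero _

theorem exists_continuous_log {X : Type*} [NormedAddCommGroup X] [NormedSpace ℝ X] {f : X → ℂ}
    (hf : Continuous f) (h0 : ∀ x, f x ≠ 0) : ∃ L : X → ℂ, Continuous L ∧ ∀ x, exp (L x) = f x := by
  have hU : IsSimplyConnected (univ : Set X) := by
    have : ContractibleSpace (univ : Set X) := (convex_univ (𝕜 := ℝ)).contractibleSpace univ_nonempty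
    exact (inferInstance : SimplyConnectedSpace (univ : Set X))
  obtain ⟨l, hl, hle⟩ := exists_continuousOn_eqOn_exp_comp hU isOpen_univ hf.continuousOn
    (by rintro ⟨t, -, ht⟩; exact h0 t ht)
  exact ⟨l, continuousOn_univ.1 hl, fun x => hle (mem_univ x)⟩

/-- `f` has a continuous logarithm on `K`. -/
def HasLogOn (f : ℂ → ℂ) (K : Set ℂ) : Prop :=
  ∃ L : ℂ → ℂ, ContinuousOn L K ∧ ∀ z ∈ K, exp (L z) = f z

/-- A continuum on which every nonvanishing continuous function has a continuous logarithm. -/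
structure IsLogContinuum (K : Set ℂ) : Prop where
  isCompact : IsCompact K
  isPreconnected : IsPreconnected K
  hasLogOn : ∀ f, ContinuousOn f K → (∀ z ∈ K, f z ≠ 0) → HasLogOn f K

theorem IsLogContinuum.isClosed {K : Set ℂ} (hK : IsLogContinuum K) : IsClosed K :=
  hK.isCompact.isClosed

theorem isLogContinuum_image_Icc {g : ℝ → ℂ} {a b : ℝ} (hab : a ≤ b)
    (hg : ContinuousOn g (Icc a b)) (inj : InjOn g (Icc a b)) :
    IsLogContinuum (g '' Icc a b) := by
  refine ⟨isCompact_Icc.image_of_continuousOn hg, isPreconnected_Icc.image _ hg, ?_⟩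
  intro f hf hf0
  have hcont : Continuous (fun t : ℝ => f (g (projIcc a b hab t))) := by
    have h1 : Continuous (fun t : Icc a b => f (g t)) := by
      rw [continuousOn_iff_continuous_domRestrict] at hg
      have : ContinuousOn (f ∘ g) (Icc a b) :=
        hf.comp (continuousOn_iff_continuous_domRestrict.2 hg) (fun t ht => ⟨t, ht, rfl⟩)
      exact continuousOn_iff_continuous_domRestrict.1 this
    exact h1.comp continuous_projIcc
  obtain ⟨l, hl, hle⟩ := exists_continuous_log hcont
    fun t => hf0 _ ⟨_, (projIcc a b hab t).2, rfl⟩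
  have hleft : ∀ t ∈ Icc a b, Function.invFunOn g (Icc a b) (g t) = t := fun t ht =>
    inj.leftInvOn_invFunOn ht
  refine ⟨fun z => l (Function.invFunOn g (Icc a b) z), ?_, ?_⟩
  · have hemb : IsClosedEmbedding (fun t : Icc a b => g t) := by
      refine Continuous.isClosedEmbedding (continuousOn_iff_continuous_domRestrict.1 hg) ?_
      intro s t hst
      exact Subtype.ext (inj s.2 t.2 hst)
    have him : g '' Icc a b = (fun t : Icc a b => g t) '' univ := by
      ext z; simp
    rw [him, hemb.isInducing.continuousOn_image_iff]
    have : ContinuousOn (fun t : Icc a b => l t) univ :=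
      (hl.comp continuous_subtype_val).continuousOn
    refine this.congr fun t _ => ?_
    simp [hleft t t.2]
  · rintro _ ⟨t, ht, rfl⟩
    have := hle t
    simp only [projIcc_of_mem hab ht] at this
    simp only [hleft t ht, this]

theorem isLogContinuum_singleton (x : ℂ) : IsLogContinuum {x} := by
  have := isLogContinuum_image_Icc (g := fun _ => x) (le_refl (0 : ℝ)) continuousOn_const
    (by intro s hs t ht _; simp at hs ht; rw [hs, ht])
  simpa using this

/-- Glueing of logarithms. -/
theorem HasLogOn.union {f : ℂ → ℂ} {K₁ K₂ : Set ℂ} {x y : ℂ} (h₁ : IsClosed K₁)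
    (h₂ : IsClosed K₂) (hK : K₁ ∩ K₂ ⊆ {x, y}) (hx₁ : x ∈ K₁) (hx₂ : x ∈ K₂)
    {L₁ L₂ : ℂ → ℂ} (hL₁ : ContinuousOn L₁ K₁) (hL₂ : ContinuousOn L₂ K₂)
    (he₁ : ∀ z ∈ K₁, exp (L₁ z) = f z) (he₂ : ∀ z ∈ K₂, exp (L₂ z) = f z)
    (hxy : L₁ y - L₁ x = L₂ y - L₂ x) : HasLogOn f (K₁ ∪ K₂) := by
  classical
  set L : ℂ → ℂ := fun z => if z ∈ K₁ then L₁ z else L₂ z + (L₁ x - L₂ x) with hL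
  have e1 : EqOn L L₁ K₁ := fun z hz => by simp [hL, hz]
  have e2 : EqOn L (fun z => L₂ z + (L₁ x - L₂ x)) K₂ := by
    intro z hz
    by_cases hz1 : z ∈ K₁
    · have : z = x ∨ z = y := hK ⟨hz1, hz⟩
      simp only [hL, hz1, if_true]
      rcases this with rfl | rfl
      · ring
      · linear_combination hxy
    · simp [hL, hz1]
  refine ⟨L, ContinuousOn.union_of_isClosed (hL₁.congr e1)
    ((hL₂.add continuousOn_const).congr e2) h₁ h₂, ?_⟩
  rintro z (hz | hz)
  · rw [e1 hz, he₁ z hz]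
  · rw [e2 hz]
    simp only [exp_add, exp_sub, he₁ x hx₁, he₂ x hx₂, he₂ z hz]
    rw [div_self, mul_one]
    rw [← he₁ x hx₁]
    exact exp_ne_zero _

theorem IsLogContinuum.union {K₁ K₂ : Set ℂ} {x : ℂ} (h₁ : IsLogContinuum K₁)
    (h₂ : IsLogContinuum K₂) (hK : K₁ ∩ K₂ = {x}) : IsLogContinuum (K₁ ∪ K₂) := by
  have hx : x ∈ K₁ ∩ K₂ := by simp [hK]
  refine ⟨h₁.isCompact.union h₂.isCompact,
    h₁.isPreconnected.union x hx.1 hx.2 h₂.isPreconnected, fun f hf hf0 => ?_⟩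
  obtain ⟨L₁, c₁, e₁⟩ := h₁.hasLogOn f (hf.mono subset_union_left) fun z hz => hf0 z (.inl hz)
  obtain ⟨L₂, c₂, e₂⟩ := h₂.hasLogOn f (hf.mono subset_union_right) fun z hz => hf0 z (.inr hz)
  exact HasLogOn.union (x := x) (y := x) h₁.isClosed h₂.isClosed (by simp [hK]) hx.1 hx.2 c₁ c₂
    e₁ e₂ (by ring)

/-- The increment, from `x` to `y`, of a continuous logarithm of `w ↦ w - z` on `K`. -/
noncomputable def logIncrement (K : Set ℂ) (x y z : ℂ) : ℂ :=
  let L := Classical.epsilon fun L : ℂ → ℂ => ContinuousOn L K ∧ ∀ w ∈ K, exp (L w) = w - z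
  L y - L x

theorem logIncrement_eq {K : Set ℂ} (hK : IsPreconnected K) {x y z : ℂ} (hx : x ∈ K) (hy : y ∈ K)
    {L : ℂ → ℂ} (hL : ContinuousOn L K) (he : ∀ w ∈ K, exp (L w) = w - z) :
    logIncrement K x y z = L y - L x := by
  have hspec := Classical.epsilon_spec
    (p := fun L : ℂ → ℂ => ContinuousOn L K ∧ ∀ w ∈ K, exp (L w) = w - z) ⟨L, hL, he⟩
  unfold logIncrement
  set L' := Classical.epsilon fun L : ℂ → ℂ => ContinuousOn L K ∧ ∀ w ∈ K, exp (L w) = w - z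
  have := eq_of_exp_eq_const hK (f := fun w => L' w - L w) (hspec.1.sub hL) (c := 1)
    (fun w hw => by
      rw [exp_sub, hspec.2 w hw, he w hw, div_self]
      rw [← he w hw]; exact exp_ne_zero _) hx hy
  simp only at this ⊢
  linear_combination -this

theorem IsLogContinuum.exists_log {K : Set ℂ} (hK : IsLogContinuum K) {z : ℂ} (hz : z ∉ K) :
    ∃ L : ℂ → ℂ, ContinuousOn L K ∧ ∀ w ∈ K, exp (L w) = w - z :=
  hK.hasLogOn (fun w => w - z) (by fun_prop) fun w hw h => hz (by rwa [sub_eq_zero.1 h] at hw)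

theorem logIncrement_mono {K K' : Set ℂ} (hK : IsLogContinuum K) (hK' : IsPreconnected K')
    (h : K' ⊆ K) {x y z : ℂ} (hx : x ∈ K') (hy : y ∈ K') (hz : z ∉ K) :
    logIncrement K' x y z = logIncrement K x y z := by
  obtain ⟨L, hL, he⟩ := hK.exists_log hz
  rw [logIncrement_eq hK.isPreconnected (h hx) (h hy) hL he,
    logIncrement_eq hK' hx hy (hL.mono h) fun w hw => he w (h hw)]

theorem logIncrement_add {K : Set ℂ} (hK : IsLogContinuum K) {x y w z : ℂ} (hx : x ∈ K)
    (hy : y ∈ K) (hw : w ∈ K) (hz : z ∉ K) :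
    logIncrement K x w z + logIncrement K w y z = logIncrement K x y z := by
  obtain ⟨L, hL, he⟩ := hK.exists_log hz
  rw [logIncrement_eq hK.isPreconnected hx hw hL he,
    logIncrement_eq hK.isPreconnected hw hy hL he, logIncrement_eq hK.isPreconnected hx hy hL he]
  ring

theorem exp_logIncrement {K : Set ℂ} (hK : IsLogContinuum K) {x y z : ℂ} (hx : x ∈ K)
    (hy : y ∈ K) (hz : z ∉ K) : exp (logIncrement K x y z) = (y - z) / (x - z) := by
  obtain ⟨L, hL, he⟩ := hK.exists_log hz
  rw [logIncrement_eq hK.isPreconnected hx hy hL he, exp_sub, he y hy, he x hx]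

theorem one_add_mem_slitPlane {w : ℂ} (hw : ‖w‖ < 1) : 1 + w ∈ slitPlane := by
  left
  have := abs_le.1 (abs_re_le_norm w)
  simp only [add_re, one_re]
  linarith [this.1]

theorem logIncrement_near {K : Set ℂ} (hK : IsLogContinuum K) {x y z z' : ℂ} (hx : x ∈ K)
    (hy : y ∈ K) (hz' : ∀ w ∈ K, ‖z' - z‖ < ‖w - z‖) :
    logIncrement K x y z' = logIncrement K x y z +
      (log (1 + (z - z') / (y - z)) - log (1 + (z - z') / (x - z))) := by
  have hz : z ∉ K := fun h => by
    have := hz' z h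
    simp only [sub_self, norm_zero] at this
    exact absurd (norm_nonneg _) (not_le.2 this)
  obtain ⟨L, hL, he⟩ := hK.exists_log hz
  have h0 : ∀ w ∈ K, w - z ≠ 0 := fun w hw h => hz (by rwa [sub_eq_zero.1 h] at hw)
  have hs : ∀ w ∈ K, 1 + (z - z') / (w - z) ∈ slitPlane := fun w hw => by
    apply one_add_mem_slitPlane
    rw [norm_div, div_lt_one (norm_pos_iff.2 (h0 w hw)), norm_sub_rev]
    exact hz' w hw
  rw [logIncrement_eq hK.isPreconnected hx hy hL he,
    logIncrement_eq hK.isPreconnected hx hy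
      (L := fun w => L w + log (1 + (z - z') / (w - z))) ?_ ?_]
  · ring
  · refine hL.add (ContinuousOn.clog ?_ hs)
    exact continuousOn_const.add (continuousOn_const.div (by fun_prop) h0)
  · intro w hw
    rw [exp_add, he w hw, exp_log (slitPlane_ne_zero (hs w hw))]
    field_simp [h0 w hw]
    ring

theorem logIncrement_far {K : Set ℂ} (hK : IsLogContinuum K) {x y z : ℂ} (hx : x ∈ K)
    (hy : y ∈ K) (hz : ∀ w ∈ K, ‖w‖ < ‖z‖) :
    logIncrement K x y z = log (1 + -y / z) - log (1 + -x / z) := by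
  have h0 : z ≠ 0 := by
    rintro rfl
    have := hz x hx
    simp only [norm_zero] at this
    exact absurd (norm_nonneg _) (not_le.2 this)
  have hs : ∀ w ∈ K, 1 + -w / z ∈ slitPlane := fun w hw => by
    apply one_add_mem_slitPlane
    rw [norm_div, div_lt_one (norm_pos_iff.2 h0), norm_neg]
    exact hz w hw
  rw [logIncrement_eq hK.isPreconnected hx hy
      (L := fun w => log (-z) + log (1 + -w / z)) ?_ ?_]
  · ring
  · refine continuousOn_const.add (ContinuousOn.clog (by fun_prop) hs)
  · intro w hw
    rw [exp_add, exp_log (neg_ne_zero.2 h0), exp_log (slitPlane_ne_zero (hs w hw))]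
    field_simp
    ring

theorem eventually_forall_norm_lt {K : Set ℂ} (hK : IsClosed K) {z : ℂ} (hz : z ∉ K) :
    ∀ᶠ z' in 𝓝 z, ∀ w ∈ K, ‖z' - z‖ < ‖w - z‖ := by
  obtain ⟨ε, hε, h⟩ := Metric.isOpen_iff.1 hK.isOpen_compl z hz
  filter_upwards [Metric.ball_mem_nhds z hε] with z' hz' w hw
  have h1 : ε ≤ dist w z := by
    by_contra hlt
    exact h (Metric.mem_ball.2 (not_le.1 hlt)) hw
  rw [← dist_eq_norm, ← dist_eq_norm]
  exact lt_of_lt_of_le hz' h1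

theorem continuousOn_logIncrement {K : Set ℂ} (hK : IsLogContinuum K) {x y : ℂ} (hx : x ∈ K)
    (hy : y ∈ K) : ContinuousOn (logIncrement K x y) Kᶜ := by
  intro z hz
  apply ContinuousAt.continuousWithinAt
  have h1 : ContinuousAt (fun z' => logIncrement K x y z +
      (log (1 + (z - z') / (y - z)) - log (1 + (z - z') / (x - z)))) z := by
    have : ∀ w : ℂ, ContinuousAt (fun z' => log (1 + (z - z') / (w - z))) z := fun w => by
      refine ContinuousAt.clog (by fun_prop) ?_
      simp
    exact continuousAt_const.add ((this y).sub (this x))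
  refine h1.congr ?_
  filter_upwards [eventually_forall_norm_lt hK.isClosed hz] with z' hz'
  exact (logIncrement_near hK hx hy hz').symm

theorem eventually_logIncrement_sub_eq {K₁ K₂ : Set ℂ} (h₁ : IsLogContinuum K₁)
    (h₂ : IsLogContinuum K₂) {x y z : ℂ} (hx₁ : x ∈ K₁) (hy₁ : y ∈ K₁) (hx₂ : x ∈ K₂)
    (hy₂ : y ∈ K₂) (hz₁ : z ∉ K₁) (hz₂ : z ∉ K₂) :
    ∀ᶠ z' in 𝓝 z, logIncrement K₁ x y z' - logIncrement K₂ x y z' =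
      logIncrement K₁ x y z - logIncrement K₂ x y z := by
  filter_upwards [eventually_forall_norm_lt h₁.isClosed hz₁,
    eventually_forall_norm_lt h₂.isClosed hz₂] with z' e₁ e₂
  rw [logIncrement_near h₁ hx₁ hy₁ e₁, logIncrement_near h₂ hx₂ hy₂ e₂]
  ring

theorem logIncrement_sub_eq_of_isPreconnected {K₁ K₂ S : Set ℂ} (h₁ : IsLogContinuum K₁)
    (h₂ : IsLogContinuum K₂) {x y z z' : ℂ} (hx₁ : x ∈ K₁) (hy₁ : y ∈ K₁) (hx₂ : x ∈ K₂)
    (hy₂ : y ∈ K₂) (hS : IsPreconnected S) (hS₁ : Disjoint S K₁) (hS₂ : Disjoint S K₂)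
    (hz : z ∈ S) (hz' : z' ∈ S) : logIncrement K₁ x y z - logIncrement K₂ x y z =
      logIncrement K₁ x y z' - logIncrement K₂ x y z' :=
  hS.eq_of_locally_eq (f := fun z => logIncrement K₁ x y z - logIncrement K₂ x y z)
    (fun _ hw => (eventually_logIncrement_sub_eq h₁ h₂ hx₁ hy₁ hx₂ hy₂
      (disjoint_left.1 hS₁ hw) (disjoint_left.1 hS₂ hw)).filter_mono nhdsWithin_le_nhds) hz hz'

theorem logIncrement_eq_of_not_isBounded {K₁ K₂ S : Set ℂ} (h₁ : IsLogContinuum K₁)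
    (h₂ : IsLogContinuum K₂) {x y z : ℂ} (hx₁ : x ∈ K₁) (hy₁ : y ∈ K₁) (hx₂ : x ∈ K₂)
    (hy₂ : y ∈ K₂) (hS : IsPreconnected S) (hS₁ : Disjoint S K₁) (hS₂ : Disjoint S K₂)
    (hb : ¬ Bornology.IsBounded S) (hz : z ∈ S) :
    logIncrement K₁ x y z = logIncrement K₂ x y z := by
  obtain ⟨R, hR⟩ := (h₁.isCompact.union h₂.isCompact).isBounded.exists_norm_le
  obtain ⟨z', hz', hlt⟩ : ∃ z' ∈ S, R < ‖z'‖ := by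
    by_contra! h
    exact hb (isBounded_iff_forall_norm_le.2 ⟨R, h⟩)
  rw [← sub_eq_zero, logIncrement_sub_eq_of_isPreconnected h₁ h₂ hx₁ hy₁ hx₂ hy₂ hS hS₁ hS₂ hz hz',
    logIncrement_far h₁ hx₁ hy₁ fun w hw => (hR w (.inl hw)).trans_lt hlt,
    logIncrement_far h₂ hx₂ hy₂ fun w hw => (hR w (.inr hw)).trans_lt hlt, sub_self]

end Complex

theorem isPreconnected_setOf_lt_norm {R : ℝ} (hR : 0 < R) :
    IsPreconnected {z : ℂ | R < ‖z‖} := by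
  have : {z : ℂ | R < ‖z‖} = Complex.exp '' {w : ℂ | Real.log R < w.re} := by
    ext z
    constructor
    · intro hz
      have hz' : R < ‖z‖ := hz
      have h0 : z ≠ 0 := norm_pos_iff.1 (hR.trans hz')
      refine ⟨Complex.log z, ?_, Complex.exp_log h0⟩
      simp only [mem_ofPred_eq, Complex.log_re]
      exact Real.log_lt_log hR hz'
    · rintro ⟨w, hw, rfl⟩
      simp only [mem_ofPred_eq, Complex.norm_exp] at hw ⊢
      exact (Real.log_lt_iff_lt_exp hR).1 hw
  rw [this]
  exact (convex_halfSpace_re_gt _).isPreconnected.image _ Complex.continuous_exp.continuousOn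

theorem connectedComponentIn_eq_of_not_isBounded {K : Set ℂ} (hK : Bornology.IsBounded K)
    {z z' : ℂ} (hz : ¬ Bornology.IsBounded (connectedComponentIn Kᶜ z))
    (hz' : ¬ Bornology.IsBounded (connectedComponentIn Kᶜ z')) :
    connectedComponentIn Kᶜ z = connectedComponentIn Kᶜ z' := by
  obtain ⟨R, hR⟩ := hK.exists_norm_le
  set R' := max R 1
  have hpre := isPreconnected_setOf_lt_norm (R := R') (lt_of_lt_of_le one_pos (le_max_right _ _))
  have hsub : {w : ℂ | R' < ‖w‖} ⊆ Kᶜ := fun w hw hwK =>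
    absurd (hR w hwK) (not_le.2 ((le_max_left _ _).trans_lt hw))
  have key : ∀ z, ¬ Bornology.IsBounded (connectedComponentIn Kᶜ z) →
      ∃ w, R' < ‖w‖ ∧ connectedComponentIn Kᶜ z = connectedComponentIn Kᶜ w := by
    intro z hz
    obtain ⟨w, hw, hlt⟩ : ∃ w ∈ connectedComponentIn Kᶜ z, R' < ‖w‖ := by
      by_contra! h
      exact hz (isBounded_iff_forall_norm_le.2 ⟨R', h⟩)
    exact ⟨w, hlt, connectedComponentIn_eq hw⟩
  obtain ⟨w, hw, e⟩ := key z hz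
  obtain ⟨w', hw', e'⟩ := key z' hz'
  rw [e, e']
  exact connectedComponentIn_eq (hpre.subset_connectedComponentIn hw hsub hw')

theorem closure_connectedComponentIn_compl_subset {K : Set ℂ} (hK : IsClosed K) (z : ℂ) :
    closure (connectedComponentIn Kᶜ z) ⊆ connectedComponentIn Kᶜ z ∪ K := by
  intro w hw
  by_contra h
  rw [mem_union, not_or] at h
  obtain ⟨u, hu, hu'⟩ := mem_closure_iff.1 hw (connectedComponentIn Kᶜ w)
    hK.isOpen_compl.connectedComponentIn (mem_connectedComponentIn h.2)
  apply h.1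
  rw [connectedComponentIn_eq hu', ← connectedComponentIn_eq hu]
  exact mem_connectedComponentIn h.2

namespace Complex

theorem eq_zero_of_exp_eq_zpow_on_sphere {p : ℂ} {R : ℝ} (hR : 0 < R) {n : ℤ} {L : ℂ → ℂ}
    (hL : ContinuousOn L (sphere p R)) (he : ∀ z ∈ sphere p R, exp (L z) = (z - p) ^ n) :
    n = 0 := by
  have hmem : ∀ θ : ℝ, circleMap p R θ ∈ sphere p R := circleMap_mem_sphere p hR.le
  have hcont : Continuous fun θ : ℝ => L (circleMap p R θ) - n * (θ * I) := by
    refine (hL.comp_continuous (continuous_circleMap p R) hmem).sub (by fun_prop)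
  have h1 : ∀ θ : ℝ, exp (L (circleMap p R θ) - n * (θ * I)) = (R : ℂ) ^ n := by
    intro θ
    have h2 : circleMap p R θ - p = R * exp (θ * I) := by simp [circleMap]
    rw [exp_sub, he _ (hmem θ), h2, exp_int_mul, mul_zpow, mul_div_assoc, div_self, mul_one]
    exact zpow_ne_zero _ (exp_ne_zero _)
  have h3 := eq_of_exp_eq_const isPreconnected_univ hcont.continuousOn (fun z _ => h1 z)
    (mem_univ 0) (mem_univ (2 * Real.pi))
  have h4 : circleMap p R (2 * Real.pi) = circleMap p R 0 := by
    have := periodic_circleMap p R 0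
    simpa using this
  rw [h4] at h3
  have h5 : (n : ℂ) * ((2 * Real.pi : ℝ) * I) = 0 := by
    simp only [ofReal_zero, zero_mul, mul_zero, sub_zero] at h3
    linear_combination h3
  have h6 : ((2 * Real.pi : ℝ) : ℂ) ≠ 0 := by exact_mod_cast Real.two_pi_pos.ne'
  simpa [Real.pi_ne_zero] using h5

theorem eq_zero_of_hasLogOn {K : Set ℂ} (hK : IsCompact K) {z₁ z₂ : ℂ} (hz₁ : z₁ ∉ K)
    (hz₂ : z₂ ∉ K) (hU : Bornology.IsBounded (connectedComponentIn Kᶜ z₁))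
    (hz₂U : z₂ ∉ connectedComponentIn Kᶜ z₁) {n m : ℤ}
    (hlog : HasLogOn (fun z => (z - z₁) ^ n * (z - z₂) ^ m) K) : n = 0 := by
  classical
  obtain ⟨L, hL, he⟩ := hlog
  obtain ⟨G, hG⟩ := ContinuousMap.exists_restrict_eq hK.isClosed
    (⟨K.domRestrict L, continuousOn_iff_continuous_domRestrict.1 hL⟩ : C(K, ℂ))
  have hGL : ∀ z ∈ K, G z = L z := fun z hz => congrArg (fun f : C(K, ℂ) => f ⟨z, hz⟩) hG
  set U := connectedComponentIn Kᶜ z₁ with hUdef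
  have hUo : IsOpen U := hK.isClosed.isOpen_compl.connectedComponentIn
  have hzU : z₁ ∈ U := mem_connectedComponentIn hz₁
  have hcl : closure U ⊆ U ∪ K := closure_connectedComponentIn_compl_subset hK.isClosed z₁
  have hUK : ∀ z ∈ U, z ∉ K := fun z hz => connectedComponentIn_subset _ _ hz
  have hne₂ : ∀ z ∈ U ∪ K, z - z₂ ≠ 0 := by
    intro z hz h
    rw [sub_eq_zero] at h
    subst h
    exact hz.elim hz₂U hz₂
  have hne₁ : ∀ z ∉ U, z - z₁ ≠ 0 := by
    intro z hz h
    rw [sub_eq_zero] at h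
    subst h
    exact hz hzU
  set Φ : ℂ → ℂ := fun z => if z ∈ U then exp (G z) * (z - z₂) ^ (-m) else (z - z₁) ^ n with hΦ
  have hΦU : EqOn Φ (fun z => exp (G z) * (z - z₂) ^ (-m)) (closure U) := by
    intro z hz
    by_cases hzU' : z ∈ U
    · simp [hΦ, hzU']
    · have hzK : z ∈ K := (hcl hz).resolve_left hzU'
      simp only [hΦ, hzU', if_false, hGL z hzK, he z hzK]
      rw [mul_assoc, ← zpow_add₀ (hne₂ z (.inr hzK))]
      simp
  have hΦU' : EqOn Φ (fun z => (z - z₁) ^ n) Uᶜ := fun z hz => by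
    simp only [hΦ, if_neg (show z ∉ U from hz)]
  have hΦc : Continuous Φ := by
    rw [← continuousOn_univ, ← union_compl_self U]
    have : ContinuousOn Φ (closure U ∪ Uᶜ) := by
      refine ContinuousOn.union_of_isClosed (ContinuousOn.congr ?_ hΦU)
        (ContinuousOn.congr ?_ hΦU') isClosed_closure hUo.isClosed_compl
      · refine ContinuousOn.mul (by fun_prop) (ContinuousOn.zpow₀ (by fun_prop) _ fun z hz => ?_)
        exact .inl (hne₂ z (hcl hz))
      · exact ContinuousOn.zpow₀ (by fun_prop) _ fun z hz => .inl (hne₁ z hz)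
    exact this.mono (union_subset_union_left _ subset_closure)
  have hΦ0 : ∀ z, Φ z ≠ 0 := by
    intro z
    by_cases hz : z ∈ U
    · rw [hΦU (subset_closure hz)]
      exact mul_ne_zero (exp_ne_zero _) (zpow_ne_zero _ (hne₂ z (.inl hz)))
    · rw [hΦU' hz]
      exact zpow_ne_zero _ (hne₁ z hz)
  obtain ⟨l, hl, hle⟩ := exists_continuous_log hΦc hΦ0
  obtain ⟨R, hR0, hR⟩ := hU.subset_ball_lt 0 z₁
  refine eq_zero_of_exp_eq_zpow_on_sphere hR0 (p := z₁) (L := l) hl.continuousOn fun z hz => ?_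
  rw [hle, hΦU']
  intro hzU'
  exact (mem_ball.1 (hR hzU')).ne (mem_sphere.1 hz)

theorem not_isBounded_of_hasLogOn {K : Set ℂ} (hK : IsCompact K) {z : ℂ} (hz : z ∉ K)
    (hlog : HasLogOn (fun w => w - z) K) :
    ¬ Bornology.IsBounded (connectedComponentIn Kᶜ z) := by
  intro hU
  obtain ⟨R, hR⟩ := (hK.isBounded.union hU).exists_norm_le
  have hz₂ : ((max R 0 + 1 : ℝ) : ℂ) ∉ K ∪ connectedComponentIn Kᶜ z := fun h => by
    have h1 := hR _ h
    rw [norm_real, Real.norm_eq_abs] at h1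
    have := le_abs_self (max R 0 + 1)
    linarith [le_max_left R 0]
  rw [mem_union, not_or] at hz₂
  have := eq_zero_of_hasLogOn hK hz hz₂.1 hU hz₂.2 (n := 1) (m := 0) (by simpa using hlog)
  exact one_ne_zero this

theorem IsLogContinuum.not_isBounded {K : Set ℂ} (hK : IsLogContinuum K) {z : ℂ} (hz : z ∉ K) :
    ¬ Bornology.IsBounded (connectedComponentIn Kᶜ z) :=
  not_isBounded_of_hasLogOn hK.isCompact hz (hK.exists_log hz)

theorem IsLogContinuum.isPreconnected_compl {K : Set ℂ} (hK : IsLogContinuum K) :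
    IsPreconnected Kᶜ := by
  refine isPreconnected_of_forall_pair fun z hz z' hz' => ⟨connectedComponentIn Kᶜ z,
    connectedComponentIn_subset _ _, mem_connectedComponentIn hz, ?_,
    isPreconnected_connectedComponentIn⟩
  rw [connectedComponentIn_eq_of_not_isBounded hK.isCompact.isBounded (hK.not_isBounded hz)
    (hK.not_isBounded hz')]
  exact mem_connectedComponentIn hz'

/-- The difference of the logarithmic increments along the two sides of a closed curve does not
vanish in the bounded components of the complement. -/
theorem logIncrement_ne_of_isBounded {K₁ K₂ : Set ℂ} (h₁ : IsLogContinuum K₁)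
    (h₂ : IsLogContinuum K₂) {x y z : ℂ} (hK : K₁ ∩ K₂ = {x, y}) (hz : z ∉ K₁ ∪ K₂)
    (hb : Bornology.IsBounded (connectedComponentIn (K₁ ∪ K₂)ᶜ z)) :
    logIncrement K₁ x y z ≠ logIncrement K₂ x y z := by
  intro h
  have hx : x ∈ K₁ ∩ K₂ := by simp [hK]
  have hy : y ∈ K₁ ∩ K₂ := by simp [hK]
  obtain ⟨L₁, c₁, e₁⟩ := h₁.exists_log fun h => hz (.inl h)
  obtain ⟨L₂, c₂, e₂⟩ := h₂.exists_log fun h => hz (.inr h)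
  rw [logIncrement_eq h₁.isPreconnected hx.1 hy.1 c₁ e₁,
    logIncrement_eq h₂.isPreconnected hx.2 hy.2 c₂ e₂] at h
  exact not_isBounded_of_hasLogOn (h₁.isCompact.union h₂.isCompact) hz
    (HasLogOn.union h₁.isClosed h₂.isClosed hK.subset hx.1 hx.2 c₁ c₂ e₁ e₂ h) hb

theorem exists_int_logIncrement_sub {K₁ K₂ : Set ℂ} (h₁ : IsLogContinuum K₁)
    (h₂ : IsLogContinuum K₂) {x y z : ℂ} (hx₁ : x ∈ K₁) (hy₁ : y ∈ K₁) (hx₂ : x ∈ K₂)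
    (hy₂ : y ∈ K₂) (hz₁ : z ∉ K₁) (hz₂ : z ∉ K₂) :
    ∃ k : ℤ, logIncrement K₁ x y z - logIncrement K₂ x y z = k * (2 * Real.pi * I) := by
  refine exp_eq_one_iff.1 ?_
  rw [exp_sub, exp_logIncrement h₁ hx₁ hy₁ hz₁, exp_logIncrement h₂ hx₂ hy₂ hz₂, div_self]
  refine div_ne_zero ?_ ?_
  · exact fun h => hz₁ (by rwa [sub_eq_zero.1 h] at hy₁)
  · exact fun h => hz₁ (by rwa [sub_eq_zero.1 h] at hx₁)

/-- A simple closed curve has the same winding number about any two points at which the winding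
number does not vanish. -/
theorem logIncrement_sub_unique {K₁ K₂ : Set ℂ} (h₁ : IsLogContinuum K₁)
    (h₂ : IsLogContinuum K₂) {x y z₁ z₂ : ℂ} (hK : K₁ ∩ K₂ = {x, y}) (hz₁ : z₁ ∉ K₁ ∪ K₂)
    (hz₂ : z₂ ∉ K₁ ∪ K₂) (hne₁ : logIncrement K₁ x y z₁ ≠ logIncrement K₂ x y z₁)
    (hne₂ : logIncrement K₁ x y z₂ ≠ logIncrement K₂ x y z₂) :
    logIncrement K₁ x y z₁ - logIncrement K₂ x y z₁ =
      logIncrement K₁ x y z₂ - logIncrement K₂ x y z₂ := by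
  by_contra hne
  have hx : x ∈ K₁ ∩ K₂ := by simp [hK]
  have hy : y ∈ K₁ ∩ K₂ := by simp [hK]
  have hd₁ : Disjoint (connectedComponentIn (K₁ ∪ K₂)ᶜ z₁) K₁ :=
    disjoint_left.2 fun w hw hwK => connectedComponentIn_subset _ _ hw (.inl hwK)
  have hd₂ : Disjoint (connectedComponentIn (K₁ ∪ K₂)ᶜ z₁) K₂ :=
    disjoint_left.2 fun w hw hwK => connectedComponentIn_subset _ _ hw (.inr hwK)
  have hb : Bornology.IsBounded (connectedComponentIn (K₁ ∪ K₂)ᶜ z₁) := by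
    by_contra hb
    exact hne₁ (logIncrement_eq_of_not_isBounded h₁ h₂ hx.1 hy.1 hx.2 hy.2
      isPreconnected_connectedComponentIn hd₁ hd₂ hb (mem_connectedComponentIn hz₁))
  have hz₂U : z₂ ∉ connectedComponentIn (K₁ ∪ K₂)ᶜ z₁ := fun h =>
    hne (logIncrement_sub_eq_of_isPreconnected h₁ h₂ hx.1 hy.1 hx.2 hy.2
      isPreconnected_connectedComponentIn hd₁ hd₂ (mem_connectedComponentIn hz₁) h)
  obtain ⟨k₁, hk₁⟩ := exists_int_logIncrement_sub h₁ h₂ hx.1 hy.1 hx.2 hy.2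
    (fun h => hz₁ (.inl h)) (fun h => hz₁ (.inr h))
  obtain ⟨k₂, hk₂⟩ := exists_int_logIncrement_sub h₁ h₂ hx.1 hy.1 hx.2 hy.2
    (fun h => hz₂ (.inl h)) (fun h => hz₂ (.inr h))
  have key : k₂ = 0 := by
    refine eq_zero_of_hasLogOn (h₁.isCompact.union h₂.isCompact) hz₁ hz₂ hb hz₂U
      (n := k₂) (m := -k₁) ?_
    obtain ⟨L₁, c₁, e₁⟩ := h₁.exists_log fun h => hz₁ (.inl h)
    obtain ⟨L₂, c₂, e₂⟩ := h₂.exists_log fun h => hz₁ (.inr h)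
    obtain ⟨L₁', c₁', e₁'⟩ := h₁.exists_log fun h => hz₂ (.inl h)
    obtain ⟨L₂', c₂', e₂'⟩ := h₂.exists_log fun h => hz₂ (.inr h)
    rw [logIncrement_eq h₁.isPreconnected hx.1 hy.1 c₁ e₁,
      logIncrement_eq h₂.isPreconnected hx.2 hy.2 c₂ e₂] at hk₁
    rw [logIncrement_eq h₁.isPreconnected hx.1 hy.1 c₁' e₁',
      logIncrement_eq h₂.isPreconnected hx.2 hy.2 c₂' e₂'] at hk₂
    refine HasLogOn.union (x := x) (y := y) h₁.isClosed h₂.isClosed hK.subset hx.1 hx.2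
      (L₁ := fun w => k₂ * L₁ w + ((-k₁ : ℤ) : ℂ) * L₁' w)
      (L₂ := fun w => k₂ * L₂ w + ((-k₁ : ℤ) : ℂ) * L₂' w)
      ((continuousOn_const.mul c₁).add (continuousOn_const.mul c₁'))
      ((continuousOn_const.mul c₂).add (continuousOn_const.mul c₂')) ?_ ?_ ?_
    · intro w hw
      rw [exp_add, exp_int_mul, exp_int_mul, e₁ w hw, e₁' w hw]
    · intro w hw
      rw [exp_add, exp_int_mul, exp_int_mul, e₂ w hw, e₂' w hw]
    · push_cast
      linear_combination (k₂ : ℂ) * hk₁ - (k₁ : ℂ) * hk₂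
  rw [key] at hk₂
  apply hne₂
  rw [← sub_eq_zero, hk₂]
  simp

/-- Two branches of the logarithm of `(y - z) / (p - z)`, one with a cut along `M` and the other
one with a cut along `R`, differ somewhere near `p` if `M` and `R` meet only in `p` there. -/
theorem exists_ne_of_exp_eq {M R : Set ℂ} (hM : IsClosed M) (hR : IsClosed R) {p y : ℂ} {r : ℝ}
    (hr : 0 < r) (hMR : M ∩ R ∩ ball p r ⊆ {p}) (hy : r ≤ dist y p) {D₁ D₂ : ℂ → ℂ}
    (hD₁ : ContinuousOn D₁ Mᶜ) (hD₂ : ContinuousOn D₂ Rᶜ)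
    (e₁ : ∀ z, z ∉ M → exp (D₁ z) = (y - z) / (p - z))
    (e₂ : ∀ z, z ∉ R → exp (D₂ z) = (y - z) / (p - z)) :
    ∃ z ∈ ball p r, z ∉ M ∧ z ∉ R ∧ D₁ z ≠ D₂ z := by
  classical
  by_contra! hcon
  set L : ℂ → ℂ := fun z => if z ∈ M then D₂ z else D₁ z with hLdef
  have hor : ∀ z ∈ ball p r, z ≠ p → z ∉ M ∨ z ∉ R := by
    intro z hz hzp
    by_contra! h
    exact hzp (hMR ⟨h, hz⟩)
  have hL : ∀ z ∈ ball p r, z ≠ p → ContinuousAt L z := by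
    intro z hz hzp
    rcases hor z hz hzp with h | h
    · refine (hD₁.continuousAt (hM.isOpen_compl.mem_nhds h)).congr ?_
      filter_upwards [hM.isOpen_compl.mem_nhds h] with w hw
      simp only [hLdef, if_neg (show w ∉ M from hw)]
    · refine (hD₂.continuousAt (hR.isOpen_compl.mem_nhds h)).congr ?_
      filter_upwards [hR.isOpen_compl.mem_nhds h, isOpen_ball.mem_nhds hz] with w hw hwb
      by_cases hwM : w ∈ M
      · simp only [hLdef, if_pos hwM]
      · simp only [hLdef, if_neg hwM]
        exact (hcon w hwb hwM hw).symm
  have hLe : ∀ z ∈ ball p r, z ≠ p → exp (L z) = (y - z) / (p - z) := by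
    intro z hz hzp
    by_cases hzM : z ∈ M
    · simp only [hLdef, if_pos hzM]
      exact e₂ z ((hor z hz hzp).resolve_left fun h => h hzM)
    · simp only [hLdef, if_neg hzM]
      exact e₁ z hzM
  have hyp : y - p ≠ 0 := fun h => by
    rw [sub_eq_zero.1 h, dist_self] at hy
    linarith
  have hsph : ∀ z ∈ sphere p (r / 2), z ∈ ball p r ∧ z ≠ p := by
    intro z hz
    rw [mem_sphere] at hz
    refine ⟨by rw [mem_ball]; linarith, fun h => ?_⟩
    rw [h, dist_self] at hz
    linarith
  have hs : ∀ z ∈ sphere p (r / 2), 1 + -(z - p) / (y - p) ∈ slitPlane := by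
    intro z hz
    apply one_add_mem_slitPlane
    rw [norm_div, div_lt_one (norm_pos_iff.2 hyp), norm_neg, ← dist_eq_norm, ← dist_eq_norm]
    exact lt_of_lt_of_le (mem_ball.1 (hsph z hz).1) hy
  have := eq_zero_of_exp_eq_zpow_on_sphere (half_pos hr) (p := p) (n := 1)
    (L := fun z => log (p - y) + log (1 + -(z - p) / (y - p)) - L z) ?_ ?_
  · exact one_ne_zero this
  · refine (continuousOn_const.add (ContinuousOn.clog (by fun_prop) hs)).sub fun z hz => ?_
    exact (hL z (hsph z hz).1 (hsph z hz).2).continuousWithinAt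
  · intro z hz
    have hpy : p - y ≠ 0 := by rwa [← neg_ne_zero, neg_sub]
    have hpz : p - z ≠ 0 := sub_ne_zero.2 (hsph z hz).2.symm
    have hyz : y - z ≠ 0 := by
      rintro h
      have := mem_ball.1 (hsph z hz).1
      rw [← sub_eq_zero.1 h] at this
      linarith
    rw [exp_sub, exp_add, exp_log hpy, exp_log (slitPlane_ne_zero (hs z hz)),
      hLe z (hsph z hz).1 (hsph z hz).2]
    field_simp
    ring

end Complex

namespace MarkedJordanCurve

variable (J : MarkedJordanCurve)

theorem c_injOn (u : ℝ) : InjOn J.c (Ico u (u + 1)) := by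
  intro x hx y hy hxy
  have h : ∀ x, J.c (Int.fract x) = J.c x := fun x => by
    have := J.periodic_c.sub_int_mul_eq (x := x) ⌊x⌋
    rwa [mul_one] at this
  have h1 : Int.fract x = Int.fract y :=
    J.injOn_c ⟨Int.fract_nonneg _, Int.fract_lt_one _⟩ ⟨Int.fract_nonneg _, Int.fract_lt_one _⟩
      (by rw [h, h, hxy])
  obtain ⟨n, hn⟩ := Int.fract_eq_fract.1 h1
  have h2 : |(n : ℝ)| < 1 := by
    rw [← hn, abs_lt]
    constructor <;> linarith [hx.1, hx.2, hy.1, hy.2]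
  have h3 : n = 0 := by
    rw [← Int.abs_lt_one_iff]
    exact_mod_cast h2
  rw [h3] at hn
  simp only [Int.cast_zero] at hn
  linarith

theorem isLogContinuum_image {s t : ℝ} (hst : s ≤ t) (hts : t < s + 1) :
    IsLogContinuum (J.c '' Icc s t) :=
  isLogContinuum_image_Icc hst J.continuous_c.continuousOn
    ((J.c_injOn s).mono (Icc_subset_Ico_right hts))

theorem c_add_one (u : ℝ) : J.c (u + 1) = J.c u := J.periodic_c u

theorem exists_Ico (u : ℝ) {z : ℂ} (hz : z ∈ range J.c) : ∃ v ∈ Ico u (u + 1), J.c v = z := by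
  obtain ⟨w, rfl⟩ := hz
  obtain ⟨v, hv, h⟩ := J.periodic_c.exists_mem_Ico one_pos w u
  exact ⟨v, hv, h.symm⟩

theorem image_union_image (s t : ℝ) :
    J.c '' Icc s t ∪ J.c '' Icc t (s + 1) = range J.c := by
  refine Subset.antisymm (union_subset (image_subset_range _ _) (image_subset_range _ _)) ?_
  intro z hz
  obtain ⟨v, hv, rfl⟩ := J.exists_Ico s hz
  rcases le_total v t with h | h
  · exact .inl ⟨v, ⟨hv.1, h⟩, rfl⟩
  · exact .inr ⟨v, ⟨h, hv.2.le⟩, rfl⟩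

theorem image_inter_image {s t : ℝ} (hst : s < t) (hts : t < s + 1) :
    J.c '' Icc s t ∩ J.c '' Icc t (s + 1) = {J.c s, J.c t} := by
  apply Subset.antisymm
  · rintro _ ⟨⟨u, hu, rfl⟩, ⟨v, hv, hvu⟩⟩
    rcases hv.2.lt_or_eq with h | h
    · have : v = u := J.c_injOn s ⟨hst.le.trans hv.1, h⟩ ⟨hu.1, hu.2.trans_lt hts⟩ hvu
      subst this
      exact .inr (by rw [le_antisymm hu.2 hv.1]; rfl)
    · rw [h, J.c_add_one] at hvu
      exact .inl hvu.symm
  · rintro _ (rfl | rfl)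
    · exact ⟨⟨s, ⟨le_rfl, hst.le⟩, rfl⟩, ⟨s + 1, ⟨hts.le, le_rfl⟩, J.c_add_one s⟩⟩
    · exact ⟨⟨t, ⟨hst.le, le_rfl⟩, rfl⟩, ⟨t, ⟨le_rfl, hts.le⟩, rfl⟩⟩

theorem isCompact_range : IsCompact (range J.c) := by
  rw [← J.image_union_image 0 0]
  exact (isCompact_Icc.image J.continuous_c).union (isCompact_Icc.image J.continuous_c)

theorem range_subset_closedDomain : range J.c ⊆ J.closedDomain := by
  intro z hz
  have : connectedComponentIn (range J.c)ᶜ z = ∅ :=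
    connectedComponentIn_eq_empty fun h => h hz
  simp only [closedDomain, mem_ofPred_eq, this]
  exact Bornology.isBounded_empty

theorem connectedComponentIn_subset_compl {z : ℂ} (hz : z ∉ J.closedDomain) :
    connectedComponentIn (range J.c)ᶜ z ⊆ J.closedDomainᶜ := by
  intro w hw hw'
  simp only [closedDomain, mem_ofPred_eq, ← connectedComponentIn_eq hw] at hw'
  exact hz hw'

theorem connectedComponentIn_eq_compl {z : ℂ} (hz : z ∉ J.closedDomain) :
    connectedComponentIn (range J.c)ᶜ z = J.closedDomainᶜ := by
  refine Subset.antisymm (J.connectedComponentIn_subset_compl hz) fun w hw => ?_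
  rw [connectedComponentIn_eq_of_not_isBounded J.isCompact_range.isBounded hz hw]
  exact mem_connectedComponentIn fun h => hw (J.range_subset_closedDomain h)

theorem isClosed_closedDomain : IsClosed J.closedDomain := by
  rw [← isOpen_compl_iff, isOpen_iff_mem_nhds]
  intro z hz
  rw [← J.connectedComponentIn_eq_compl hz]
  exact (J.isCompact_range.isClosed.isOpen_compl.connectedComponentIn).mem_nhds
    (mem_connectedComponentIn fun h => hz (J.range_subset_closedDomain h))

theorem isOpen_diff_range : IsOpen (J.closedDomain \ range J.c) := by
  rw [isOpen_iff_mem_nhds]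
  rintro z ⟨hz, hzc⟩
  filter_upwards [(J.isCompact_range.isClosed.isOpen_compl.connectedComponentIn).mem_nhds
    (mem_connectedComponentIn hzc)] with w hw
  refine ⟨?_, connectedComponentIn_subset _ _ hw⟩
  simp only [closedDomain, mem_ofPred_eq, ← connectedComponentIn_eq hw]
  exact hz

theorem closedDomain_compl_nonempty : J.closedDomainᶜ.Nonempty := by
  obtain ⟨R, hR⟩ := J.isCompact_range.isBounded.exists_norm_le
  set R' := max R 1
  have hpre := isPreconnected_setOf_lt_norm (R := R') (lt_of_lt_of_le one_pos (le_max_right _ _))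
  have hsub : {w : ℂ | R' < ‖w‖} ⊆ (range J.c)ᶜ := fun w hw hwK =>
    absurd (hR w hwK) (not_le.2 ((le_max_left _ _).trans_lt hw))
  have hfar : ∀ r : ℝ, R' ≤ r → ((r + 1 : ℝ) : ℂ) ∈ {w : ℂ | R' < ‖w‖} := fun r hr => by
    simp only [mem_ofPred_eq, norm_real, Real.norm_eq_abs]
    linarith [le_abs_self (r + 1)]
  refine ⟨_, fun h : ((R' + 1 : ℝ) : ℂ) ∈ J.closedDomain => ?_⟩
  simp only [closedDomain, mem_ofPred_eq] at h
  obtain ⟨M, hM⟩ := h.exists_norm_le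
  have h1 := hM _ (hpre.subset_connectedComponentIn (hfar R' le_rfl) hsub
    (hfar (max M R') (le_max_right _ _)))
  rw [norm_real, Real.norm_eq_abs] at h1
  linarith [le_abs_self (max M R' + 1), le_max_left M R']

theorem mem_closure_compl {z : ℂ} (hz : z ∈ range J.c) : z ∈ closure J.closedDomainᶜ := by
  obtain ⟨u, rfl⟩ := hz
  by_contra hcl
  obtain ⟨r, hr, hball⟩ := Metric.isOpen_iff.1 isClosed_closure.isOpen_compl _ hcl
  obtain ⟨δ, hδ, hδu⟩ := Metric.continuousAt_iff.1 (J.continuous_c.continuousAt (x := u)) r hr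
  set ε := min δ (1 / 2) / 2 with hε
  have hε0 : 0 < ε := by positivity
  have hεδ : ε < δ := by
    have := min_le_left δ (1 / 2)
    have : 0 < min δ (1 / 2) := by positivity
    linarith
  have hε4 : ε ≤ 1 / 4 := by linarith [min_le_right δ (1 / 2)]
  have hK := J.isLogContinuum_image (s := u + ε) (t := u + 1 - ε) (by linarith) (by linarith)
  have huK : J.c u ∈ (J.c '' Icc (u + ε) (u + 1 - ε))ᶜ := by
    rintro ⟨v, hv, hvu⟩
    have := J.c_injOn u ⟨by linarith [hv.1], by linarith [hv.2]⟩ ⟨le_rfl, by linarith⟩ hvu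
    linarith [hv.1]
  obtain ⟨z₀, hz₀⟩ := J.closedDomain_compl_nonempty
  have hsub := hK.isPreconnected_compl.subset_of_closure_inter_subset
    (u := J.closedDomainᶜ) J.isClosed_closedDomain.isOpen_compl
    ⟨z₀, fun h => hz₀ (J.range_subset_closedDomain (image_subset_range _ _ h)), hz₀⟩ ?_
  · exact hsub huK (J.range_subset_closedDomain ⟨u, rfl⟩)
  · rintro w ⟨hw, hwK⟩
    have h1 := hw
    rw [← J.connectedComponentIn_eq_compl hz₀] at h1
    rcases closure_connectedComponentIn_compl_subset J.isCompact_range.isClosed _ h1 with h2 | h2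
    · rwa [J.connectedComponentIn_eq_compl hz₀] at h2
    · exfalso
      obtain ⟨v, hv, rfl⟩ := J.exists_Ico (u - ε) h2
      have hlt : v < u + ε := by
        by_contra hge
        exact hwK ⟨v, ⟨not_lt.1 hge, by linarith [hv.2]⟩, rfl⟩
      have : dist v u < δ := by
        rw [Real.dist_eq, abs_lt]
        constructor <;> linarith [hv.1]
      exact hball (hδu this) hw

theorem logIncrement_eq_of_notMem {T₁ T₂ : Set ℂ} (h₁ : IsLogContinuum T₁)
    (h₂ : IsLogContinuum T₂) (hT₁ : T₁ ⊆ J.closedDomain) (hT₂ : T₂ ⊆ J.closedDomain) {x y z : ℂ}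
    (hx₁ : x ∈ T₁) (hy₁ : y ∈ T₁) (hx₂ : x ∈ T₂) (hy₂ : y ∈ T₂) (hz : z ∉ J.closedDomain) :
    logIncrement T₁ x y z = logIncrement T₂ x y z :=
  logIncrement_eq_of_not_isBounded h₁ h₂ hx₁ hy₁ hx₂ hy₂ isPreconnected_connectedComponentIn
    (disjoint_left.2 fun _ hw hw' => J.connectedComponentIn_subset_compl hz hw (hT₁ hw'))
    (disjoint_left.2 fun _ hw hw' => J.connectedComponentIn_subset_compl hz hw (hT₂ hw'))
    hz (mem_connectedComponentIn fun h => hz (J.range_subset_closedDomain h))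

theorem logIncrement_eq_of_mem_range {T₁ T₂ : Set ℂ} (h₁ : IsLogContinuum T₁)
    (h₂ : IsLogContinuum T₂) (hT₁ : T₁ ⊆ J.closedDomain) (hT₂ : T₂ ⊆ J.closedDomain) {x y z : ℂ}
    (hx₁ : x ∈ T₁) (hy₁ : y ∈ T₁) (hx₂ : x ∈ T₂) (hy₂ : y ∈ T₂) (hz : z ∈ range J.c)
    (hz₁ : z ∉ T₁) (hz₂ : z ∉ T₂) :
    logIncrement T₁ x y z = logIncrement T₂ x y z := by
  have hfr := mem_closure_iff_frequently.1 (J.mem_closure_compl hz)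
  obtain ⟨w, hw, hw'⟩ := (hfr.and_eventually
    (eventually_logIncrement_sub_eq h₁ h₂ hx₁ hy₁ hx₂ hy₂ hz₁ hz₂)).exists
  rw [← sub_eq_zero, ← hw', J.logIncrement_eq_of_notMem h₁ h₂ hT₁ hT₂ hx₁ hy₁ hx₂ hy₂ hw, sub_self]

/-- `T` is an arc-like continuum in the closed domain joining the boundary points `c s` and
`c t`. -/
structure IsSlit (s t : ℝ) (T : Set ℂ) : Prop where
  lt : s < t
  lt_add_one : t < s + 1
  isLogContinuum : IsLogContinuum T
  subset : T ⊆ J.closedDomain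
  left_mem : J.c s ∈ T
  right_mem : J.c t ∈ T

/-- The point `z` is on the side of the slit `T` that contains the boundary arc `c (s, t)`. -/
def IsBelow (s t : ℝ) (T : Set ℂ) (z : ℂ) : Prop :=
  z ∈ J.c '' Icc s t ∨ (z ∉ range J.c ∧
    logIncrement T (J.c s) (J.c t) z = logIncrement (J.c '' Icc t (s + 1)) (J.c s) (J.c t) z)

theorem image_subset_closedDomain (u v : ℝ) : J.c '' Icc u v ⊆ J.closedDomain :=
  (image_subset_range _ _).trans J.range_subset_closedDomain

theorem isBelow_bot {s t : ℝ} {T : Set ℂ} {u : ℝ} (hu : u ∈ Icc s t) :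
    J.IsBelow s t T (J.c u) := .inl ⟨u, hu, rfl⟩

theorem isBelow_iff_eq_top {s t : ℝ} {T : Set ℂ} {z : ℂ} (hzc : z ∉ range J.c) :
    J.IsBelow s t T z ↔ logIncrement T (J.c s) (J.c t) z =
      logIncrement (J.c '' Icc t (s + 1)) (J.c s) (J.c t) z := by
  have : z ∉ J.c '' Icc s t := fun h => hzc (image_subset_range _ _ h)
  simp [IsBelow, this, hzc]

namespace IsSlit

variable {J} {s t : ℝ} {T : Set ℂ} (h : J.IsSlit s t T)
include h

theorem isLogContinuum_bot : IsLogContinuum (J.c '' Icc s t) :=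
  J.isLogContinuum_image h.lt.le h.lt_add_one

theorem isLogContinuum_top : IsLogContinuum (J.c '' Icc t (s + 1)) :=
  J.isLogContinuum_image h.lt_add_one.le (by linarith [h.lt])

theorem left_mem_bot : J.c s ∈ J.c '' Icc s t := ⟨s, ⟨le_rfl, h.lt.le⟩, rfl⟩

theorem right_mem_bot : J.c t ∈ J.c '' Icc s t := ⟨t, ⟨h.lt.le, le_rfl⟩, rfl⟩

theorem left_mem_top : J.c s ∈ J.c '' Icc t (s + 1) :=
  ⟨s + 1, ⟨h.lt_add_one.le, le_rfl⟩, J.c_add_one s⟩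

theorem right_mem_top : J.c t ∈ J.c '' Icc t (s + 1) := ⟨t, ⟨le_rfl, h.lt_add_one.le⟩, rfl⟩

theorem notMem_top {z : ℂ} (hz : z ∉ T) (hb : z ∈ J.c '' Icc s t) :
    z ∉ J.c '' Icc t (s + 1) := fun ht => by
  have : z ∈ ({J.c s, J.c t} : Set ℂ) := by
    rw [← J.image_inter_image h.lt h.lt_add_one]; exact ⟨hb, ht⟩
  rcases this with rfl | rfl
  · exact hz h.left_mem
  · exact hz h.right_mem

theorem notMem_bot {z : ℂ} (hz : z ∉ T) (ht : z ∈ J.c '' Icc t (s + 1)) :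
    z ∉ J.c '' Icc s t := fun hb => h.notMem_top hz hb ht

theorem bot_ne_top {z : ℂ} (hz : z ∈ J.closedDomain) (hz' : z ∉ range J.c) :
    logIncrement (J.c '' Icc s t) (J.c s) (J.c t) z ≠
      logIncrement (J.c '' Icc t (s + 1)) (J.c s) (J.c t) z := by
  have hU := J.image_union_image s t
  refine logIncrement_ne_of_isBounded h.isLogContinuum_bot h.isLogContinuum_top
    (J.image_inter_image h.lt h.lt_add_one) ?_ ?_
  · rwa [hU]
  · rw [hU]; exact hz

theorem eventually_isBelow_iff {z : ℂ} (hzT : z ∉ T) :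
    ∀ᶠ z' in 𝓝[J.closedDomain \ T] z, (J.IsBelow s t T z' ↔ J.IsBelow s t T z) := by
  have hbot := h.isLogContinuum_bot
  have htop := h.isLogContinuum_top
  by_cases hzc : z ∈ range J.c
  · rw [← J.image_union_image s t] at hzc
    rcases hzc with hzb | hzt
    · have hzt := h.notMem_top hzT hzb
      have h0 := J.logIncrement_eq_of_mem_range h.isLogContinuum htop h.subset
        (J.image_subset_closedDomain _ _) h.left_mem h.right_mem h.left_mem_top h.right_mem_top
        (image_subset_range _ _ hzb) hzT hzt
      filter_upwards [nhdsWithin_le_nhds (eventually_logIncrement_sub_eq h.isLogContinuum htop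
        h.left_mem h.right_mem h.left_mem_top h.right_mem_top hzT hzt),
        nhdsWithin_le_nhds (htop.isClosed.isOpen_compl.mem_nhds hzt)] with w hw hwt
      refine iff_of_true ?_ (.inl hzb)
      by_cases hwc : w ∈ range J.c
      · rw [← J.image_union_image s t] at hwc
        exact .inl (hwc.resolve_right hwt)
      · exact .inr ⟨hwc, by rwa [h0, sub_self, sub_eq_zero] at hw⟩
    · have hzb := h.notMem_bot hzT hzt
      have h0 := J.logIncrement_eq_of_mem_range h.isLogContinuum hbot h.subset
        (J.image_subset_closedDomain _ _) h.left_mem h.right_mem h.left_mem_bot h.right_mem_bot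
        (image_subset_range _ _ hzt) hzT hzb
      filter_upwards [nhdsWithin_le_nhds (eventually_logIncrement_sub_eq h.isLogContinuum hbot
        h.left_mem h.right_mem h.left_mem_bot h.right_mem_bot hzT hzb),
        nhdsWithin_le_nhds (hbot.isClosed.isOpen_compl.mem_nhds hzb), self_mem_nhdsWithin]
        with w hw hwb hwD
      refine iff_of_false ?_ ?_
      · rintro (h1 | ⟨h1, h2⟩)
        · exact hwb h1
        · rw [h0, sub_self, sub_eq_zero] at hw
          exact h.bot_ne_top hwD.1 h1 (hw.symm.trans h2)
      · rintro (h1 | ⟨h1, h2⟩)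
        · exact hzb h1
        · exact h1 (image_subset_range _ _ hzt)
  · have hzt : z ∉ J.c '' Icc t (s + 1) := fun h => hzc (image_subset_range _ _ h)
    filter_upwards [nhdsWithin_le_nhds (eventually_logIncrement_sub_eq h.isLogContinuum htop
        h.left_mem h.right_mem h.left_mem_top h.right_mem_top hzT hzt),
        nhdsWithin_le_nhds (J.isCompact_range.isClosed.isOpen_compl.mem_nhds hzc)] with w hw hwc
    have h1 : w ∉ J.c '' Icc s t := fun h => hwc (image_subset_range _ _ h)
    have h2 : z ∉ J.c '' Icc s t := fun h => hzc (image_subset_range _ _ h)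
    have h3 : w ∉ range J.c := hwc
    simp only [IsBelow, h1, h2, h3, hzc, false_or, not_false_iff, true_and]
    rw [← sub_eq_zero, hw, sub_eq_zero]

theorem isBelow_iff_of_isPreconnected {S : Set ℂ} (hS : IsPreconnected S)
    (hSD : S ⊆ J.closedDomain) (hST : Disjoint S T) {z w : ℂ} (hz : z ∈ S) (hw : w ∈ S) :
    J.IsBelow s t T z ↔ J.IsBelow s t T w :=
  hS.iff_of_locally_iff (fun _ hu => (h.eventually_isBelow_iff
    (disjoint_left.1 hST hu)).filter_mono
    (nhdsWithin_mono _ (subset_sdiff.2 ⟨hSD, hST⟩))) hz hw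

theorem isBelow_iff_of_mem_connectedComponentIn {z w : ℂ}
    (hw : w ∈ connectedComponentIn (J.closedDomain \ T) z) :
    J.IsBelow s t T z ↔ J.IsBelow s t T w :=
  h.isBelow_iff_of_isPreconnected isPreconnected_connectedComponentIn
    (fun _ hu => (connectedComponentIn_subset _ _ hu).1)
    (disjoint_left.2 fun _ hu => (connectedComponentIn_subset _ _ hu).2)
    (mem_connectedComponentIn (connectedComponentIn_nonempty_iff.1 ⟨w, hw⟩)) hw

theorem exists_mem_connectedComponentIn {z : ℂ} (hz : z ∈ J.closedDomain) (hzT : z ∉ T) :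
    ∃ u ∈ Ioo s t ∪ Ioo t (s + 1), J.c u ∈ connectedComponentIn (J.closedDomain \ T) z := by
  suffices ∃ w ∈ range J.c, w ∈ connectedComponentIn (J.closedDomain \ T) z by
    obtain ⟨w, hw, hw'⟩ := this
    obtain ⟨v, hv, rfl⟩ := J.exists_Ico s hw
    refine ⟨v, ?_, hw'⟩
    have hvT := (connectedComponentIn_subset _ _ hw').2
    have hvs : v ≠ s := by rintro rfl; exact hvT h.left_mem
    have hvt : v ≠ t := by rintro rfl; exact hvT h.right_mem
    rcases hvt.lt_or_gt with h1 | h1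
    · exact .inl ⟨lt_of_le_of_ne hv.1 hvs.symm, h1⟩
    · exact .inr ⟨h1, hv.2⟩
  by_cases hzc : z ∈ range J.c
  · exact ⟨z, hzc, mem_connectedComponentIn ⟨hz, hzT⟩⟩
  have hKo : IsOpen ((J.closedDomain \ range J.c) \ T) :=
    J.isOpen_diff_range.sdiff h.isLogContinuum.isClosed
  set O := connectedComponentIn ((J.closedDomain \ range J.c) \ T) z with hO
  have hOo : IsOpen O := hKo.connectedComponentIn
  have hzO : z ∈ O := mem_connectedComponentIn ⟨⟨hz, hzc⟩, hzT⟩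
  have hOD : O ⊆ J.closedDomain \ T := fun w hw => by
    have := connectedComponentIn_subset _ _ hw
    exact ⟨this.1.1, this.2⟩
  have hclD : closure O ⊆ J.closedDomain :=
    closure_minimal (fun w hw => (hOD hw).1) J.isClosed_closedDomain
  by_contra! hcon
  have hsub : Tᶜ ⊆ O := by
    refine h.isLogContinuum.isPreconnected_compl.subset_of_closure_inter_subset hOo
      ⟨z, hzT, hzO⟩ ?_
    rintro w ⟨hw, hwT⟩
    by_cases hwc : w ∈ range J.c
    · exfalso
      refine hcon w hwc ?_
      have hpre : IsPreconnected (insert w O) :=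
        isPreconnected_connectedComponentIn.subset_closure (subset_insert _ _)
          (insert_subset hw subset_closure)
      exact hpre.subset_connectedComponentIn (mem_insert_of_mem _ hzO)
        (insert_subset (show w ∈ J.closedDomain \ T from ⟨hclD hw, hwT⟩) hOD) (mem_insert _ _)
    · have h1 : IsClosed ((J.closedDomain \ range J.c) \ T)ᶜ := hKo.isClosed_compl
      have h2 := closure_connectedComponentIn_compl_subset h1 z
      rw [compl_compl] at h2
      rcases h2 hw with h3 | h3
      · exact h3
      · exact absurd ⟨⟨hclD hw, hwc⟩, hwT⟩ h3
  obtain ⟨w, hw⟩ := J.closedDomain_compl_nonempty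
  exact hw (hOD (hsub fun hwT => hw (h.subset hwT))).1

theorem not_isBelow_top {u : ℝ} (hu : u ∈ Icc t (s + 1)) (huT : J.c u ∉ T) :
    ¬ J.IsBelow s t T (J.c u) := by
  rintro (h1 | ⟨h1, -⟩)
  · exact h.notMem_top huT h1 ⟨u, hu, rfl⟩
  · exact h1 ⟨u, rfl⟩

theorem isBelow_iff_nonempty {z : ℂ} (hz : z ∈ J.closedDomain) (hzT : z ∉ T) :
    J.IsBelow s t T z ↔
      (connectedComponentIn (J.closedDomain \ T) z ∩ J.c '' Ioo s t).Nonempty := by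
  constructor
  · intro hb
    obtain ⟨u, hu, hu'⟩ := h.exists_mem_connectedComponentIn hz hzT
    rcases hu with hu | hu
    · exact ⟨_, hu', ⟨u, hu, rfl⟩⟩
    · exact absurd ((h.isBelow_iff_of_mem_connectedComponentIn hu').1 hb)
        (h.not_isBelow_top (Ioo_subset_Icc_self hu) (connectedComponentIn_subset _ _ hu').2)
  · rintro ⟨_, hw, ⟨u, hu, rfl⟩⟩
    exact (h.isBelow_iff_of_mem_connectedComponentIn hw).2 (J.isBelow_bot (Ioo_subset_Icc_self hu))

theorem exists_top_of_not_isBelow {z : ℂ} (hz : z ∈ J.closedDomain) (hzT : z ∉ T)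
    (hb : ¬ J.IsBelow s t T z) :
    ∃ u ∈ Ioo t (s + 1), J.c u ∈ connectedComponentIn (J.closedDomain \ T) z := by
  obtain ⟨u, hu, hu'⟩ := h.exists_mem_connectedComponentIn hz hzT
  refine ⟨u, hu.resolve_left fun hu => hb ?_, hu'⟩
  exact (h.isBelow_iff_of_mem_connectedComponentIn hu').2 (J.isBelow_bot (Ioo_subset_Icc_self hu))

end IsSlit

theorem logIncrement_swap {K : Set ℂ} (hK : IsLogContinuum K) {x y z : ℂ} (hx : x ∈ K)
    (hy : y ∈ K) (hz : z ∉ K) : logIncrement K x y z = -logIncrement K y x z := by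
  obtain ⟨L, hL, he⟩ := hK.exists_log hz
  rw [logIncrement_eq hK.isPreconnected hx hy hL he, logIncrement_eq hK.isPreconnected hy hx hL he]
  ring

namespace IsSlit

variable {J} {s t : ℝ} {T : Set ℂ} (h : J.IsSlit s t T)
include h

theorem swap : J.IsSlit t (s + 1) T :=
  ⟨h.lt_add_one, by linarith [h.lt], h.isLogContinuum, h.subset, h.right_mem, by
    rw [J.c_add_one]; exact h.left_mem⟩

theorem eq_bot_of_not_isBelow {z : ℂ} (hz : z ∈ J.closedDomain) (hzT : z ∉ T)
    (hzc : z ∉ range J.c) (hb : ¬ J.IsBelow s t T z) :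
    logIncrement T (J.c s) (J.c t) z = logIncrement (J.c '' Icc s t) (J.c s) (J.c t) z := by
  obtain ⟨u, hu, hu'⟩ := h.exists_top_of_not_isBelow hz hzT hb
  have h1 : J.IsBelow t (s + 1) T z :=
    (h.swap.isBelow_iff_of_mem_connectedComponentIn hu').2
      (J.isBelow_bot (Ioo_subset_Icc_self hu))
  rw [J.isBelow_iff_eq_top hzc] at h1
  have h2 : J.c '' Icc (s + 1) (t + 1) = J.c '' Icc s t := by
    ext w
    constructor
    · rintro ⟨v, hv, rfl⟩
      exact ⟨v - 1, ⟨by linarith [hv.1], by linarith [hv.2]⟩, by rw [← J.c_add_one]; simp⟩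
    · rintro ⟨v, hv, rfl⟩
      exact ⟨v + 1, ⟨by linarith [hv.1], by linarith [hv.2]⟩, J.c_add_one v⟩
  have hzb : z ∉ J.c '' Icc s t := fun h => hzc (image_subset_range _ _ h)
  rw [h2, J.c_add_one] at h1
  rw [logIncrement_swap h.isLogContinuum h.left_mem h.right_mem hzT, h1,
    logIncrement_swap h.isLogContinuum_bot h.left_mem_bot h.right_mem_bot hzb]

end IsSlit

end MarkedJordanCurve

namespace Network

variable {V E : Type*} (G : Network V E)

/-- There is a simple path from `x` to `y` with edge set `γ` and vertex set `W`, all of whose steps,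
along the edge `e` from `u` to `v`, satisfy `P e u v`. -/
inductive SPath (P : E → V → V → Prop) : V → V → Set E → Set V → Prop
  | nil (x : V) : SPath P x x ∅ {x}
  | cons {e : E} {x y z : V} {γ : Set E} {W : Set V} (he : P e x y) (hx : x ∉ W)
      (h : SPath P y z γ W) : SPath P x z (insert e γ) (insert x W)

namespace SPath

variable {P : E → V → V → Prop} {x y z : V} {γ γ' : Set E} {W W' : Set V}

theorem left_mem (h : SPath P x y γ W) : x ∈ W := by
  cases h with
  | nil => rfl
  | cons => exact mem_insert _ _

theorem right_mem (h : SPath P x y γ W) : y ∈ W := by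
  induction h with
  | nil => rfl
  | cons _ _ _ ih => exact mem_insert_of_mem _ ih

theorem mono {Q : E → V → V → Prop} (h : SPath P x y γ W)
    (hPQ : ∀ e ∈ γ, ∀ u v, P e u v → Q e u v) : SPath Q x y γ W := by
  induction h with
  | nil => exact .nil _
  | cons he hx _ ih =>
    exact .cons (hPQ _ (mem_insert _ _) _ _ he) hx
      (ih fun e he' => hPQ e (mem_insert_of_mem _ he'))

theorem exists_step (h : SPath P x y γ W) {e : E} (he : e ∈ γ) :
    ∃ u ∈ W, ∃ v ∈ W, P e u v := by
  induction h with
  | nil => exact absurd he (notMem_empty _)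
  | cons he' hx h' ih =>
    rcases he with rfl | he
    · exact ⟨_, mem_insert _ _, _, mem_insert_of_mem _ h'.left_mem, he'⟩
    · obtain ⟨u, hu, v, hv, huv⟩ := ih he
      exact ⟨u, mem_insert_of_mem _ hu, v, mem_insert_of_mem _ hv, huv⟩

theorem exists_edge (h : SPath P x y γ W) {v : V} (hv : v ∈ W) (hxy : x ≠ y) :
    ∃ e ∈ γ, ∃ u, P e u v ∨ P e v u := by
  induction h with
  | nil => exact absurd rfl hxy
  | @cons e x y z γ W he hx h' ih =>
    rcases hv with rfl | hv
    · exact ⟨e, mem_insert _ _, y, .inr he⟩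
    · by_cases hyz : y = z
      · subst hyz
        cases h' with
        | nil =>
          rw [mem_singleton_iff] at hv
          exact ⟨e, mem_insert _ _, x, .inl (hv ▸ he)⟩
        | cons _ hy h'' => exact absurd h''.right_mem hy
      · obtain ⟨e', he', u, hu⟩ := ih hv hyz
        exact ⟨e', mem_insert_of_mem _ he', u, hu⟩

theorem finite_edges (h : SPath P x y γ W) : γ.Finite := by
  induction h with
  | nil => exact finite_empty
  | cons _ _ _ ih => exact ih.insert _

theorem append (h : SPath P x y γ W) (h' : SPath P y z γ' W') (hW : W ∩ W' ⊆ {y}) :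
    SPath P x z (γ ∪ γ') (W ∪ W') := by
  induction h with
  | nil =>
    rwa [empty_union, union_eq_self_of_subset_left (singleton_subset_iff.2 h'.left_mem)]
  | @cons e x y' y γ W he hx h'' ih =>
    rw [insert_union, insert_union]
    refine .cons he ?_ (ih h' fun v hv => hW ⟨mem_insert_of_mem _ hv.1, hv.2⟩)
    rintro (hxW | hxW')
    · exact hx hxW
    · have : x = y := hW ⟨mem_insert _ _, hxW'⟩
      exact hx (this ▸ h''.right_mem)

theorem split (h : SPath P x z γ W) {y : V} (hy : y ∈ W) :
    ∃ γ₁ W₁ γ₂ W₂, SPath P x y γ₁ W₁ ∧ SPath P y z γ₂ W₂ ∧ W₁ ∩ W₂ ⊆ {y} ∧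
      γ = γ₁ ∪ γ₂ ∧ W = W₁ ∪ W₂ := by
  induction h with
  | nil x =>
    rw [mem_singleton_iff] at hy
    subst hy
    exact ⟨_, _, _, _, .nil _, .nil _, inter_subset_left, (empty_union _).symm,
      (union_self _).symm⟩
  | @cons e x y' z γ W he hx h' ih =>
    rcases hy with rfl | hy
    · exact ⟨_, _, _, _, .nil _, .cons he hx h', inter_subset_left, (empty_union _).symm,
        (union_eq_self_of_subset_left (singleton_subset_iff.2 (mem_insert _ _))).symm⟩
    · obtain ⟨γ₁, W₁, γ₂, W₂, h₁, h₂, hW, rfl, rfl⟩ := ih hy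
      refine ⟨_, _, _, _, .cons he (fun h => hx (.inl h)) h₁, h₂, ?_, (insert_union ..).symm,
        (insert_union ..).symm⟩
      rintro v ⟨rfl | hv, hv'⟩
      · exact absurd (.inr hv') hx
      · exact hW ⟨hv, hv'⟩

theorem split_edge (h : SPath P x z γ W) {e : E} (he : e ∈ γ) :
    ∃ u v γ₁ W₁ γ₂ W₂, SPath P x u γ₁ W₁ ∧ P e u v ∧ SPath P v z γ₂ W₂ ∧ Disjoint W₁ W₂ ∧
      γ = insert e (γ₁ ∪ γ₂) ∧ W = W₁ ∪ W₂ := by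
  induction h with
  | nil x => exact absurd he (notMem_empty _)
  | @cons e' x y' z γ W he' hx h' ih =>
    rcases he with rfl | he
    · exact ⟨x, y', _, _, _, _, .nil _, he', h', disjoint_singleton_left.2 hx, by
        rw [empty_union], rfl⟩
    · obtain ⟨u, v, γ₁, W₁, γ₂, W₂, h₁, huv, h₂, hW, rfl, rfl⟩ := ih he
      refine ⟨u, v, _, _, _, _, .cons he' (fun h => hx (.inl h)) h₁, huv, h₂, ?_, ?_,
        (insert_union ..).symm⟩
      · rw [disjoint_insert_left]
        exact ⟨fun h => hx (.inr h), hW⟩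
      · rw [insert_union, insert_comm]

variable {h : V → ℝ}

theorem lt_of_mem_right (hP : ∀ e u v, P e u v → h u < h v) (hγ : SPath P x y γ W) {v : V}
    (hv : v ∈ W) : v = x ∨ h x < h v := by
  induction hγ with
  | nil => exact .inl hv
  | cons he _ _ ih =>
    rcases hv with rfl | hv
    · exact .inl rfl
    · rcases ih hv with rfl | hlt
      · exact .inr (hP _ _ _ he)
      · exact .inr ((hP _ _ _ he).trans hlt)

theorem lt_of_mem_left (hP : ∀ e u v, P e u v → h u < h v) (hγ : SPath P x y γ W) {v : V}
    (hv : v ∈ W) : v = y ∨ h v < h y := by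
  induction hγ generalizing v with
  | nil => exact .inl hv
  | cons he _ hγ' ih =>
    rcases hv with rfl | hv
    · refine .inr ?_
      rcases ih hγ'.left_mem with h1 | h1
      · exact h1 ▸ hP _ _ _ he
      · exact (hP _ _ _ he).trans h1
    · exact ih hv

theorem append_of_lt (hP : ∀ e u v, P e u v → h u < h v) (h₁ : SPath P x y γ W)
    (h₂ : SPath P y z γ' W') : SPath P x z (γ ∪ γ') (W ∪ W') := by
  refine h₁.append h₂ ?_
  rintro v ⟨hv, hv'⟩
  rcases h₁.lt_of_mem_left hP hv with h3 | h3
  · exact h3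
  rcases h₂.lt_of_mem_right hP hv' with h4 | h4
  · exact h4
  · exact absurd h3 h4.not_gt

theorem cons_of_lt (hP : ∀ e u v, P e u v → h u < h v) {e : E} (he : P e x y)
    (h₂ : SPath P y z γ W) : SPath P x z (insert e γ) (insert x W) := by
  refine .cons he (fun hx => ?_) h₂
  have h1 := hP _ _ _ he
  rcases h₂.lt_of_mem_right hP hx with h4 | h4
  · exact absurd h1 (h4 ▸ lt_irrefl _)
  · exact absurd h1 h4.not_gt

theorem finsum_eq {M : Type*} [AddCommGroup M] {f : E → M} {φ : V → M}
    (hP : ∀ e u v, P e u v → G.Joins e u v)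
    (hf : ∀ e u v, P e u v → f e = φ v - φ u) (hγ : SPath P x y γ W) :
    ∑ᶠ e ∈ γ, f e = φ y - φ x := by
  induction hγ with
  | nil => simp
  | @cons e x y z γ W he hx h' ih =>
    have he' : e ∉ γ := fun h => by
      obtain ⟨u, hu, v, hv, huv⟩ := h'.exists_step h
      rcases hP _ _ _ huv with h1 | h1 <;> rcases hP _ _ _ he with h2 | h2
      · exact hx (h2.1 ▸ h1.1 ▸ hu)
      · exact hx (h2.2 ▸ h1.2 ▸ hv)
      · exact hx (h2.1 ▸ h1.1 ▸ hv)
      · exact hx (h2.2 ▸ h1.2 ▸ hu)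
    rw [finsum_mem_insert f he' h'.finite_edges, ih, hf _ _ _ he]
    abel

end SPath

variable {G}

theorem Joins.symm {e : E} {x y : V} (h : G.Joins e x y) : G.Joins e y x := Or.symm h

theorem Joins.ne {e : E} {x y : V} (h : G.Joins e x y) : x ≠ y := by
  rcases h with ⟨rfl, rfl⟩ | ⟨rfl, rfl⟩
  · exact G.fst_ne_snd e
  · exact (G.fst_ne_snd e).symm

theorem Joins.eq_or_eq {e : E} {x y u v : V} (h : G.Joins e x y) (h' : G.Joins e u v) :
    (x = u ∧ y = v) ∨ (x = v ∧ y = u) := by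
  rcases h with ⟨rfl, rfl⟩ | ⟨rfl, rfl⟩ <;> rcases h' with ⟨rfl, rfl⟩ | ⟨rfl, rfl⟩ <;> simp

variable (G)

theorem SPath.exists_fin {x y : V} {γ : Set E} {W : Set V} (h : SPath G.Joins x y γ W) :
    ∃ (n : ℕ) (v : Fin (n + 1) → V) (ε : Fin n → E), Function.Injective v ∧ v 0 = x ∧
      v (Fin.last n) = y ∧ (∀ k : Fin n, G.Joins (ε k) (v k.castSucc) (v k.succ)) ∧
      γ = range ε ∧ W = range v := by
  induction h with
  | nil x =>
    refine ⟨0, fun _ => x, Fin.elim0, fun i j _ => Subsingleton.elim (α := Fin 1) i j, rfl, rfl,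
      fun k => k.elim0, ?_, ?_⟩
    · simp
    · simp
  | @cons e x y z γ W he hx h' ih =>
    obtain ⟨n, v, ε, hv, h0, hl, hJ, rfl, rfl⟩ := ih
    refine ⟨n + 1, Fin.cons x v, Fin.cons e ε, Fin.cons_injective_iff.2 ⟨hx, hv⟩, rfl, ?_, ?_, ?_,
      ?_⟩
    · rw [← Fin.succ_last, Fin.cons_succ, hl]
    · intro k
      refine Fin.cases ?_ (fun k => ?_) k
      · simpa [h0] using he
      · have := hJ k
        simpa using this
    · rw [Fin.range_cons]
    · rw [Fin.range_cons]

theorem sPath_of_fin {n : ℕ} (v : Fin (n + 1) → V) (ε : Fin n → E) (hv : Function.Injective v)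
    (hJ : ∀ k : Fin n, G.Joins (ε k) (v k.castSucc) (v k.succ)) :
    SPath G.Joins (v 0) (v (Fin.last n)) (range ε) (range v) := by
  induction n with
  | zero =>
    have h1 : range ε = ∅ := range_eq_empty _
    have h2 : range v = {v 0} := by
      ext z
      constructor
      · rintro ⟨i, rfl⟩
        rw [Subsingleton.elim (α := Fin 1) i 0]; rfl
      · rintro rfl
        exact ⟨0, rfl⟩
    rw [h1, h2]
    exact .nil _
  | succ n ih =>
    have h1 := ih (fun i => v i.succ) (fun k => ε k.succ)
      (fun i j hij => Fin.succ_injective _ (hv hij)) (fun k => by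
        have := hJ k.succ
        simpa using this)
    have h2 : SPath G.Joins (v 0) (v (Fin.last (n + 1)))
        (insert (ε 0) (range fun k : Fin n => ε k.succ))
        (insert (v 0) (range fun i : Fin (n + 1) => v i.succ)) := by
      refine .cons (by simpa using hJ 0) ?_ h1
      rintro ⟨i, hi⟩
      exact Fin.succ_ne_zero i (hv hi)
    rw [← Fin.range_cons, ← Fin.range_cons] at h2
    convert h2 using 2
    · exact (Fin.cons_self_tail ε).symm
    · exact (Fin.cons_self_tail v).symm

theorem isPathFrom_iff {x y : V} {γ : Finset E} :
    G.IsPathFrom x y γ ↔ ∃ W, SPath G.Joins x y (γ : Set E) W := by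
  constructor
  · rintro ⟨n, v, ε, hv, rfl, rfl, hJ, hγ⟩
    rw [hγ]
    exact ⟨_, G.sPath_of_fin v ε hv hJ⟩
  · rintro ⟨W, h⟩
    obtain ⟨n, v, ε, hv, h0, hl, hJ, hγ, -⟩ := h.exists_fin G
    exact ⟨n, v, ε, hv, h0, hl, hJ, hγ⟩

theorem SPath.eq_or_eq {a b a' b' : V} {γ : Set E} {W W' : Set V} (h : SPath G.Joins a b γ W)
    (h' : SPath G.Joins a' b' γ W') (hab : a ≠ b) : a = a' ∨ a = b' := by
  classical
  set φ : V → ZMod 2 := fun v => if v = a then 1 else 0 with hφ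
  have key : ∀ {x y : V} {W : Set V}, SPath G.Joins x y γ W →
      ∑ᶠ e ∈ γ, (φ (G.fst e) - φ (G.snd e)) = φ y - φ x := fun hs =>
    hs.finsum_eq G (fun _ _ _ h => h) (by
      rintro e u v (⟨rfl, rfl⟩ | ⟨rfl, rfl⟩)
      · rw [CharTwo.sub_eq_add, CharTwo.sub_eq_add, add_comm]
      · rfl)
  have h1 := (key h).symm.trans (key h')
  by_contra! hne
  simp [hφ, hab.symm, hne.1.symm, hne.2.symm] at h1

theorem SPath.reverse {x y : V} {γ : Set E} {W : Set V} (h : SPath G.Joins x y γ W) :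
    SPath G.Joins y x γ W := by
  induction h with
  | nil => exact .nil _
  | @cons e x y z γ W he hx h' ih =>
    have h1 : SPath G.Joins y x (insert e ∅) (insert y {x}) :=
      .cons he.symm he.ne.symm (.nil x)
    have h2 := ih.append h1 (by
      rintro v ⟨hv, rfl | hv'⟩
      · rfl
      · rw [mem_singleton_iff] at hv'
        subst hv'
        exact absurd hv hx)
    convert h2 using 1
    · rw [union_comm, insert_union, empty_union]
    · ext v
      simp only [mem_insert_iff, mem_union, mem_singleton_iff]
      constructor
      · rintro (h | h)
        · exact .inr (.inr h)
        · exact .inl h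
      · rintro (h | rfl | h)
        · exact .inr h
        · exact .inr h'.left_mem
        · exact .inl h

theorem meets_iff {x y : V} {γ : Finset E} {W : Set V} (h : SPath G.Joins x y (γ : Set E) W)
    (hxy : x ≠ y) {v : V} : G.Meets γ v ↔ v ∈ W := by
  constructor
  · rintro ⟨e, he, hv⟩
    obtain ⟨u, hu, w, hw, hJ⟩ := h.exists_step (Finset.mem_coe.2 he)
    rcases hJ with ⟨rfl, rfl⟩ | ⟨rfl, rfl⟩ <;> rcases hv with rfl | rfl <;> assumption
  · intro hv
    obtain ⟨e, he, u, hu⟩ := h.exists_edge hv hxy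
    refine ⟨e, he, ?_⟩
    rcases hu with (⟨h1, h2⟩ | ⟨h1, h2⟩) | (⟨h1, h2⟩ | ⟨h1, h2⟩) <;> simp [h1, h2]

end Network

namespace PlaneNetwork

variable {V E : Type*} (N : PlaneNetwork V E)

/-- The parametrization of the edge `e` by `[0, 1]`, extended to the real line. -/
noncomputable def pt (e : E) : ℝ → ℂ := (N.arc e).extend

/-- The midpoint of the edge `e`. -/
noncomputable def mid (e : E) : ℂ := N.pt e (1 / 2)

theorem continuous_pt (e : E) : Continuous (N.pt e) := (N.arc e).continuous_extend

theorem pt_eq {e : E} {s : ℝ} (hs : s ∈ Icc (0 : ℝ) 1) : N.pt e s = N.arc e ⟨s, hs⟩ :=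
  Path.extend_apply _ hs

theorem pt_zero (e : E) : N.pt e 0 = N.pos (N.fst e) := Path.extend_zero _

theorem pt_one (e : E) : N.pt e 1 = N.pos (N.snd e) := Path.extend_one _

theorem injOn_pt (e : E) : InjOn (N.pt e) (Icc 0 1) := by
  intro s hs t ht h
  rw [N.pt_eq hs, N.pt_eq ht] at h
  exact congrArg Subtype.val (N.arc_injective e h)

theorem image_pt (e : E) : N.pt e '' Icc 0 1 = range (N.arc e) := by
  ext z
  constructor
  · rintro ⟨s, hs, rfl⟩
    exact ⟨⟨s, hs⟩, (N.pt_eq hs).symm⟩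
  · rintro ⟨s, rfl⟩
    exact ⟨s, s.2, N.pt_eq s.2⟩

theorem pt_eq_pos {e : E} {s : ℝ} (hs : s ∈ Icc (0 : ℝ) 1) {v : V} (h : N.pt e s = N.pos v) :
    (s = 0 ∧ v = N.fst e) ∨ (s = 1 ∧ v = N.snd e) := by
  have h1 := h
  rw [N.pt_eq hs] at h1
  rcases N.arc_vertex e _ _ h1 with h2 | h2
  · have : s = 0 := congrArg Subtype.val h2
    subst this
    rw [N.pt_zero] at h
    exact .inl ⟨rfl, N.pos_injective h.symm⟩
  · have : s = 1 := congrArg Subtype.val h2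
    subst this
    rw [N.pt_one] at h
    exact .inr ⟨rfl, N.pos_injective h.symm⟩

theorem pt_eq_pt {e e' : E} (hee : e ≠ e') {s s' : ℝ} (hs : s ∈ Icc (0 : ℝ) 1)
    (hs' : s' ∈ Icc (0 : ℝ) 1) (h : N.pt e s = N.pt e' s') : s = 0 ∨ s = 1 := by
  rw [N.pt_eq hs, N.pt_eq hs'] at h
  rcases N.arc_disjoint e e' hee _ _ h with h2 | h2
  · exact .inl (congrArg Subtype.val h2)
  · exact .inr (congrArg Subtype.val h2)

theorem pt_mem {e : E} {s : ℝ} (hs : s ∈ Icc (0 : ℝ) 1) : N.pt e s ∈ N.curve.closedDomain := by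
  rw [N.pt_eq hs]
  exact N.arc_mem e _

theorem half_mem : (1 / 2 : ℝ) ∈ Icc (0 : ℝ) 1 := by constructor <;> norm_num

theorem mid_mem (e : E) : N.mid e ∈ N.curve.closedDomain := N.pt_mem half_mem

theorem isLogContinuum_pt (e : E) {u v : ℝ} (hu : 0 ≤ u) (huv : u ≤ v) (hv : v ≤ 1) :
    IsLogContinuum (N.pt e '' Icc u v) :=
  isLogContinuum_image_Icc huv (N.continuous_pt e).continuousOn
    ((N.injOn_pt e).mono (Icc_subset_Icc hu hv))

/-- The subset of the plane covered by the vertices in `W` and the edges in `γ`. -/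
def carrier (γ : Set E) (W : Set V) : Set ℂ := N.pos '' W ∪ ⋃ e ∈ γ, range (N.arc e)

theorem pos_mem_carrier {γ : Set E} {W : Set V} {v : V} (hv : v ∈ W) :
    N.pos v ∈ N.carrier γ W := .inl ⟨v, hv, rfl⟩

theorem pt_mem_carrier {γ : Set E} {W : Set V} {e : E} (he : e ∈ γ) {s : ℝ}
    (hs : s ∈ Icc (0 : ℝ) 1) : N.pt e s ∈ N.carrier γ W := by
  refine .inr (mem_biUnion he ?_)
  rw [← N.image_pt]
  exact ⟨s, hs, rfl⟩

theorem mem_carrier_iff {γ : Set E} {W : Set V} {z : ℂ} : z ∈ N.carrier γ W ↔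
    (∃ v ∈ W, N.pos v = z) ∨ ∃ e ∈ γ, ∃ s ∈ Icc (0 : ℝ) 1, N.pt e s = z := by
  simp only [carrier, mem_union, mem_iUnion, ← N.image_pt, mem_image, exists_prop]

theorem carrier_subset_closedDomain (γ : Set E) (W : Set V) :
    N.carrier γ W ⊆ N.curve.closedDomain := by
  intro z hz
  rcases N.mem_carrier_iff.1 hz with ⟨v, -, rfl⟩ | ⟨e, -, s, hs, rfl⟩
  · exact N.pos_mem v
  · exact N.pt_mem hs

theorem carrier_mono {γ γ' : Set E} {W W' : Set V} (hγ : γ ⊆ γ') (hW : W ⊆ W') :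
    N.carrier γ W ⊆ N.carrier γ' W' :=
  union_subset_union (image_mono hW) (biUnion_subset_biUnion_left hγ)

theorem carrier_union (γ γ' : Set E) (W W' : Set V) :
    N.carrier (γ ∪ γ') (W ∪ W') = N.carrier γ W ∪ N.carrier γ' W' := by
  simp only [carrier, image_union, biUnion_union]
  ac_rfl

theorem pt_notMem_carrier {γ : Set E} {W : Set V} {e : E} (he : e ∉ γ) {s : ℝ}
    (hs : s ∈ Ioo (0 : ℝ) 1) : N.pt e s ∉ N.carrier γ W := by
  intro h
  have hs' := Ioo_subset_Icc_self hs
  rcases N.mem_carrier_iff.1 h with ⟨v, -, hv⟩ | ⟨e', he', s', hs'', h'⟩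
  · rcases N.pt_eq_pos hs' hv.symm with ⟨h1, -⟩ | ⟨h1, -⟩
    · exact hs.1.ne' h1
    · exact hs.2.ne h1
  · rcases N.pt_eq_pt (fun h1 : e = e' => he (h1.symm ▸ he')) hs' hs'' h'.symm with h1 | h1
    · exact hs.1.ne' h1
    · exact hs.2.ne h1

theorem mid_notMem_carrier {γ : Set E} {W : Set V} {e : E} (he : e ∉ γ) :
    N.mid e ∉ N.carrier γ W := N.pt_notMem_carrier he (by constructor <;> norm_num)

variable {N} {γ γ' : Set E} {W W' : Set V} {a b : V}

open Network

theorem pos_mem_carrier_iff (h : SPath N.Joins a b γ W) {v : V} :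
    N.pos v ∈ N.carrier γ W ↔ v ∈ W := by
  refine ⟨fun hv => ?_, N.pos_mem_carrier⟩
  rcases N.mem_carrier_iff.1 hv with ⟨u, hu, huv⟩ | ⟨e, he, s, hs, hsv⟩
  · rwa [← N.pos_injective huv]
  · obtain ⟨u, hu, w, hw, hJ⟩ := h.exists_step he
    rcases N.pt_eq_pos hs hsv with ⟨-, rfl⟩ | ⟨-, rfl⟩ <;>
      rcases hJ with ⟨rfl, rfl⟩ | ⟨rfl, rfl⟩ <;> assumption

/-- An arc of an edge outside of the path `γ` meets `γ` in ends of the edge only. -/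
theorem pt_mem_carrier_iff (h : SPath N.Joins a b γ W) {e : E} (he : e ∉ γ) {s : ℝ}
    (hs : s ∈ Icc (0 : ℝ) 1) :
    N.pt e s ∈ N.carrier γ W ↔ (s = 0 ∧ N.fst e ∈ W) ∨ (s = 1 ∧ N.snd e ∈ W) := by
  constructor
  · intro hc
    rcases eq_or_ne s 0 with rfl | h0
    · rw [N.pt_zero, pos_mem_carrier_iff h] at hc
      exact .inl ⟨rfl, hc⟩
    rcases eq_or_ne s 1 with rfl | h1
    · rw [N.pt_one, pos_mem_carrier_iff h] at hc
      exact .inr ⟨rfl, hc⟩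
    exact absurd hc (N.pt_notMem_carrier he ⟨lt_of_le_of_ne hs.1 h0.symm, lt_of_le_of_ne hs.2 h1⟩)
  · rintro (⟨rfl, hW⟩ | ⟨rfl, hW⟩)
    · rw [N.pt_zero]; exact N.pos_mem_carrier hW
    · rw [N.pt_one]; exact N.pos_mem_carrier hW

theorem notMem_edges (h : SPath N.Joins a b γ W) {e : E} {x y : V} (he : N.Joins e x y)
    (hx : x ∉ W) : e ∉ γ := by
  intro heγ
  obtain ⟨u, hu, w, hw, hJ⟩ := h.exists_step heγ
  rcases he.eq_or_eq hJ with ⟨rfl, rfl⟩ | ⟨rfl, rfl⟩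
  · exact hx hu
  · exact hx hw

theorem isLogContinuum_carrier (h : SPath N.Joins a b γ W) :
    IsLogContinuum (N.carrier γ W) := by
  induction h with
  | nil x => simpa [carrier] using isLogContinuum_singleton (N.pos x)
  | @cons e x y z γ W he hx h' ih =>
    have heγ := notMem_edges h' he hx
    have h1 : N.carrier (insert e γ) (insert x W) = N.pt e '' Icc 0 1 ∪ N.carrier γ W := by
      have h2 : N.pos x ∈ range (N.arc e) := by
        rw [← N.image_pt]
        rcases he with ⟨rfl, -⟩ | ⟨-, rfl⟩
        · exact ⟨0, ⟨le_rfl, zero_le_one⟩, N.pt_zero e⟩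
        · exact ⟨1, ⟨zero_le_one, le_rfl⟩, N.pt_one e⟩
      simp only [carrier, image_insert_eq, biUnion_insert, N.image_pt]
      rw [insert_union, ← union_assoc, union_comm (N.pos '' W), union_assoc,
        insert_eq_of_mem (mem_union_left _ h2)]
    rw [h1]
    refine (N.isLogContinuum_pt e le_rfl zero_le_one le_rfl).union ih (x := N.pos y) ?_
    apply Subset.antisymm
    · rintro _ ⟨⟨s, hs, rfl⟩, hc⟩
      rw [pt_mem_carrier_iff h' heγ hs] at hc
      rcases he with ⟨rfl, rfl⟩ | ⟨rfl, rfl⟩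
      · rcases hc with ⟨rfl, h3⟩ | ⟨rfl, h3⟩
        · exact absurd h3 hx
        · exact N.pt_one e
      · rcases hc with ⟨rfl, h3⟩ | ⟨rfl, h3⟩
        · exact N.pt_zero e
        · exact absurd h3 hx
    · rintro _ rfl
      refine ⟨?_, N.pos_mem_carrier h'.left_mem⟩
      rcases he with ⟨-, rfl⟩ | ⟨rfl, -⟩
      · exact ⟨1, ⟨zero_le_one, le_rfl⟩, N.pt_one e⟩
      · exact ⟨0, ⟨le_rfl, zero_le_one⟩, N.pt_zero e⟩

theorem exists_half {e : E} {u v : V} (h : N.Joins e u v) :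
    ∃ H₁ H₂ : Set ℂ, IsLogContinuum H₁ ∧ IsLogContinuum H₂ ∧ H₁ ⊆ N.carrier {e} ∅ ∧
      H₂ ⊆ N.carrier {e} ∅ ∧ N.pos u ∈ H₁ ∧ N.mid e ∈ H₁ ∧ N.mid e ∈ H₂ ∧ N.pos v ∈ H₂ ∧
      H₁ ∩ H₂ ⊆ {N.mid e} ∧ N.pos v ∉ H₁ ∧ N.pos u ∉ H₂ ∧ N.carrier {e} ∅ ⊆ H₁ ∪ H₂ := by
  have h0 : (0 : ℝ) ≤ 1 / 2 := by norm_num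
  have h1 : (1 / 2 : ℝ) ≤ 1 := by norm_num
  have key : IsLogContinuum (N.pt e '' Icc 0 (1 / 2)) ∧ IsLogContinuum (N.pt e '' Icc (1 / 2) 1) ∧
      N.pt e '' Icc 0 (1 / 2) ⊆ N.carrier {e} ∅ ∧ N.pt e '' Icc (1 / 2) 1 ⊆ N.carrier {e} ∅ ∧
      N.pos (N.fst e) ∈ N.pt e '' Icc 0 (1 / 2) ∧ N.mid e ∈ N.pt e '' Icc 0 (1 / 2) ∧
      N.mid e ∈ N.pt e '' Icc (1 / 2) 1 ∧ N.pos (N.snd e) ∈ N.pt e '' Icc (1 / 2) 1 ∧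
      N.pt e '' Icc 0 (1 / 2) ∩ N.pt e '' Icc (1 / 2) 1 ⊆ {N.mid e} ∧
      N.pos (N.snd e) ∉ N.pt e '' Icc 0 (1 / 2) ∧ N.pos (N.fst e) ∉ N.pt e '' Icc (1 / 2) 1 ∧
      N.carrier {e} ∅ ⊆ N.pt e '' Icc 0 (1 / 2) ∪ N.pt e '' Icc (1 / 2) 1 := by
    refine ⟨N.isLogContinuum_pt e le_rfl h0 h1, N.isLogContinuum_pt e h0 h1 le_rfl, ?_, ?_,
      ⟨0, ⟨le_rfl, h0⟩, N.pt_zero e⟩, ⟨_, ⟨h0, le_rfl⟩, rfl⟩, ⟨_, ⟨le_rfl, h1⟩, rfl⟩,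
      ⟨1, ⟨h1, le_rfl⟩, N.pt_one e⟩, ?_, ?_, ?_, ?_⟩
    · rintro _ ⟨s, hs, rfl⟩
      exact N.pt_mem_carrier (mem_singleton e) ⟨hs.1, hs.2.trans h1⟩
    · rintro _ ⟨s, hs, rfl⟩
      exact N.pt_mem_carrier (mem_singleton e) ⟨h0.trans hs.1, hs.2⟩
    · rintro _ ⟨⟨s, hs, rfl⟩, ⟨t, ht, hts⟩⟩
      have := N.injOn_pt e ⟨h0.trans ht.1, ht.2⟩ ⟨hs.1, hs.2.trans h1⟩ hts
      subst this
      rw [le_antisymm hs.2 ht.1]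
      rfl
    · rintro ⟨s, hs, h⟩
      rcases N.pt_eq_pos ⟨hs.1, hs.2.trans h1⟩ h with ⟨-, h2⟩ | ⟨h2, -⟩
      · exact N.fst_ne_snd e h2.symm
      · linarith [hs.2]
    · rintro ⟨s, hs, h⟩
      rcases N.pt_eq_pos ⟨h0.trans hs.1, hs.2⟩ h with ⟨h2, -⟩ | ⟨-, h2⟩
      · linarith [hs.1]
      · exact N.fst_ne_snd e h2
    · rw [← image_union, Icc_union_Icc_eq_Icc h0 h1, N.image_pt]
      simp [carrier]
  rcases h with ⟨rfl, rfl⟩ | ⟨rfl, rfl⟩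
  · exact ⟨_, _, key⟩
  · obtain ⟨a1, a2, a3, a4, a5, a6, a7, a8, a9, a10, a11, a12⟩ := key
    exact ⟨_, _, a2, a1, a4, a3, a8, a7, a6, a5, by rwa [inter_comm], a11, a10, by
      rwa [union_comm]⟩

theorem carrier_inter_carrier {a' b' : V} (h : SPath N.Joins a b γ W)
    (h' : SPath N.Joins a' b' γ' W') (hγ : Disjoint γ γ') :
    N.carrier γ W ∩ N.carrier γ' W' = N.pos '' (W ∩ W') := by
  apply Subset.antisymm
  · rintro z ⟨hz, hz'⟩
    rcases N.mem_carrier_iff.1 hz with ⟨v, hv, rfl⟩ | ⟨e, he, s, hs, rfl⟩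
    · exact ⟨v, ⟨hv, (pos_mem_carrier_iff h').1 hz'⟩, rfl⟩
    · have hends : N.fst e ∈ W ∧ N.snd e ∈ W := by
        obtain ⟨u, hu, w, hw, hJ⟩ := h.exists_step he
        rcases hJ with ⟨rfl, rfl⟩ | ⟨rfl, rfl⟩
        · exact ⟨hu, hw⟩
        · exact ⟨hw, hu⟩
      rcases (pt_mem_carrier_iff h' (disjoint_left.1 hγ he) hs).1 hz' with ⟨rfl, h1⟩ | ⟨rfl, h1⟩
      · exact ⟨_, ⟨hends.1, h1⟩, (N.pt_zero e).symm⟩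
      · exact ⟨_, ⟨hends.2, h1⟩, (N.pt_one e).symm⟩
  · rintro _ ⟨v, hv, rfl⟩
    exact ⟨N.pos_mem_carrier hv.1, N.pos_mem_carrier hv.2⟩

theorem sPath_edge {e : E} {u v : V} (he : N.Joins e u v) : SPath N.Joins u v {e} {u, v} := by
  have := SPath.cons (P := N.Joins) he he.ne (SPath.nil v)
  simpa using this

theorem eq_pos_of_mem_edge (h : SPath N.Joins a b γ W) {e : E} {u v : V} (he : N.Joins e u v)
    (hv : v ∉ W) {z : ℂ} (hz : z ∈ N.carrier {e} ∅) (hz' : z ∈ N.carrier γ W) : z = N.pos u := by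
  have h1 : z ∈ N.carrier {e} {u, v} ∩ N.carrier γ W :=
    ⟨N.carrier_mono subset_rfl (empty_subset _) hz, hz'⟩
  rw [carrier_inter_carrier (sPath_edge he) h
    (disjoint_singleton_left.2 (notMem_edges h he.symm hv))] at h1
  obtain ⟨w, ⟨rfl | rfl, hw⟩, rfl⟩ := h1
  · rfl
  · exact absurd hw hv

/-- A path is cut into two continua by the midpoint of any of its edges. -/
theorem exists_cut (h : SPath N.Joins a b γ W) {e : E} (he : e ∈ γ) :
    ∃ K₁ K₂ : Set ℂ, IsLogContinuum K₁ ∧ IsLogContinuum K₂ ∧ K₁ ⊆ N.carrier γ W ∧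
      K₂ ⊆ N.carrier γ W ∧ N.carrier γ W ⊆ K₁ ∪ K₂ ∧
      N.pos a ∈ K₁ ∧ N.mid e ∈ K₁ ∧ N.mid e ∈ K₂ ∧ N.pos b ∈ K₂ ∧
      K₁ ∩ K₂ ⊆ {N.mid e} := by
  obtain ⟨u, v, γ₁, W₁, γ₂, W₂, h₁, hJ, h₂, hd, rfl, rfl⟩ := h.split_edge he
  obtain ⟨H₁, H₂, l₁, l₂, s₁, s₂, hu, m₁, m₂, hv, hH, hv', hu', hcov⟩ := exists_half hJ
  have hvW : v ∉ W₁ := disjoint_right.1 hd h₂.left_mem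
  have huW : u ∉ W₂ := disjoint_left.1 hd h₁.right_mem
  have hdγ : Disjoint γ₁ γ₂ := by
    rw [disjoint_left]
    intro e' he₁ he₂
    obtain ⟨w, hw, w', -, hJ'⟩ := h₁.exists_step he₁
    exact notMem_edges h₂ hJ' (disjoint_left.1 hd hw) he₂
  have hc : N.carrier (insert e (γ₁ ∪ γ₂)) (W₁ ∪ W₂) =
      N.carrier {e} ∅ ∪ (N.carrier γ₁ W₁ ∪ N.carrier γ₂ W₂) := by
    rw [← N.carrier_union, ← N.carrier_union, singleton_union, empty_union]
  refine ⟨N.carrier γ₁ W₁ ∪ H₁, H₂ ∪ N.carrier γ₂ W₂,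
    (isLogContinuum_carrier h₁).union l₁ (x := N.pos u) ?_,
    l₂.union (isLogContinuum_carrier h₂) (x := N.pos v) ?_, ?_, ?_, ?_,
    .inl (N.pos_mem_carrier h₁.left_mem), .inr m₁, .inl m₂,
    .inr (N.pos_mem_carrier h₂.right_mem), ?_⟩
  · refine Subset.antisymm (fun z hz => eq_pos_of_mem_edge h₁ hJ hvW (s₁ hz.2) hz.1) ?_
    rintro _ rfl
    exact ⟨N.pos_mem_carrier h₁.right_mem, hu⟩
  · refine Subset.antisymm (fun z hz => eq_pos_of_mem_edge h₂ hJ.symm huW (s₂ hz.1) hz.2) ?_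
    rintro _ rfl
    exact ⟨hv, N.pos_mem_carrier h₂.left_mem⟩
  · rw [hc]
    exact union_subset (fun z hz => .inr (.inl hz)) fun z hz => .inl (s₁ hz)
  · rw [hc]
    exact union_subset (fun z hz => .inl (s₂ hz)) fun z hz => .inr (.inr hz)
  · rw [hc]
    rintro z (hz | hz | hz)
    · rcases hcov hz with h | h
      · exact .inl (.inr h)
      · exact .inr (.inl h)
    · exact .inl (.inl hz)
    · exact .inr (.inr hz)
  · rintro z ⟨hz | hz, hz' | hz'⟩
    · rw [eq_pos_of_mem_edge h₁ hJ hvW (s₂ hz') hz] at hz'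
      exact absurd hz' hu'
    · have h1 : z ∈ N.carrier γ₁ W₁ ∩ N.carrier γ₂ W₂ := ⟨hz, hz'⟩
      rw [carrier_inter_carrier h₁ h₂ hdγ, hd.inter_eq, image_empty] at h1
      exact absurd h1 (notMem_empty _)
    · exact hH ⟨hz, hz'⟩
    · rw [eq_pos_of_mem_edge h₂ hJ.symm huW (s₁ hz) hz'] at hz
      exact absurd hz hv'

/-- The winding number of the closed curve formed by a path and another continuum with the same
ends does not vanish near an edge of the path which the continuum avoids. -/
theorem exists_logIncrement_ne (h : SPath N.Joins a b γ W) {T : Set ℂ} (hT : IsLogContinuum T)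
    (ha : N.pos a ∈ T) (hb : N.pos b ∈ T) {e : E} (he : e ∈ γ) (heT : N.mid e ∉ T)
    {S : Set ℂ} (hS : S ∈ 𝓝 (N.mid e)) :
    ∃ z ∈ S, z ∉ N.carrier γ W ∧ z ∉ T ∧
      logIncrement (N.carrier γ W) (N.pos a) (N.pos b) z ≠
        logIncrement T (N.pos a) (N.pos b) z := by
  obtain ⟨K₁, K₂, l₁, l₂, s₁, s₂, hcov, a₁, m₁, m₂, b₂, hK⟩ := exists_cut h he
  obtain ⟨r, hr, hball⟩ := Metric.mem_nhds_iff.1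
    (inter_mem hS (hT.isClosed.isOpen_compl.mem_nhds heT))
  have hl := isLogContinuum_carrier h
  have hby : r ≤ dist (N.pos b) (N.mid e) := by
    by_contra hlt
    exact (hball (mem_ball.2 (not_le.1 hlt))).2 hb
  have hne : ∀ {K : Set ℂ} {w z : ℂ}, w ∈ K → z ∉ K → w - z ≠ 0 := fun hw hz h =>
    hz (sub_eq_zero.1 h ▸ hw)
  have hMR : K₂ ∩ (T ∪ K₁) ∩ ball (N.mid e) r ⊆ {N.mid e} := by
    rintro z ⟨⟨hz₂, hz | hz⟩, hzb⟩
    · exact absurd hz (hball hzb).2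
    · exact hK ⟨hz, hz₂⟩
  have he₂ : ∀ z, z ∉ T ∪ K₁ → exp (logIncrement T (N.pos a) (N.pos b) z -
      logIncrement K₁ (N.pos a) (N.mid e) z) = (N.pos b - z) / (N.mid e - z) := by
    intro z hz
    have hzT : z ∉ T := fun h => hz (.inl h)
    have hz₁ : z ∉ K₁ := fun h => hz (.inr h)
    rw [exp_sub, exp_logIncrement hT ha hb hzT, exp_logIncrement l₁ a₁ m₁ hz₁]
    have h1 := hne ha hzT
    have h2 := hne m₁ hz₁
    field_simp
  obtain ⟨z, hz, hz₂, hzR, hzD⟩ := exists_ne_of_exp_eq (M := K₂) (R := T ∪ K₁)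
    (p := N.mid e) (y := N.pos b)
    (D₁ := logIncrement K₂ (N.mid e) (N.pos b))
    (D₂ := fun z => logIncrement T (N.pos a) (N.pos b) z - logIncrement K₁ (N.pos a) (N.mid e) z)
    l₂.isClosed (hT.isClosed.union l₁.isClosed) hr hMR hby
    (continuousOn_logIncrement l₂ m₂ b₂)
    (((continuousOn_logIncrement hT ha hb).mono (compl_subset_compl.2 subset_union_left)).sub
      ((continuousOn_logIncrement l₁ a₁ m₁).mono (compl_subset_compl.2 subset_union_right)))
    (fun z hz => exp_logIncrement l₂ m₂ b₂ hz) he₂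
  have hz₁ : z ∉ K₁ := fun h => hzR (.inr h)
  have hzγ : z ∉ N.carrier γ W := fun h => (hcov h).elim hz₁ hz₂
  refine ⟨z, (hball hz).1, hzγ, fun h => hzR (.inl h), fun heq => hzD ?_⟩
  rw [← heq, ← logIncrement_add hl (s₁ a₁) (s₂ b₂) (s₁ m₁) hzγ,
    logIncrement_mono hl l₁.isPreconnected s₁ a₁ m₁ hzγ,
    logIncrement_mono hl l₂.isPreconnected s₂ m₂ b₂ hzγ]
  ring

end PlaneNetwork

namespace PlaneNetwork

variable {V E : Type*} (N : PlaneNetwork V E)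

open Network

/-- The path with edge set `γ` and vertex set `W` runs from the vertex `a`, situated at the point
`c s` of the left arc, to the vertex `b`, situated at the point `c t` of the right arc. -/
structure IsCrossing (s t : ℝ) (a b : V) (γ : Set E) (W : Set V) : Prop where
  left : s ∈ Icc N.curve.t₀ N.curve.t₁
  right : t ∈ Icc N.curve.t₂ N.curve.t₃
  pos_left : N.pos a = N.curve.c s
  pos_right : N.pos b = N.curve.c t
  path : SPath N.Joins a b γ W

theorem disjoint_A_B : Disjoint N.A N.B := by
  rw [disjoint_left]
  rintro v ⟨s, hs, hsv⟩ ⟨t, ht, htv⟩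
  have := N.curve.c_injOn N.curve.t₀
    ⟨hs.1, by linarith [hs.2, N.curve.t₁_lt_t₂, N.curve.t₂_lt_t₃, N.curve.t₃_lt]⟩
    ⟨by linarith [ht.1, N.curve.t₀_lt_t₁, N.curve.t₁_lt_t₂], ht.2.trans_lt N.curve.t₃_lt⟩
    (hsv.trans htv.symm)
  linarith [hs.2, ht.1, N.curve.t₁_lt_t₂]

theorem exists_isCrossing {a b : V} {γ : Set E} {W : Set V} (ha : a ∈ N.A) (hb : b ∈ N.B)
    (h : SPath N.Joins a b γ W) : ∃ s t, N.IsCrossing s t a b γ W := by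
  obtain ⟨s, hs, hsa⟩ := ha
  obtain ⟨t, ht, htb⟩ := hb
  exact ⟨s, t, hs, ht, hsa.symm, htb.symm, h⟩

theorem mem_abPaths_iff {γ : Finset E} :
    γ ∈ N.abPaths ↔ ∃ a ∈ N.A, ∃ b ∈ N.B, ∃ W, SPath N.Joins a b (γ : Set E) W := by
  simp only [abPaths, pathFamily, mem_ofPred_eq, N.isPathFrom_iff]

namespace IsCrossing

variable {N} {s t s' t' : ℝ} {a b a' b' : V} {γ γ' : Set E} {W W' : Set V}

theorem left_mem_A (h : N.IsCrossing s t a b γ W) : a ∈ N.A := ⟨s, h.left, h.pos_left.symm⟩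

theorem right_mem_B (h : N.IsCrossing s t a b γ W) : b ∈ N.B := ⟨t, h.right, h.pos_right.symm⟩

theorem ne (h : N.IsCrossing s t a b γ W) : a ≠ b :=
  N.disjoint_A_B.ne_of_mem h.left_mem_A h.right_mem_B

theorem isSlit (h : N.IsCrossing s t a b γ W) : N.curve.IsSlit s t (N.carrier γ W) where
  lt := by linarith [h.left.2, h.right.1, N.curve.t₁_lt_t₂]
  lt_add_one := by linarith [h.left.1, h.right.2, N.curve.t₃_lt]
  isLogContinuum := isLogContinuum_carrier h.path
  subset := N.carrier_subset_closedDomain _ _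
  left_mem := h.pos_left ▸ N.pos_mem_carrier h.path.left_mem
  right_mem := h.pos_right ▸ N.pos_mem_carrier h.path.right_mem

theorem left_unique {s s' : ℝ} (hs : s ∈ Icc N.curve.t₀ N.curve.t₁)
    (hs' : s' ∈ Icc N.curve.t₀ N.curve.t₁) (h : N.curve.c s = N.curve.c s') : s = s' := by
  have h1 : N.curve.t₁ < N.curve.t₀ + 1 := by
    linarith [N.curve.t₁_lt_t₂, N.curve.t₂_lt_t₃, N.curve.t₃_lt]
  exact N.curve.c_injOn N.curve.t₀ ⟨hs.1, hs.2.trans_lt h1⟩ ⟨hs'.1, hs'.2.trans_lt h1⟩ h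

theorem right_unique {t t' : ℝ} (ht : t ∈ Icc N.curve.t₂ N.curve.t₃)
    (ht' : t' ∈ Icc N.curve.t₂ N.curve.t₃) (h : N.curve.c t = N.curve.c t') : t = t' := by
  have h1 : N.curve.t₃ < N.curve.t₂ + 1 := by
    linarith [N.curve.t₀_lt_t₁, N.curve.t₁_lt_t₂, N.curve.t₃_lt]
  exact N.curve.c_injOn N.curve.t₂ ⟨ht.1, ht.2.trans_lt h1⟩ ⟨ht'.1, ht'.2.trans_lt h1⟩ h

theorem unique (h : N.IsCrossing s t a b γ W) (h' : N.IsCrossing s' t' a' b' γ W') :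
    s = s' ∧ t = t' ∧ a = a' ∧ b = b' := by
  have ha : a = a' := (h.path.eq_or_eq N.toNetwork h'.path h.ne).resolve_right
    (N.disjoint_A_B.ne_of_mem h.left_mem_A h'.right_mem_B)
  have hb : b = b' := ((h.path.reverse N.toNetwork).eq_or_eq N.toNetwork h'.path
    h.ne.symm).resolve_left (N.disjoint_A_B.ne_of_mem h'.left_mem_A h.right_mem_B).symm
  refine ⟨left_unique h.left h'.left ?_, right_unique h.right h'.right ?_, ha, hb⟩
  · rw [← h.pos_left, ← h'.pos_left, ha]
  · rw [← h.pos_right, ← h'.pos_right, hb]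

theorem exists_pt_eq (h : N.IsCrossing s t a b γ W) {v : V} (hv : v ∈ W) :
    ∃ e ∈ γ, ∃ r ∈ Icc (0 : ℝ) 1, N.pt e r = N.pos v := by
  obtain ⟨e, he, u, hu⟩ := h.path.exists_edge hv h.ne
  have : N.fst e = v ∨ N.snd e = v := by
    rcases hu with (⟨h1, h2⟩ | ⟨h1, h2⟩) | (⟨h1, h2⟩ | ⟨h1, h2⟩) <;> simp [h1, h2]
  rcases this with rfl | rfl
  · exact ⟨e, he, 0, ⟨le_rfl, zero_le_one⟩, N.pt_zero e⟩
  · exact ⟨e, he, 1, ⟨zero_le_one, le_rfl⟩, N.pt_one e⟩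

theorem mem_carrier_iff (h : N.IsCrossing s t a b γ W) {z : ℂ} :
    z ∈ N.carrier γ W ↔ ∃ e ∈ γ, ∃ r ∈ Icc (0 : ℝ) 1, N.pt e r = z := by
  rw [N.mem_carrier_iff]
  refine or_iff_right_of_imp ?_
  rintro ⟨v, hv, rfl⟩
  exact h.exists_pt_eq hv

theorem trace_eq {γ : Finset E} (h : N.IsCrossing s t a b γ W) :
    N.trace γ = N.carrier γ W := by
  ext z
  rw [h.mem_carrier_iff]
  simp only [trace, ← N.image_pt, mem_iUnion, mem_image, exists_prop, Finset.mem_coe]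

theorem isBelow_pt_iff (h : N.IsCrossing s t a b γ W) {e : E} (he : e ∉ γ) {r : ℝ}
    (hr : r ∈ Icc (0 : ℝ) 1) (hrT : N.pt e r ∉ N.carrier γ W) :
    N.curve.IsBelow s t (N.carrier γ W) (N.pt e r) ↔
      N.curve.IsBelow s t (N.carrier γ W) (N.mid e) := by
  have hsub : uIcc r (1 / 2) ⊆ Icc (0 : ℝ) 1 := uIcc_subset_Icc hr half_mem
  refine h.isSlit.isBelow_iff_of_isPreconnected (S := N.pt e '' uIcc r (1 / 2))
    (isPreconnected_uIcc.image _ (N.continuous_pt e).continuousOn) ?_ ?_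
    ⟨r, left_mem_uIcc, rfl⟩ ⟨_, right_mem_uIcc, rfl⟩
  · rintro _ ⟨x, hx, rfl⟩
    exact N.pt_mem (hsub hx)
  · rw [disjoint_left]
    rintro _ ⟨x, hx, rfl⟩ hxT
    have h1 := hsub hx
    rcases (pt_mem_carrier_iff h.path he h1).1 hxT with ⟨h0, -⟩ | ⟨h0, -⟩
    · have : r = 0 := by
        rcases le_total r (1 / 2) with h2 | h2
        · rw [uIcc_of_le h2] at hx
          linarith [hx.1, hr.1]
        · rw [uIcc_of_ge h2] at hx
          linarith [hx.1]
      exact hrT (by rw [this, ← h0]; exact hxT)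
    · have : r = 1 := by
        rcases le_total r (1 / 2) with h2 | h2
        · rw [uIcc_of_le h2] at hx
          linarith [hx.2]
        · rw [uIcc_of_ge h2] at hx
          linarith [hx.2, hr.2]
      exact hrT (by rw [this, ← h0]; exact hxT)

theorem edgeBelow_iff_forall {γ : Finset E} (h : N.IsCrossing s t a b γ W) {e : E} :
    N.EdgeBelow e γ ↔ ∀ r ∈ Icc (0 : ℝ) 1, N.pt e r ∈ N.carrier γ W ∨
      N.curve.IsBelow s t (N.carrier γ W) (N.pt e r) := by
  have key : range (N.arc e) ⊆ N.trace γ ∪ N.regionBelow γ s t ↔ ∀ r ∈ Icc (0 : ℝ) 1,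
      N.pt e r ∈ N.carrier γ W ∨ N.curve.IsBelow s t (N.carrier γ W) (N.pt e r) := by
    rw [← N.image_pt, image_subset_iff]
    refine forall₂_congr fun r hr => ?_
    rw [mem_preimage, mem_union, h.trace_eq]
    by_cases hT : N.pt e r ∈ N.carrier γ W
    · simp [hT]
    · simp only [hT, false_or, regionBelow, h.trace_eq, mem_ofPred_eq]
      rw [h.isSlit.isBelow_iff_nonempty (N.pt_mem hr) hT]
      exact and_iff_right ⟨N.pt_mem hr, hT⟩
  rw [← key]
  constructor
  · rintro ⟨s', hs', t', ht', a', b', ha', hb', hp, hsub⟩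
    obtain ⟨W', hW'⟩ := N.isPathFrom_iff.1 hp
    obtain ⟨rfl, rfl, -, -⟩ := h.unique (⟨hs', ht', ha', hb', hW'⟩ : N.IsCrossing s' t' a' b' γ W')
    exact hsub
  · intro hsub
    exact ⟨s, h.left, t, h.right, a, b, h.pos_left, h.pos_right,
      N.isPathFrom_iff.2 ⟨W, h.path⟩, hsub⟩

theorem edgeBelow_iff {γ : Finset E} (h : N.IsCrossing s t a b γ W) {e : E} :
    N.EdgeBelow e γ ↔ e ∈ γ ∨ N.curve.IsBelow s t (N.carrier γ W) (N.mid e) := by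
  rw [h.edgeBelow_iff_forall]
  by_cases he : e ∈ γ
  · simp only [he, true_or, iff_true]
    exact fun r hr => .inl (N.pt_mem_carrier he hr)
  · simp only [he, false_or]
    constructor
    · intro hall
      exact (hall _ half_mem).resolve_left (N.mid_notMem_carrier he)
    · intro hm r hr
      by_cases hT : N.pt e r ∈ N.carrier γ W
      · exact .inl hT
      · exact .inr ((h.isBelow_pt_iff he hr hT).2 hm)

end IsCrossing

variable {N} {s t s' t' : ℝ} {a b a' b' : V} {γ γ' : Finset E} {W W' : Set V}

theorem mem_or_isBelow_of_le (h : N.IsCrossing s t a b γ W) (h' : N.IsCrossing s' t' a' b' γ' W')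
    (hle : ∀ e ∈ γ, N.EdgeBelow e γ') {z : ℂ} (hz : z ∈ N.carrier γ W) :
    z ∈ N.carrier γ' W' ∨ N.curve.IsBelow s' t' (N.carrier γ' W') z := by
  obtain ⟨e, he, r, hr, rfl⟩ := h.mem_carrier_iff.1 hz
  exact h'.edgeBelow_iff_forall.1 (hle e he) r hr

theorem params_of_le (h : N.IsCrossing s t a b γ W) (h' : N.IsCrossing s' t' a' b' γ' W')
    (hA : W' ∩ N.A ⊆ {a'}) (hB : W' ∩ N.B ⊆ {b'}) (hle : ∀ e ∈ γ, N.EdgeBelow e γ') :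
    s' ≤ s ∧ t ≤ t' := by
  constructor
  · by_contra! hlt
    by_cases haT : N.pos a ∈ N.carrier γ' W'
    · have : a = a' := hA ⟨(pos_mem_carrier_iff h'.path).1 haT, h.left_mem_A⟩
      subst this
      exact hlt.ne (IsCrossing.left_unique h.left h'.left (h.pos_left.symm.trans h'.pos_left))
    · have h1 := (mem_or_isBelow_of_le h h' hle
        (N.pos_mem_carrier h.path.left_mem)).resolve_left haT
      rw [h.pos_left, ← N.curve.c_add_one] at h1 haT
      exact h'.isSlit.not_isBelow_top
        ⟨by linarith [h'.right.2, h.left.1, N.curve.t₃_lt], by linarith⟩ haT h1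
  · by_contra! hlt
    by_cases hbT : N.pos b ∈ N.carrier γ' W'
    · have : b = b' := hB ⟨(pos_mem_carrier_iff h'.path).1 hbT, h.right_mem_B⟩
      subst this
      exact hlt.ne (IsCrossing.right_unique h'.right h.right (h'.pos_right.symm.trans h.pos_right))
    · have h1 := (mem_or_isBelow_of_le h h' hle
        (N.pos_mem_carrier h.path.right_mem)).resolve_left hbT
      rw [h.pos_right] at h1 hbT
      exact h'.isSlit.not_isBelow_top
        ⟨hlt.le, by linarith [h.right.2, h'.left.1, N.curve.t₃_lt]⟩ hbT h1

theorem isBelow_of_le (h : N.IsCrossing s t a b γ W) (h' : N.IsCrossing s' t' a' b' γ' W')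
    (hA : W' ∩ N.A ⊆ {a'}) (hB : W' ∩ N.B ⊆ {b'}) (hle : ∀ e ∈ γ, N.EdgeBelow e γ') {z : ℂ}
    (hz : z ∈ N.curve.closedDomain) (hzT' : z ∉ N.carrier γ' W')
    (hb : N.curve.IsBelow s t (N.carrier γ W) z) :
    N.curve.IsBelow s' t' (N.carrier γ' W') z := by
  by_contra hb'
  obtain ⟨hs, ht⟩ := params_of_le h h' hA hB hle
  obtain ⟨u, hu, hu'⟩ := h'.isSlit.exists_top_of_not_isBelow hz hzT' hb'
  have hdisj : Disjoint (connectedComponentIn (N.curve.closedDomain \ N.carrier γ' W') z)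
      (N.carrier γ W) := by
    rw [disjoint_left]
    intro w hw hwT
    rcases mem_or_isBelow_of_le h h' hle hwT with h1 | h1
    · exact (connectedComponentIn_subset _ _ hw).2 h1
    · exact hb' ((h'.isSlit.isBelow_iff_of_mem_connectedComponentIn hw).2 h1)
  have h1 := (h.isSlit.isBelow_iff_of_isPreconnected isPreconnected_connectedComponentIn
    (fun w hw => (connectedComponentIn_subset _ _ hw).1) hdisj
    (mem_connectedComponentIn ⟨hz, hzT'⟩) hu').1 hb
  exact h.isSlit.not_isBelow_top ⟨by linarith [hu.1], by linarith [hu.2]⟩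
    (disjoint_left.1 hdisj hu') h1

theorem edgeBelow_of_le (h : N.IsCrossing s t a b γ W) (h' : N.IsCrossing s' t' a' b' γ' W')
    (hA : W' ∩ N.A ⊆ {a'}) (hB : W' ∩ N.B ⊆ {b'}) (hle : ∀ e ∈ γ, N.EdgeBelow e γ') {e : E}
    (he : N.EdgeBelow e γ) : N.EdgeBelow e γ' := by
  by_cases heγ : e ∈ γ
  · exact hle e heγ
  rw [h'.edgeBelow_iff]
  by_cases heγ' : e ∈ γ'
  · exact .inl heγ'
  · exact .inr (isBelow_of_le h h' hA hB hle (N.mid_mem e)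
      (N.mid_notMem_carrier heγ') ((h.edgeBelow_iff.1 he).resolve_left heγ))

/-- Where the logarithmic increments along two paths with the same ends differ, the point is
inside of the Jordan curve. -/
theorem mem_of_logIncrement_ne (h : N.IsCrossing s t a b γ W) (h' : N.IsCrossing s t a b γ' W')
    {z : ℂ} (hz : z ∉ N.carrier γ W) (hz' : z ∉ N.carrier γ' W')
    (hne : logIncrement (N.carrier γ W) (N.pos a) (N.pos b) z ≠
      logIncrement (N.carrier γ' W') (N.pos a) (N.pos b) z) :
    z ∈ N.curve.closedDomain ∧ z ∉ range N.curve.c := by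
  have l := isLogContinuum_carrier h.path
  have l' := isLogContinuum_carrier h'.path
  have a₁ := N.pos_mem_carrier (γ := (γ : Set E)) h.path.left_mem
  have b₁ := N.pos_mem_carrier (γ := (γ : Set E)) h.path.right_mem
  have a₂ := N.pos_mem_carrier (γ := (γ' : Set E)) h'.path.left_mem
  have b₂ := N.pos_mem_carrier (γ := (γ' : Set E)) h'.path.right_mem
  constructor
  · by_contra hzD
    exact hne (N.curve.logIncrement_eq_of_notMem l l' (N.carrier_subset_closedDomain _ _)
      (N.carrier_subset_closedDomain _ _) a₁ b₁ a₂ b₂ hzD)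
  · intro hzc
    exact hne (N.curve.logIncrement_eq_of_mem_range l l' (N.carrier_subset_closedDomain _ _)
      (N.carrier_subset_closedDomain _ _) a₁ b₁ a₂ b₂ hzc hz hz')

theorem subset_of_le_of_le (h : N.IsCrossing s t a b γ W) (h' : N.IsCrossing s' t' a' b' γ' W')
    (hA : W ∩ N.A ⊆ {a}) (hB : W ∩ N.B ⊆ {b}) (hA' : W' ∩ N.A ⊆ {a'}) (hB' : W' ∩ N.B ⊆ {b'})
    (hle : ∀ e ∈ γ, N.EdgeBelow e γ') (hle' : ∀ e ∈ γ', N.EdgeBelow e γ) : γ ⊆ γ' := by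
  intro e he
  by_contra he'
  have h1 := params_of_le h h' hA' hB' hle
  have h2 := params_of_le h' h hA hB hle'
  obtain rfl : s = s' := le_antisymm h2.1 h1.1
  obtain rfl : t = t' := le_antisymm h1.2 h2.2
  obtain rfl : a = a' := N.pos_injective (h.pos_left.trans h'.pos_left.symm)
  obtain rfl : b = b' := N.pos_injective (h.pos_right.trans h'.pos_right.symm)
  obtain ⟨z, -, hz, hz', hne⟩ := exists_logIncrement_ne h.path (isLogContinuum_carrier h'.path)
    (N.pos_mem_carrier h'.path.left_mem) (N.pos_mem_carrier h'.path.right_mem)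
    (Finset.mem_coe.2 he) (N.mid_notMem_carrier he') univ_mem
  obtain ⟨hzD, hzc⟩ := mem_of_logIncrement_ne h h' hz hz' hne
  have hiff : N.curve.IsBelow s t (N.carrier γ W) z ↔ N.curve.IsBelow s t (N.carrier γ' W') z :=
    ⟨isBelow_of_le h h' hA' hB' hle hzD hz', isBelow_of_le h' h hA hB hle' hzD hz⟩
  rw [h.pos_left, h.pos_right] at hne
  by_cases hb : N.curve.IsBelow s t (N.carrier γ W) z
  · exact hne (((N.curve.isBelow_iff_eq_top hzc).1 hb).trans
      ((N.curve.isBelow_iff_eq_top hzc).1 (hiff.1 hb)).symm)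
  · exact hne ((h.isSlit.eq_bot_of_not_isBelow hzD hz hzc hb).trans
      (h'.isSlit.eq_bot_of_not_isBelow hzD hz' hzc fun h => hb (hiff.2 h)).symm)

/-- A path that avoids a given crossing stays on one side of it. -/
theorem isBelow_iff_of_disjoint {x y : V} {α : Set E} {X : Set V}
    (h' : N.IsCrossing s' t' a' b' γ' W') (hα : SPath N.Joins x y α X) (hX : Disjoint X W')
    {z w : ℂ} (hz : z ∈ N.carrier α X) (hw : w ∈ N.carrier α X) :
    N.curve.IsBelow s' t' (N.carrier γ' W') z ↔ N.curve.IsBelow s' t' (N.carrier γ' W') w := by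
  refine h'.isSlit.isBelow_iff_of_isPreconnected (isLogContinuum_carrier hα).isPreconnected
    (N.carrier_subset_closedDomain _ _) ?_ hz hw
  rw [disjoint_iff_inter_eq_empty, carrier_inter_carrier hα h'.path, hX.inter_eq, image_empty]
  rw [disjoint_left]
  intro e he
  obtain ⟨u, hu, v, -, hJ⟩ := hα.exists_step he
  exact notMem_edges h'.path hJ (disjoint_left.1 hX hu)

end PlaneNetwork

namespace Network.SPath

variable {V E : Type*} {P : E → V → V → Prop} {x y : V} {γ : Set E} {W : Set V}

theorem eq_left_or_exists (h : SPath P x y γ W) {v : V} (hv : v ∈ W) :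
    v = x ∨ ∃ e u, P e u v := by
  induction h with
  | nil => exact .inl hv
  | cons he _ _ ih =>
    rcases hv with rfl | hv
    · exact .inl rfl
    · rcases ih hv with rfl | h1
      · exact .inr ⟨_, _, he⟩
      · exact .inr h1

theorem eq_right_or_exists (h : SPath P x y γ W) {v : V} (hv : v ∈ W) :
    v = y ∨ ∃ e u, P e v u := by
  induction h with
  | nil => exact .inl hv
  | cons he _ _ ih =>
    rcases hv with rfl | hv
    · exact .inr ⟨_, _, he⟩
    · exact ih hv

end Network.SPath

namespace PlaneNetwork

variable {V E : Type*} (N : PlaneNetwork V E)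

open Network

/-- The edge `e` of `H` joins `u` and `v`, and the potential `h` increases from `u` to `v`. -/
def Up (H : Set E) (h : V → ℝ) (e : E) (u v : V) : Prop :=
  e ∈ H ∧ N.Joins e u v ∧ h u < h v

/-- The edges in `H`, directed by the potential `h`, leave every vertex outside of `B` that they
enter and enter every vertex outside of `A` that they leave. -/
structure IsFlow (H : Set E) (h : V → ℝ) : Prop where
  orient : ∀ e ∈ H, ∃ u v, N.Up H h e u v
  notMem_A : ∀ {e u v}, N.Up H h e u v → v ∉ N.A
  notMem_B : ∀ {e u v}, N.Up H h e u v → u ∉ N.B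
  exists_up : ∀ {e u v}, N.Up H h e u v → v ∉ N.B → ∃ e' w, N.Up H h e' v w
  exists_down : ∀ {e u v}, N.Up H h e u v → u ∉ N.A → ∃ e' w, N.Up H h e' w u

variable {N} {H : Set E} {h : V → ℝ}

theorem Up.lt : ∀ e u v, N.Up H h e u v → h u < h v := fun _ _ _ h => h.2.2

theorem sPath_joins {x y : V} {γ : Set E} {W : Set V} (hγ : SPath (N.Up H h) x y γ W) :
    SPath N.Joins x y γ W := hγ.mono fun _ _ _ _ h => h.2.1

theorem sPath_single {e : E} {u v : V} (he : N.Up H h e u v) :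
    SPath (N.Up H h) u v {e} {u, v} := by
  have := SPath.cons (P := N.Up H h) he he.2.1.ne (SPath.nil v)
  simpa using this

namespace IsFlow

variable (hH : N.IsFlow H h)
include hH

theorem inter_A {a b : V} {γ : Set E} {W : Set V} (hγ : SPath (N.Up H h) a b γ W) :
    W ∩ N.A ⊆ {a} := by
  rintro v ⟨hv, hvA⟩
  rcases hγ.eq_left_or_exists hv with h1 | ⟨e, u, hu⟩
  · exact h1
  · exact absurd hvA (hH.notMem_A hu)

theorem inter_B {a b : V} {γ : Set E} {W : Set V} (hγ : SPath (N.Up H h) a b γ W) :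
    W ∩ N.B ⊆ {b} := by
  rintro v ⟨hv, hvB⟩
  rcases hγ.eq_right_or_exists hv with h1 | ⟨e, u, hu⟩
  · exact h1
  · exact absurd hvB (hH.notMem_B hu)

theorem exists_up_path [Finite V] {S : Set V} (hS : N.B ⊆ S) {e : E} {u v : V}
    (he : N.Up H h e u v) :
    ∃ y ∈ S, ∃ δ X, SPath (N.Up H h) v y δ X ∧ X ∩ S ⊆ {y} := by
  have wf : WellFounded (fun a b : V => h b < h a) := by
    have : IsTrans V (fun a b : V => h b < h a) := ⟨fun _ _ _ h1 h2 => h2.trans h1⟩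
    have : Std.Irrefl (fun a b : V => h b < h a) := ⟨fun _ => lt_irrefl _⟩
    exact Finite.wellFounded_of_trans_of_irrefl _
  induction v using wf.induction generalizing e u with
  | _ v ih =>
    by_cases hv : v ∈ S
    · exact ⟨v, hv, _, _, .nil v, inter_subset_left⟩
    · obtain ⟨e', w, hw⟩ := hH.exists_up he fun hB => hv (hS hB)
      obtain ⟨y, hy, δ, X, hδ, hX⟩ := ih w hw.2.2 hw
      refine ⟨y, hy, _, _, hδ.cons_of_lt Up.lt hw, ?_⟩
      rintro z ⟨rfl | hz, hzS⟩
      · exact absurd hzS hv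
      · exact hX ⟨hz, hzS⟩

theorem exists_down_path [Finite V] {S : Set V} (hS : N.A ⊆ S) {e : E} {u v : V}
    (he : N.Up H h e u v) :
    ∃ x ∈ S, ∃ δ X, SPath (N.Up H h) x u δ X ∧ X ∩ S ⊆ {x} := by
  have wf : WellFounded (fun a b : V => h a < h b) := by
    have : IsTrans V (fun a b : V => h a < h b) := ⟨fun _ _ _ h1 h2 => h1.trans h2⟩
    have : Std.Irrefl (fun a b : V => h a < h b) := ⟨fun _ => lt_irrefl _⟩
    exact Finite.wellFounded_of_trans_of_irrefl _
  induction u using wf.induction generalizing e v with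
  | _ u ih =>
    by_cases hu : u ∈ S
    · exact ⟨u, hu, _, _, .nil u, inter_subset_left⟩
    · obtain ⟨e', w, hw⟩ := hH.exists_down he fun hA => hu (hS hA)
      obtain ⟨x, hx, δ, X, hδ, hX⟩ := ih w hw.2.2 hw
      refine ⟨x, hx, _, _, hδ.append_of_lt Up.lt (sPath_single hw), ?_⟩
      rintro z ⟨hz | rfl | rfl, hzS⟩
      · exact hX ⟨hz, hzS⟩
      · exact hX ⟨hδ.right_mem, hzS⟩
      · exact absurd hzS hu

end IsFlow

variable {s t s' t' : ℝ} {a b a' b' x y : V} {γ γ' : Finset E} {W W' : Set V}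

/-- If a part of a crossing is replaced by a chord above the crossing, then the replaced part is
below the new crossing. -/
theorem isBelow_of_chord (hγ : N.IsCrossing s t a b γ W) (hγ' : N.IsCrossing s t a b γ' W')
    {γ₁ γ₂ γ₃ δ : Set E} {W₁ W₂ W₃ X : Set V} (h₁ : SPath N.Joins a x γ₁ W₁)
    (h₂ : SPath N.Joins x y γ₂ W₂) (h₃ : SPath N.Joins y b γ₃ W₃) (hδ : SPath N.Joins x y δ X)
    (eγ : (γ : Set E) = γ₁ ∪ γ₂ ∪ γ₃) (eγ' : (γ' : Set E) = γ₁ ∪ δ ∪ γ₃)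
    (eW : W = W₁ ∪ W₂ ∪ W₃) (eW' : W' = W₁ ∪ X ∪ W₃)
    (hd : Disjoint δ γ₂) (hX : X ∩ W₂ ⊆ {x, y}) {e e' : E} (he : e ∈ δ) (heγ : e ∉ γ)
    (hab : ¬ N.curve.IsBelow s t (N.carrier γ W) (N.mid e)) (he' : e' ∈ γ₂) (heγ' : e' ∉ γ') :
    N.curve.IsBelow s t (N.carrier γ' W') (N.mid e') := by
  by_contra hab'
  have l := isLogContinuum_carrier hγ.path
  have l' := isLogContinuum_carrier hγ'.path
  have c₁ : N.carrier γ₁ W₁ ⊆ N.carrier γ W := N.carrier_mono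
    (eγ ▸ subset_union_left.trans subset_union_left)
    (eW ▸ subset_union_left.trans subset_union_left)
  have c₂ : N.carrier γ₂ W₂ ⊆ N.carrier γ W := N.carrier_mono
    (eγ ▸ subset_union_right.trans subset_union_left)
    (eW ▸ subset_union_right.trans subset_union_left)
  have c₃ : N.carrier γ₃ W₃ ⊆ N.carrier γ W := N.carrier_mono
    (eγ ▸ subset_union_right) (eW ▸ subset_union_right)
  have c₁' : N.carrier γ₁ W₁ ⊆ N.carrier γ' W' := N.carrier_mono
    (eγ' ▸ subset_union_left.trans subset_union_left)
    (eW' ▸ subset_union_left.trans subset_union_left)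
  have c₂' : N.carrier δ X ⊆ N.carrier γ' W' := N.carrier_mono
    (eγ' ▸ subset_union_right.trans subset_union_left)
    (eW' ▸ subset_union_right.trans subset_union_left)
  have c₃' : N.carrier γ₃ W₃ ⊆ N.carrier γ' W' := N.carrier_mono
    (eγ' ▸ subset_union_right) (eW' ▸ subset_union_right)
  have l₁ := isLogContinuum_carrier h₁
  have l₂ := isLogContinuum_carrier h₂
  have l₃ := isLogContinuum_carrier h₃
  have lδ := isLogContinuum_carrier hδ
  have m₁a := N.pos_mem_carrier (γ := γ₁) h₁.left_mem
  have m₁x := N.pos_mem_carrier (γ := γ₁) h₁.right_mem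
  have m₂x := N.pos_mem_carrier (γ := γ₂) h₂.left_mem
  have m₂y := N.pos_mem_carrier (γ := γ₂) h₂.right_mem
  have m₃y := N.pos_mem_carrier (γ := γ₃) h₃.left_mem
  have m₃b := N.pos_mem_carrier (γ := γ₃) h₃.right_mem
  have mδx := N.pos_mem_carrier (γ := δ) hδ.left_mem
  have mδy := N.pos_mem_carrier (γ := δ) hδ.right_mem
  have hdiff : ∀ z, z ∉ N.carrier γ W → z ∉ N.carrier γ' W' →
      logIncrement (N.carrier δ X) (N.pos x) (N.pos y) z -
        logIncrement (N.carrier γ₂ W₂) (N.pos x) (N.pos y) z =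
      logIncrement (N.carrier γ' W') (N.pos a) (N.pos b) z -
        logIncrement (N.carrier γ W) (N.pos a) (N.pos b) z := by
    intro z hz hz'
    rw [← logIncrement_add l (c₁ m₁a) (c₃ m₃b) (c₁ m₁x) hz,
      ← logIncrement_add l (c₁ m₁x) (c₃ m₃b) (c₃ m₃y) hz,
      ← logIncrement_add l' (c₁' m₁a) (c₃' m₃b) (c₁' m₁x) hz',
      ← logIncrement_add l' (c₁' m₁x) (c₃' m₃b) (c₃' m₃y) hz',
      ← logIncrement_mono l l₁.isPreconnected c₁ m₁a m₁x hz,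
      ← logIncrement_mono l l₂.isPreconnected c₂ m₂x m₂y hz,
      ← logIncrement_mono l l₃.isPreconnected c₃ m₃y m₃b hz,
      ← logIncrement_mono l' l₁.isPreconnected c₁' m₁a m₁x hz',
      ← logIncrement_mono l' lδ.isPreconnected c₂' mδx mδy hz',
      ← logIncrement_mono l' l₃.isPreconnected c₃' m₃y m₃b hz']
    ring
  have heT : N.mid e ∉ N.carrier γ W := N.mid_notMem_carrier heγ
  have heT' : N.mid e' ∉ N.carrier γ' W' := N.mid_notMem_carrier heγ'
  have heδ : e ∈ (γ' : Set E) := by rw [eγ']; exact .inl (.inr he)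
  have heγ₂ : e' ∈ (γ : Set E) := by rw [eγ]; exact .inl (.inr he')
  obtain ⟨q, hq, hqT', hqT, hqne⟩ := exists_logIncrement_ne hγ'.path l
    (N.pos_mem_carrier hγ.path.left_mem) (N.pos_mem_carrier hγ.path.right_mem) heδ heT
    (eventually_nhdsWithin_iff.1 (hγ.isSlit.eventually_isBelow_iff heT))
  obtain ⟨q', hq', hqT₂, hqT₂', hqne'⟩ := exists_logIncrement_ne hγ.path l'
    (N.pos_mem_carrier hγ'.path.left_mem) (N.pos_mem_carrier hγ'.path.right_mem) heγ₂ heT'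
    (eventually_nhdsWithin_iff.1 (hγ'.isSlit.eventually_isBelow_iff heT'))
  obtain ⟨hqD, hqc⟩ := mem_of_logIncrement_ne hγ' hγ hqT' hqT hqne
  obtain ⟨hqD', hqc'⟩ := mem_of_logIncrement_ne hγ hγ' hqT₂ hqT₂' hqne'
  have d := hdiff q hqT hqT'
  have d' := hdiff q' hqT₂ hqT₂'
  rw [hγ.pos_left, hγ.pos_right] at d d' hqne hqne'
  have hb : ¬ N.curve.IsBelow s t (N.carrier γ W) q := fun hb => hab ((hq ⟨hqD, hqT⟩).1 hb)
  have hb' : ¬ N.curve.IsBelow s t (N.carrier γ' W') q' := fun hb =>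
    hab' ((hq' ⟨hqD', hqT₂'⟩).1 hb)
  have e₁ := hγ.isSlit.eq_bot_of_not_isBelow hqD hqT hqc hb
  have e₂ := hγ'.isSlit.eq_bot_of_not_isBelow hqD' hqT₂' hqc' hb'
  have e₃ : logIncrement (N.carrier γ' W') (N.curve.c s) (N.curve.c t) q =
      logIncrement (N.curve.c '' Icc t (s + 1)) (N.curve.c s) (N.curve.c t) q := by
    rw [← N.curve.isBelow_iff_eq_top hqc]
    by_contra hbe
    exact hqne ((hγ'.isSlit.eq_bot_of_not_isBelow hqD hqT' hqc hbe).trans e₁.symm)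
  have e₄ : logIncrement (N.carrier γ W) (N.curve.c s) (N.curve.c t) q' =
      logIncrement (N.curve.c '' Icc t (s + 1)) (N.curve.c s) (N.curve.c t) q' := by
    rw [← N.curve.isBelow_iff_eq_top hqc']
    by_contra hbe
    exact hqne' ((hγ.isSlit.eq_bot_of_not_isBelow hqD' hqT₂ hqc' hbe).trans e₂.symm)
  have hS := hγ.isSlit
  have hU := N.curve.image_union_image s t
  have f₁ := logIncrement_sub_unique hS.isLogContinuum_bot hS.isLogContinuum_top
    (N.curve.image_inter_image hS.lt hS.lt_add_one) (by rwa [hU]) (by rwa [hU])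
    (hS.bot_ne_top hqD hqc) (hS.bot_ne_top hqD' hqc')
  have f₂ := hS.bot_ne_top hqD hqc
  have hint : N.carrier δ X ∩ N.carrier γ₂ W₂ = {N.pos x, N.pos y} := by
    rw [carrier_inter_carrier hδ h₂ hd]
    have : X ∩ W₂ = {x, y} := by
      refine hX.antisymm ?_
      rintro _ (rfl | rfl)
      · exact ⟨hδ.left_mem, h₂.left_mem⟩
      · exact ⟨hδ.right_mem, h₂.right_mem⟩
    rw [this, image_pair]
  rw [e₁, e₃] at d
  rw [e₂, e₄] at d'
  have g := logIncrement_sub_unique lδ l₂ hint (z₁ := q) (z₂ := q')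
    (fun h => h.elim (fun h => hqT' (c₂' h)) fun h => hqT (c₂ h))
    (fun h => h.elim (fun h => hqT₂' (c₂' h)) fun h => hqT₂ (c₂ h)) ?_ ?_
  · rw [d, d', ← f₁] at g
    apply f₂
    linear_combination (-1 / 2 : ℂ) * g
  · rw [← sub_ne_zero, d, sub_ne_zero]
    exact f₂.symm
  · rw [← sub_ne_zero, d', sub_ne_zero]
    exact hS.bot_ne_top hqD' hqc'

theorem isBelow_pos_iff_mid (hγ : N.IsCrossing s t a b γ W) {e : E} {u v : V}
    (hJ : N.Joins e u v) (hu : u ∉ W) :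
    N.curve.IsBelow s t (N.carrier γ W) (N.pos u) ↔
      N.curve.IsBelow s t (N.carrier γ W) (N.mid e) := by
  have heγ := notMem_edges hγ.path hJ hu
  have huT : N.pos u ∉ N.carrier γ W := fun h => hu ((pos_mem_carrier_iff hγ.path).1 h)
  rcases hJ with ⟨rfl, -⟩ | ⟨-, rfl⟩
  · rw [← N.pt_zero] at huT ⊢
    exact hγ.isBelow_pt_iff heγ ⟨le_rfl, zero_le_one⟩ huT
  · rw [← N.pt_one] at huT ⊢
    exact hγ.isBelow_pt_iff heγ ⟨zero_le_one, le_rfl⟩ huT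

end PlaneNetwork

namespace PlaneNetwork

variable {V E : Type*} {N : PlaneNetwork V E}

open Network

variable {H : Set E} {h : V → ℝ}

theorem exists_isCrossing_of_up {a b : V} {γ : Set E} {W : Set V} (ha : a ∈ N.A) (hb : b ∈ N.B)
    (hγ : SPath (N.Up H h) a b γ W) :
    ∃ (s t : ℝ) (γ' : Finset E), (γ' : Set E) = γ ∧ N.IsCrossing s t a b γ' W := by
  obtain ⟨s, t, hst⟩ := N.exists_isCrossing ha hb (sPath_joins hγ)
  exact ⟨s, t, hγ.finite_edges.toFinset, hγ.finite_edges.coe_toFinset, by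
    rwa [hγ.finite_edges.coe_toFinset]⟩

/-- A monotone crossing with an edge above it can be replaced by a higher monotone crossing which
contains this edge. -/
theorem IsFlow.exists_higher [Finite V] (hH : N.IsFlow H h) {s t : ℝ} {a b : V} {γ : Finset E}
    {W : Set V} (hγ : N.IsCrossing s t a b γ W) (hUp : SPath (N.Up H h) a b γ W) {e : E}
    (he : e ∈ H) (hb : ¬ N.EdgeBelow e γ) :
    ∃ (s' t' : ℝ) (a' b' : V) (γ' : Finset E) (W' : Set V), N.IsCrossing s' t' a' b' γ' W' ∧
      SPath (N.Up H h) a' b' γ' W' ∧ (∀ e' ∈ γ, N.EdgeBelow e' γ') ∧ e ∈ γ' := by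
  have hlt := Up.lt (N := N) (H := H) (h := h)
  rw [hγ.edgeBelow_iff, not_or] at hb
  obtain ⟨heγ, hmid⟩ := hb
  obtain ⟨u, v, huv⟩ := hH.orient e he
  obtain ⟨x, hx, δ₁, X₁, hδ₁, hX₁⟩ := hH.exists_down_path (S := W ∪ N.A) subset_union_right huv
  obtain ⟨y, hy, δ₂, X₂, hδ₂, hX₂⟩ := hH.exists_up_path (S := W ∪ N.B) subset_union_right huv
  have hX₁W : X₁ ∩ W ⊆ {x} := fun z hz => hX₁ ⟨hz.1, .inl hz.2⟩
  have hX₂W : X₂ ∩ W ⊆ {y} := fun z hz => hX₂ ⟨hz.1, .inl hz.2⟩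
  have hδ := (hδ₁.append_of_lt hlt (sPath_single huv)).append_of_lt hlt hδ₂
  set δ := δ₁ ∪ {e} ∪ δ₂ with hδdef
  set X := X₁ ∪ {u, v} ∪ X₂ with hXdef
  have heδ : e ∈ δ := .inl (.inr rfl)
  have hXW : X ∩ W ⊆ {x, y} := by
    rintro z ⟨(hz | rfl | rfl) | hz, hzW⟩
    · exact .inl (hX₁W ⟨hz, hzW⟩)
    · exact .inl (hX₁W ⟨hδ₁.right_mem, hzW⟩)
    · exact .inr (hX₂W ⟨hδ₂.left_mem, hzW⟩)
    · exact .inr (hX₂W ⟨hz, hzW⟩)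
  have hδγ : ∀ e' ∈ δ, e' ∉ γ := by
    have key : ∀ {p q z : V} {α : Set E} {Y : Set V}, SPath (N.Up H h) p q α Y → Y ∩ W ⊆ {z} →
        ∀ e' ∈ α, e' ∉ γ := by
      intro p q z α Y hα hY e' he' heγ'
      obtain ⟨p', hp', q', hq', hJ⟩ := hα.exists_step he'
      have h1 : p' ∈ W := by
        by_contra h1
        exact notMem_edges hγ.path hJ.2.1 h1 (Finset.mem_coe.2 heγ')
      have h2 : q' ∈ W := by
        by_contra h2
        exact notMem_edges hγ.path hJ.2.1.symm h2 (Finset.mem_coe.2 heγ')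
      exact hJ.2.1.ne ((hY ⟨hp', h1⟩).trans (hY ⟨hq', h2⟩).symm)
    rintro e' ((he' | rfl) | he')
    · exact key hδ₁ hX₁W e' he'
    · exact heγ
    · exact key hδ₂ hX₂W e' he'
  have hxy : h x < h y := by
    have h1 := huv.2.2
    rcases hδ₁.lt_of_mem_right hlt hδ₁.right_mem with h2 | h2 <;>
      rcases hδ₂.lt_of_mem_left hlt hδ₂.left_mem with h3 | h3
    · rwa [← h2, ← h3]
    · rw [← h2]; linarith
    · rw [← h3]; linarith
    · linarith
  obtain ⟨a', γ₁, W₁, a₀, γr, Wr, h₁, hr, eγ, ha', hW₁r, hcase⟩ :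
      ∃ a' γ₁ W₁ a₀ γr Wr, SPath (N.Up H h) a' x γ₁ W₁ ∧ SPath (N.Up H h) a₀ b γr Wr ∧
        (γ : Set E) = γ₁ ∪ γr ∧ a' ∈ N.A ∧ W₁ ∩ Wr ⊆ {x} ∧
        ((x ∈ W ∧ a₀ = x ∧ a' = a ∧ W = W₁ ∪ Wr) ∨ (x ∉ W ∧ a₀ = a ∧ a' = x ∧ Wr = W)) := by
    by_cases hxW : x ∈ W
    · obtain ⟨γ₁, W₁, γr, Wr, h₁, hr, hI, eγ, eW⟩ := hUp.split hxW
      exact ⟨a, γ₁, W₁, x, γr, Wr, h₁, hr, eγ, hγ.left_mem_A, hI, .inl ⟨hxW, rfl, rfl, eW⟩⟩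
    · exact ⟨x, ∅, {x}, a, γ, W, .nil x, hUp, (empty_union _).symm, hx.resolve_left hxW,
        inter_subset_left, .inr ⟨hxW, rfl, rfl, rfl⟩⟩
  have hWrW : Wr ⊆ W := by
    rcases hcase with ⟨-, -, -, eW⟩ | ⟨-, -, -, rfl⟩
    · exact eW ▸ subset_union_right
    · exact subset_rfl
  have hyWr : y ∈ W → y ∈ Wr := by
    intro hyW
    rcases hcase with ⟨-, -, -, eW⟩ | ⟨-, -, -, rfl⟩
    · rw [eW] at hyW
      refine hyW.resolve_left fun hy₁ => ?_
      rcases h₁.lt_of_mem_left hlt hy₁ with h4 | h4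
      · exact hxy.ne (h4 ▸ rfl)
      · exact hxy.not_gt h4
    · exact hyW
  obtain ⟨b', γ₂, W₂, γ₃, W₃, b₀, h₂, h₃, eγr, hb', hW₂₃, hcase'⟩ :
      ∃ b' γ₂ W₂ γ₃ W₃ b₀, SPath (N.Up H h) a₀ b₀ γ₂ W₂ ∧ SPath (N.Up H h) y b' γ₃ W₃ ∧
        γr = γ₂ ∪ γ₃ ∧ b' ∈ N.B ∧ W₂ ∩ W₃ ⊆ {y} ∧
        ((y ∈ W ∧ b₀ = y ∧ b' = b ∧ Wr = W₂ ∪ W₃) ∨ (y ∉ W ∧ b₀ = b ∧ b' = y ∧ W₂ = Wr)) := by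
    by_cases hyW : y ∈ W
    · obtain ⟨γ₂, W₂, γ₃, W₃, h₂, h₃, hI, eγ, eW⟩ := hr.split (hyWr hyW)
      exact ⟨b, γ₂, W₂, γ₃, W₃, y, h₂, h₃, eγ, hγ.right_mem_B, hI, .inl ⟨hyW, rfl, rfl, eW⟩⟩
    · exact ⟨y, γr, Wr, ∅, {y}, b, hr, .nil y, (union_empty _).symm, hy.resolve_left hyW,
        inter_subset_right, .inr ⟨hyW, rfl, rfl, rfl⟩⟩
  have hW₂r : W₂ ⊆ Wr := by
    rcases hcase' with ⟨-, -, -, eW⟩ | ⟨-, -, -, rfl⟩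
    · exact eW ▸ subset_union_left
    · exact subset_rfl
  have hW₂W : W₂ ⊆ W := hW₂r.trans hWrW
  have hUp' := (h₁.append_of_lt hlt hδ).append_of_lt hlt h₃
  obtain ⟨s', t', γ', eγ', hγ'⟩ := exists_isCrossing_of_up ha' hb' hUp'
  set W' := W₁ ∪ X ∪ W₃ with hW'
  have hF : W₂ ∩ W' ⊆ {x, y} := by
    rintro z ⟨hz, (hz' | hz') | hz'⟩
    · exact .inl (hW₁r ⟨hz', hW₂r hz⟩)
    · exact hXW ⟨hz', hW₂W hz⟩
    · exact .inr (hW₂₃ ⟨hz, hz'⟩)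
  refine ⟨s', t', a', b', γ', W', hγ', by rwa [eγ'], ?_, ?_⟩
  swap
  · rw [← Finset.mem_coe, eγ']
    exact .inl (.inr heδ)
  intro e' he'
  rw [hγ'.edgeBelow_iff]
  by_cases heγ' : e' ∈ γ'
  · exact .inl heγ'
  refine .inr ?_
  have he₂ : e' ∈ γ₂ := by
    have h1 : e' ∈ (γ : Set E) := he'
    have h2 : e' ∉ (γ' : Set E) := heγ'
    rw [eγ, eγr] at h1
    rw [eγ'] at h2
    rcases h1 with h1 | h1 | h1
    · exact absurd (.inl (.inl h1)) h2
    · exact h1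
    · exact absurd (.inr h1) h2
  obtain ⟨p, q, α, Wα, β, Wβ, hα, hJ, hβ, hdαβ, eγ₂, eW₂⟩ := h₂.split_edge he₂
  have hαW : Wα ⊆ W₂ := eW₂ ▸ subset_union_left
  have hβW : Wβ ⊆ W₂ := eW₂ ▸ subset_union_right
  by_cases hxW : x ∈ W
  swap
  · obtain ⟨-, rfl, rfl, -⟩ := hcase.resolve_left fun h => hxW h.1
    have hd : Disjoint X₁ W := disjoint_left.2 fun z hz hzW => hxW (hX₁W ⟨hz, hzW⟩ ▸ hzW)
    have hnx : ¬ N.curve.IsBelow s t (N.carrier γ W) (N.pos a') := by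
      rw [isBelow_iff_of_disjoint hγ (sPath_joins hδ₁) hd (N.pos_mem_carrier hδ₁.left_mem)
        (N.pos_mem_carrier hδ₁.right_mem),
        isBelow_pos_iff_mid hγ huv.2.1 (disjoint_left.1 hd hδ₁.right_mem)]
      exact hmid
    have hs : s' < s := by
      by_contra! hle
      rw [hγ'.pos_left] at hnx
      exact hnx (N.curve.isBelow_bot
        ⟨hle, by linarith [hγ'.left.2, hγ.right.1, N.curve.t₁_lt_t₂]⟩)
    have hdα : Disjoint Wα W' := by
      rw [disjoint_left]
      intro z hz hz'
      rcases hF ⟨hαW hz, hz'⟩ with rfl | h4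
      · exact hxW (hW₂W (hαW hz))
      · rw [mem_singleton_iff] at h4
        subst h4
        obtain ⟨-, rfl, -, -⟩ := hcase'.resolve_right fun h => h.1 (hW₂W (hαW hz))
        exact disjoint_left.1 hdαβ hz hβ.right_mem
    rw [← isBelow_pos_iff_mid hγ' hJ.2.1 (disjoint_left.1 hdα hα.right_mem),
      ← isBelow_iff_of_disjoint hγ' (sPath_joins hα) hdα (N.pos_mem_carrier hα.left_mem)
        (N.pos_mem_carrier hα.right_mem), hγ.pos_left]
    exact N.curve.isBelow_bot
      ⟨hs.le, by linarith [hγ.left.2, hγ'.right.1, N.curve.t₁_lt_t₂]⟩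
  by_cases hyW : y ∈ W
  swap
  · obtain ⟨-, rfl, rfl, -⟩ := hcase'.resolve_left fun h => hyW h.1
    have hd : Disjoint X₂ W := disjoint_left.2 fun z hz hzW => hyW (hX₂W ⟨hz, hzW⟩ ▸ hzW)
    have hny : ¬ N.curve.IsBelow s t (N.carrier γ W) (N.pos b') := by
      rw [isBelow_iff_of_disjoint hγ (sPath_joins hδ₂) hd (N.pos_mem_carrier hδ₂.right_mem)
        (N.pos_mem_carrier hδ₂.left_mem),
        isBelow_pos_iff_mid hγ huv.2.1.symm (disjoint_left.1 hd hδ₂.left_mem)]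
      exact hmid
    have ht : t < t' := by
      by_contra! hle
      rw [hγ'.pos_right] at hny
      exact hny (N.curve.isBelow_bot
        ⟨by linarith [hγ.left.2, hγ'.right.1, N.curve.t₁_lt_t₂], hle⟩)
    have hdβ : Disjoint Wβ W' := by
      rw [disjoint_left]
      intro z hz hz'
      rcases hF ⟨hβW hz, hz'⟩ with rfl | h4
      · obtain ⟨-, rfl, -, -⟩ := hcase.resolve_right fun h => h.1 hxW
        exact disjoint_left.1 hdαβ hα.left_mem hz
      · rw [mem_singleton_iff] at h4
        subst h4
        exact hyW (hW₂W (hβW hz))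
    rw [← isBelow_pos_iff_mid hγ' hJ.2.1.symm (disjoint_left.1 hdβ hβ.left_mem),
      ← isBelow_iff_of_disjoint hγ' (sPath_joins hβ) hdβ (N.pos_mem_carrier hβ.right_mem)
        (N.pos_mem_carrier hβ.left_mem), hγ.pos_right]
    exact N.curve.isBelow_bot
      ⟨by linarith [hγ'.left.2, hγ.right.1, N.curve.t₁_lt_t₂], ht.le⟩
  obtain ⟨-, rfl, rfl, eW⟩ := hcase.resolve_right fun h => h.1 hxW
  obtain ⟨-, rfl, rfl, eWr⟩ := hcase'.resolve_right fun h => h.1 hyW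
  obtain rfl : s = s' :=
    IsCrossing.left_unique hγ.left hγ'.left (hγ.pos_left.symm.trans hγ'.pos_left)
  obtain rfl : t = t' :=
    IsCrossing.right_unique hγ.right hγ'.right (hγ.pos_right.symm.trans hγ'.pos_right)
  refine isBelow_of_chord hγ hγ' (sPath_joins h₁) (sPath_joins h₂) (sPath_joins h₃)
    (sPath_joins hδ) (by rw [eγ, eγr, union_assoc]) eγ' (by rw [eW, eWr, union_assoc]) hW' ?_
    (fun z hz => hXW ⟨hz.1, hW₂W hz.2⟩) heδ heγ hmid he₂ heγ'
  rw [disjoint_left]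
  intro e'' h1 h2
  refine hδγ e'' h1 (Finset.mem_coe.1 ?_)
  rw [eγ, eγr]
  exact .inr (.inl h2)

/-- The graph of a nonzero flow has a top path, which is monotone. -/
theorem IsFlow.exists_top [Finite V] [Finite E] (hH : N.IsFlow H h) (hne : H.Nonempty) :
    ∃ (s t : ℝ) (a b : V) (γ : Finset E) (W : Set V), N.IsCrossing s t a b γ W ∧
      SPath (N.Up H h) a b γ W ∧ ∀ e ∈ H, N.EdgeBelow e γ := by
  classical
  have hlt := Up.lt (N := N) (H := H) (h := h)
  set 𝒮 : Set (Finset E) := {γ | ∃ s t a b W, N.IsCrossing s t a b γ W ∧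
    SPath (N.Up H h) a b γ W} with h𝒮
  have hfin : 𝒮.Finite := toFinite _
  have h𝒮ne : 𝒮.Nonempty := by
    obtain ⟨e, he⟩ := hne
    obtain ⟨u, v, huv⟩ := hH.orient e he
    obtain ⟨a, ha, δ₁, X₁, hδ₁, -⟩ := hH.exists_down_path subset_rfl huv
    obtain ⟨b, hb, δ₂, X₂, hδ₂, -⟩ := hH.exists_up_path subset_rfl huv
    have hδ := (hδ₁.append_of_lt hlt (sPath_single huv)).append_of_lt hlt hδ₂
    obtain ⟨s, t, γ, eγ, hγ⟩ := exists_isCrossing_of_up ha hb hδ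
    exact ⟨γ, s, t, a, b, _, hγ, by rwa [eγ]⟩
  obtain ⟨γ, ⟨s, t, a, b, W, hγ, hUp⟩, hmax⟩ :=
    exists_max_image 𝒮 (fun γ => {e ∈ H | N.EdgeBelow e γ}.ncard) hfin h𝒮ne
  refine ⟨s, t, a, b, γ, W, hγ, hUp, fun e he => ?_⟩
  by_contra hb
  obtain ⟨s', t', a', b', γ', W', hγ', hUp', hle, heγ'⟩ := hH.exists_higher hγ hUp he hb
  refine (hmax γ' ⟨s', t', a', b', W', hγ', hUp'⟩).not_gt (ncard_lt_ncard ?_ (toFinite _))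
  refine ⟨fun e' he' => ⟨he'.1, edgeBelow_of_le hγ hγ' (hH.inter_A hUp') (hH.inter_B hUp') hle
    he'.2⟩, fun hsub => hb (hsub ⟨he, hγ'.edgeBelow_iff.2 (.inl heγ')⟩).2⟩

end PlaneNetwork

namespace PlaneNetwork

variable {V E : Type*} {N : PlaneNetwork V E}

open Network

theorem IsTopPath.exists_isCrossing {H : Set E} {γ : Finset E} (hγ : N.IsTopPath H γ) :
    ∃ s t a b W, N.IsCrossing s t a b γ W ∧ W ∩ N.A ⊆ {a} ∧ W ∩ N.B ⊆ {b} := by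
  obtain ⟨-, hab, hA, hB, -⟩ := hγ
  obtain ⟨a, ha, b, hb, W, hW⟩ := N.mem_abPaths_iff.1 hab
  obtain ⟨s, t, hc⟩ := N.exists_isCrossing ha hb hW
  refine ⟨s, t, a, b, W, hc, ?_, ?_⟩
  · rintro v ⟨hv, hvA⟩
    exact hA ⟨hvA, (N.meets_iff hW hc.ne).2 hv⟩ ⟨ha, (N.meets_iff hW hc.ne).2 hW.left_mem⟩
  · rintro v ⟨hv, hvB⟩
    exact hB ⟨hvB, (N.meets_iff hW hc.ne).2 hv⟩ ⟨hb, (N.meets_iff hW hc.ne).2 hW.right_mem⟩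

theorem IsTopPath.unique {H : Set E} {γ γ' : Finset E} (hγ : N.IsTopPath H γ)
    (hγ' : N.IsTopPath H γ') : γ = γ' := by
  obtain ⟨s, t, a, b, W, hc, hA, hB⟩ := hγ.exists_isCrossing
  obtain ⟨s', t', a', b', W', hc', hA', hB'⟩ := hγ'.exists_isCrossing
  have h₁ : ∀ e ∈ γ, N.EdgeBelow e γ' := fun e he => hγ'.2.2.2.2 e (hγ.1 he)
  have h₂ : ∀ e ∈ γ', N.EdgeBelow e γ := fun e he => hγ.2.2.2.2 e (hγ'.1 he)
  exact (subset_of_le_of_le hc hc' hA hB hA' hB' h₁ h₂).antisymm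
    (subset_of_le_of_le hc' hc hA' hB' hA hB h₂ h₁)

/-- `γ` is a path from `A` to `B` in `H` along which `h` increases. -/
def IsUpCrossing (N : PlaneNetwork V E) (H : Set E) (h : V → ℝ) (γ : Finset E) : Prop :=
  ∃ a ∈ N.A, ∃ b ∈ N.B, ∃ W, SPath (N.Up H h) a b γ W

variable {H : Set E} {h : V → ℝ}

theorem IsUpCrossing.subset {γ : Finset E} (hγ : N.IsUpCrossing H h γ) : (γ : Set E) ⊆ H := by
  obtain ⟨a, -, b, -, W, hW⟩ := hγ
  intro e he
  obtain ⟨u, -, v, -, huv⟩ := hW.exists_step he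
  exact huv.1

theorem IsUpCrossing.mono {H' : Set E} {γ : Finset E} (hγ : N.IsUpCrossing H h γ)
    (hH' : (γ : Set E) ⊆ H') : N.IsUpCrossing H' h γ := by
  obtain ⟨a, ha, b, hb, W, hW⟩ := hγ
  exact ⟨a, ha, b, hb, W, hW.mono fun e he u v huv => ⟨hH' he, huv.2⟩⟩

theorem IsUpCrossing.mem_abPaths {γ : Finset E} (hγ : N.IsUpCrossing H h γ) : γ ∈ N.abPaths := by
  obtain ⟨a, ha, b, hb, W, hW⟩ := hγ
  exact N.mem_abPaths_iff.2 ⟨a, ha, b, hb, W, sPath_joins hW⟩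

theorem nonempty_of_mem_abPaths {γ : Finset E} (hγ : γ ∈ N.abPaths) : γ.Nonempty := by
  obtain ⟨a, ha, b, hb, W, hW⟩ := N.mem_abPaths_iff.1 hγ
  obtain ⟨e, he, -⟩ := hW.exists_edge hW.left_mem (N.disjoint_A_B.ne_of_mem ha hb)
  exact ⟨e, he⟩

namespace IsFlow

variable (hH : N.IsFlow H h)
include hH

theorem exists_isCrossing {γ : Finset E} (hγ : N.IsUpCrossing H h γ) :
    ∃ s t a b W, N.IsCrossing s t a b γ W ∧ W ∩ N.A ⊆ {a} ∧ W ∩ N.B ⊆ {b} := by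
  obtain ⟨a, ha, b, hb, W, hW⟩ := hγ
  obtain ⟨s, t, hc⟩ := N.exists_isCrossing ha hb (sPath_joins hW)
  exact ⟨s, t, a, b, W, hc, hH.inter_A hW, hH.inter_B hW⟩

theorem isTopPath {γ : Finset E} (hγ : N.IsUpCrossing H h γ) (hle : ∀ e ∈ H, N.EdgeBelow e γ) :
    N.IsTopPath H γ := by
  obtain ⟨s, t, a, b, W, hc, hA, hB⟩ := hH.exists_isCrossing hγ
  refine ⟨hγ.subset, hγ.mem_abPaths, ?_, ?_, hle⟩
  · rintro v ⟨hvA, hv⟩ w ⟨hwA, hw⟩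
    rw [N.meets_iff hc.path hc.ne] at hv hw
    exact (hA ⟨hv, hvA⟩).trans (hA ⟨hw, hwA⟩).symm
  · rintro v ⟨hvB, hv⟩ w ⟨hwB, hw⟩
    rw [N.meets_iff hc.path hc.ne] at hv hw
    exact (hB ⟨hv, hvB⟩).trans (hB ⟨hw, hwB⟩).symm

theorem exists_isTopPath [Finite V] [Finite E] (hne : H.Nonempty) :
    ∃ γ, N.IsTopPath H γ ∧ N.IsUpCrossing H h γ := by
  obtain ⟨s, t, a, b, γ, W, hc, hUp, hle⟩ := hH.exists_top hne
  have hγ : N.IsUpCrossing H h γ := ⟨a, hc.left_mem_A, b, hc.right_mem_B, W, hUp⟩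
  exact ⟨γ, hH.isTopPath hγ hle, hγ⟩

theorem isUpCrossing_of_isTopPath [Finite V] [Finite E] {γ : Finset E}
    (hγ : N.IsTopPath H γ) : N.IsUpCrossing H h γ := by
  obtain ⟨e, he⟩ := nonempty_of_mem_abPaths hγ.2.1
  obtain ⟨γ', hγ', hUp⟩ := hH.exists_isTopPath ⟨e, hγ.1 he⟩
  rwa [hγ.unique hγ']

theorem edgeBelow_self {γ : Finset E} (hγ : N.IsUpCrossing H h γ) {e : E} (he : e ∈ γ) :
    N.EdgeBelow e γ := by
  obtain ⟨s, t, a, b, W, hc, -⟩ := hH.exists_isCrossing hγ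
  exact hc.edgeBelow_iff.2 (.inl he)

theorem edgeBelow_trans {γ γ' : Finset E} (hγ : N.IsUpCrossing H h γ)
    (hγ' : N.IsUpCrossing H h γ') (hle : ∀ e ∈ γ, N.EdgeBelow e γ') {e : E}
    (he : N.EdgeBelow e γ) : N.EdgeBelow e γ' := by
  obtain ⟨s, t, a, b, W, hc, -⟩ := hH.exists_isCrossing hγ
  obtain ⟨s', t', a', b', W', hc', hA, hB⟩ := hH.exists_isCrossing hγ'
  exact edgeBelow_of_le hc hc' hA hB hle he

theorem eq_of_le_of_le {γ γ' : Finset E} (hγ : N.IsUpCrossing H h γ)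
    (hγ' : N.IsUpCrossing H h γ') (hle : ∀ e ∈ γ, N.EdgeBelow e γ')
    (hle' : ∀ e ∈ γ', N.EdgeBelow e γ) : γ = γ' := by
  obtain ⟨s, t, a, b, W, hc, hA, hB⟩ := hH.exists_isCrossing hγ
  obtain ⟨s', t', a', b', W', hc', hA', hB'⟩ := hH.exists_isCrossing hγ'
  exact (subset_of_le_of_le hc hc' hA hB hA' hB' hle hle').antisymm
    (subset_of_le_of_le hc' hc hA' hB' hA hB hle' hle)

/-- A finite non-crossing family of monotone crossings has a highest member. -/
theorem exists_highest {S : Finset (Finset E)} (hne : S.Nonempty)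
    (hS : ∀ γ ∈ S, N.IsUpCrossing H h γ) (hnc : (S : Set (Finset E)).Pairwise N.NonCrossing) :
    ∃ γ ∈ S, ∀ γ' ∈ S, ∀ e ∈ γ', N.EdgeBelow e γ := by
  induction hne using Finset.Nonempty.cons_induction with
  | singleton γ =>
    refine ⟨γ, Finset.mem_singleton_self _, fun γ' hγ' e he => ?_⟩
    rw [Finset.mem_singleton] at hγ'
    subst hγ'
    exact hH.edgeBelow_self (hS γ' (Finset.mem_singleton_self _)) he
  | cons γ₀ S hγ₀ _ ih =>
    simp only [Finset.mem_cons, forall_eq_or_imp] at hS ⊢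
    rw [Finset.coe_cons] at hnc
    obtain ⟨γ, hγ, hmax⟩ := ih hS.2 (hnc.mono (subset_insert _ _))
    have hne : γ₀ ≠ γ := fun h => hγ₀ (h ▸ hγ)
    rcases hnc (mem_insert _ _) (mem_insert_of_mem _ hγ) hne with hle | hle
    · refine ⟨γ₀, .inl rfl, fun e he => hH.edgeBelow_self hS.1 he, fun γ' hγ' e he => ?_⟩
      exact hH.edgeBelow_trans (hS.2 γ hγ) hS.1 hle (hmax γ' hγ' e he)
    · exact ⟨γ, .inr hγ, hle, hmax⟩

end IsFlow

/-- The increment of `φ` along the edge `e`, directed by the potential `h`. -/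
noncomputable def increment (N : PlaneNetwork V E) (h φ : V → ℝ) (e : E) : ℝ :=
  open Classical in
  if h (N.fst e) < h (N.snd e) then φ (N.snd e) - φ (N.fst e) else φ (N.fst e) - φ (N.snd e)

theorem increment_eq {φ : V → ℝ} {e : E} {u v : V} (hJ : N.Joins e u v) (hlt : h u < h v) :
    N.increment h φ e = φ v - φ u := by
  rcases hJ with ⟨rfl, rfl⟩ | ⟨rfl, rfl⟩
  · simp [increment, hlt]
  · simp [increment, hlt.not_gt]

theorem _root_.Network.usage_of_mem {γ : Finset E} {e : E} (he : e ∈ γ) : usage γ e = 1 :=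
  indicator_of_mem (Finset.mem_coe.2 he) _

theorem _root_.Network.usage_of_notMem {γ : Finset E} {e : E} (he : e ∉ γ) : usage γ e = 0 :=
  indicator_of_notMem (fun h => he (Finset.mem_coe.1 h)) _

theorem _root_.Network.usage_nonneg (γ : Finset E) (e : E) : 0 ≤ usage γ e :=
  indicator_nonneg (fun _ _ => zero_le_one) _

variable [Fintype E]

theorem sum_usage_mul {P : E → V → V → Prop} {a b : V} {γ : Finset E} {W : Set V}
    (hP : ∀ e u v, P e u v → N.Joins e u v) {f : E → ℝ} {φ : V → ℝ}
    (hf : ∀ e u v, P e u v → f e = φ v - φ u) (hγ : SPath P a b (γ : Set E) W) :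
    ∑ e, usage γ e * f e = φ b - φ a := by
  rw [← hγ.finsum_eq N.toNetwork hP hf, finsum_mem_def, finsum_eq_sum_of_fintype]
  refine Finset.sum_congr rfl fun e _ => ?_
  by_cases he : e ∈ (γ : Set E)
  · simp only [usage, indicator_of_mem he, one_mul]
  · simp only [usage, indicator_of_notMem he, zero_mul]

/-- The weights `r`, directed by the potential `h`, form a flow from `A` to `B`. -/
structure IsBalanced (N : PlaneNetwork V E) (h : V → ℝ) (r : E → ℝ) : Prop where
  nonneg : ∀ e, 0 ≤ r e
  min_A : ∀ v ∈ N.A, ∀ u, h v ≤ h u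
  max_B : ∀ v ∈ N.B, ∀ u, h u ≤ h v
  orient : ∀ e, r e ≠ 0 → h (N.fst e) ≠ h (N.snd e)
  conserve : ∀ φ : V → ℝ, (∀ v ∈ N.A, φ v = 0) → (∀ v ∈ N.B, φ v = 0) →
    ∑ e, r e * N.increment h φ e = 0

theorem sum_usage_mul_increment {γ : Finset E} (hγ : N.IsUpCrossing H h γ) {φ : V → ℝ}
    (hA : ∀ v ∈ N.A, φ v = 0) (hB : ∀ v ∈ N.B, φ v = 0) :
    ∑ e, usage γ e * N.increment h φ e = 0 := by
  obtain ⟨a, ha, b, hb, W, hW⟩ := hγ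
  rw [sum_usage_mul (fun _ _ _ h => h.2.1) (fun e u v h => increment_eq h.2.1 h.2.2) hW,
    hA a ha, hB b hb, sub_zero]

namespace IsBalanced

variable {r : E → ℝ} (hr : N.IsBalanced h r)
include hr

theorem orient' {e : E} (he : r e ≠ 0) : ∃ u v, N.Up {e | r e ≠ 0} h e u v := by
  rcases (hr.orient e he).lt_or_gt with h1 | h1
  · exact ⟨_, _, he, .inl ⟨rfl, rfl⟩, h1⟩
  · exact ⟨_, _, he, .inr ⟨rfl, rfl⟩, h1⟩

theorem isFlow : N.IsFlow {e | r e ≠ 0} h := by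
  classical
  have nA : ∀ {e u v}, N.Up {e | r e ≠ 0} h e u v → v ∉ N.A := fun huv hv =>
    (hr.min_A _ hv _).not_gt huv.2.2
  have nB : ∀ {e u v}, N.Up {e | r e ≠ 0} h e u v → u ∉ N.B := fun huv hu =>
    (hr.max_B _ hu _).not_gt huv.2.2
  have hne : ∀ {x y : V} {S : Set V}, x ∉ S → y ∈ S → y ≠ x := fun hx hy hyx => hx (hyx ▸ hy)
  refine ⟨fun e he => hr.orient' he, nA, nB, ?_, ?_⟩
  · intro e u v huv hvB
    by_contra! hcon
    have h0 := hr.conserve (Pi.single v 1)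
      (fun w hw => Pi.single_eq_of_ne (hne (nA huv) hw) _)
      (fun w hw => Pi.single_eq_of_ne (hne hvB hw) _)
    have hterm : ∀ e', 0 ≤ r e' * N.increment h (Pi.single v 1) e' := by
      intro e'
      by_cases he' : r e' = 0
      · rw [he', zero_mul]
      · obtain ⟨u', v', huv'⟩ := hr.orient' he'
        refine mul_nonneg (hr.nonneg e') ?_
        rw [increment_eq huv'.2.1 huv'.2.2]
        have h1 : u' ≠ v := by rintro rfl; exact hcon e' v' huv'
        rw [Pi.single_eq_of_ne h1, sub_zero]
        exact (Pi.single_nonneg.2 zero_le_one : (0 : V → ℝ) ≤ Pi.single v 1) v'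
    have h1 := (Finset.sum_eq_zero_iff_of_nonneg fun e' _ => hterm e').1 h0 e (Finset.mem_univ _)
    rw [increment_eq huv.2.1 huv.2.2, Pi.single_eq_same, Pi.single_eq_of_ne huv.2.1.ne, sub_zero,
      mul_one] at h1
    exact huv.1 h1
  · intro e u v huv huA
    by_contra! hcon
    have h0 := hr.conserve (-Pi.single u 1)
      (fun w hw => by
        rw [Pi.neg_apply, Pi.single_eq_of_ne (hne huA hw), neg_zero])
      (fun w hw => by
        rw [Pi.neg_apply, Pi.single_eq_of_ne (hne (nB huv) hw), neg_zero])
    have hterm : ∀ e', 0 ≤ r e' * N.increment h (-Pi.single u 1) e' := by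
      intro e'
      by_cases he' : r e' = 0
      · rw [he', zero_mul]
      · obtain ⟨u', v', huv'⟩ := hr.orient' he'
        refine mul_nonneg (hr.nonneg e') ?_
        rw [increment_eq huv'.2.1 huv'.2.2]
        have h1 : v' ≠ u := by rintro rfl; exact hcon e' u' huv'
        rw [Pi.neg_apply, Pi.neg_apply, Pi.single_eq_of_ne h1, neg_zero, zero_sub, neg_neg]
        exact (Pi.single_nonneg.2 zero_le_one : (0 : V → ℝ) ≤ Pi.single u 1) u'
    have h1 := (Finset.sum_eq_zero_iff_of_nonneg fun e' _ => hterm e').1 h0 e (Finset.mem_univ _)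
    rw [increment_eq huv.2.1 huv.2.2, Pi.neg_apply, Pi.neg_apply, Pi.single_eq_same,
      Pi.single_eq_of_ne huv.2.1.ne.symm, neg_zero, zero_sub, neg_neg, mul_one] at h1
    exact huv.1 h1

theorem sub {γ : Finset E} (hγ : N.IsUpCrossing {e | r e ≠ 0} h γ) {m : ℝ}
    (hm : ∀ e ∈ γ, m ≤ r e) : N.IsBalanced h (fun e => r e - m * usage γ e) where
  nonneg e := by
    by_cases he : e ∈ γ
    · rw [usage_of_mem he]; linarith [hm e he]
    · rw [usage_of_notMem he]; linarith [hr.nonneg e]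
  min_A := hr.min_A
  max_B := hr.max_B
  orient e he := hr.orient e fun h0 => by
    by_cases heγ : e ∈ γ
    · exact hγ.subset heγ h0
    · rw [usage_of_notMem heγ, h0, mul_zero, sub_zero] at he
      exact he rfl
  conserve φ hA hB := by
    have h1 := sum_usage_mul_increment hγ hA hB
    simp only [sub_mul, Finset.sum_sub_distrib, hr.conserve φ hA hB, mul_assoc, ← Finset.mul_sum,
      h1, mul_zero, sub_zero]

end IsBalanced

end PlaneNetwork

namespace PlaneNetwork

variable {V E : Type*} {N : PlaneNetwork V E}

open Network

variable {h : V → ℝ} {r : E → ℝ}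

theorem AlgorithmRun.eq {out out' : List (Finset E × ℝ)} (hrun : N.AlgorithmRun r out)
    (hrun' : N.AlgorithmRun r out') : out = out' := by
  induction hrun generalizing out' with
  | halt r h =>
    cases hrun' with
    | halt => rfl
    | step _ _ _ _ hγ => exact absurd ⟨_, hγ⟩ h
  | step r γ m out hγ hm _ ih =>
    cases hrun' with
    | halt _ h => exact absurd ⟨_, hγ⟩ h
    | step _ γ' m' out' hγ' hm' hout' =>
      obtain rfl := hγ.unique hγ'
      obtain rfl := hm.unique hm'
      rw [ih hout']

/-- The total weight of the path `γ` in the list `out`. -/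
noncomputable def outMass (out : List (Finset E × ℝ)) (γ : Finset E) : ℝ :=
  open Classical in (out.map fun p => if p.1 = γ then p.2 else 0).sum

theorem outMass_cons (γ₀ : Finset E) (m : ℝ) (out : List (Finset E × ℝ)) (γ : Finset E)
    [Decidable (γ₀ = γ)] :
    outMass ((γ₀, m) :: out) γ = (if γ₀ = γ then m else 0) + outMass out γ := by
  rw [outMass, List.map_cons, List.sum_cons, ← outMass]
  congr

theorem outMass_of_notMem {out : List (Finset E × ℝ)} {γ : Finset E}
    (hγ : γ ∉ out.map Prod.fst) : outMass out γ = 0 := by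
  refine List.sum_eq_zero fun x hx => ?_
  obtain ⟨p, hp, rfl⟩ := List.mem_map.1 hx
  exact if_neg fun h => hγ (List.mem_map.2 ⟨p, hp, h⟩)

theorem outMass_of_mem {out : List (Finset E × ℝ)} (hout : (out.map Prod.fst).Nodup)
    {p : Finset E × ℝ} (hp : p ∈ out) : outMass out p.1 = p.2 := by
  classical
  induction out with
  | nil => exact absurd hp List.not_mem_nil
  | cons q out ih =>
    rw [List.map_cons, List.nodup_cons] at hout
    rw [outMass_cons]
    rcases List.mem_cons.1 hp with rfl | hp
    · rw [if_pos rfl, outMass_of_notMem hout.1, add_zero]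
    · rw [if_neg, zero_add, ih hout.2 hp]
      exact fun h => hout.1 (List.mem_map.2 ⟨p, hp, h.symm⟩)

theorem sum_outMass_mul [Fintype E] (out : List (Finset E × ℝ)) (f : Finset E → ℝ) :
    ∑ γ, outMass out γ * f γ = (out.map fun p => p.2 * f p.1).sum := by
  classical
  induction out with
  | nil => simp [outMass]
  | cons q out ih =>
    obtain ⟨γ₀, m⟩ := q
    simp only [outMass_cons, add_mul, Finset.sum_add_distrib, ih, List.map_cons, List.sum_cons,
      ite_mul, zero_mul, Finset.sum_ite_eq, Finset.mem_univ, if_true]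

namespace IsBalanced

section

variable {γ : Finset E} {m : ℝ}

theorem support_subset (hγ : N.IsTopPath {e | r e ≠ 0} γ) :
    {e | r e - m * usage γ e ≠ 0} ⊆ {e | r e ≠ 0} := by
  intro e he h0
  by_cases heγ : e ∈ γ
  · exact hγ.1 heγ h0
  · exact he (by rw [usage_of_notMem heγ, h0, mul_zero, sub_zero])

theorem exists_eq_zero (hm : IsLeast (r '' (γ : Set E)) m) :
    ∃ e ∈ γ, r e - m * usage γ e = 0 := by
  obtain ⟨e, he, hem⟩ := hm.1
  exact ⟨e, he, by rw [usage_of_mem (Finset.mem_coe.1 he), hem, mul_one, sub_self]⟩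

end

variable [Fintype E] (hr : N.IsBalanced h r) {γ : Finset E} {m : ℝ}
include hr

theorem pos_of_isLeast (hγ : N.IsTopPath {e | r e ≠ 0} γ) (hm : IsLeast (r '' (γ : Set E)) m) :
    0 < m := by
  obtain ⟨e, he, rfl⟩ := hm.1
  exact (hr.nonneg e).lt_of_ne' (hγ.1 he)

variable [Finite V]

theorem sub_isLeast (hγ : N.IsTopPath {e | r e ≠ 0} γ) (hm : IsLeast (r '' (γ : Set E)) m) :
    N.IsBalanced h (fun e => r e - m * usage γ e) :=
  hr.sub (hr.isFlow.isUpCrossing_of_isTopPath hγ)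
    fun _ he => hm.2 (mem_image_of_mem _ (Finset.mem_coe.2 he))

theorem eq_zero_of_forall_not_isTopPath (hr0 : ¬ ∃ γ, N.IsTopPath {e | r e ≠ 0} γ)
    (e : E) : r e = 0 := by
  by_contra he
  obtain ⟨γ, hγ, -⟩ := hr.isFlow.exists_isTopPath ⟨e, he⟩
  exact hr0 ⟨γ, hγ⟩

theorem exists_algorithmRun : ∃ out, N.AlgorithmRun r out := by
  induction hn : {e | r e ≠ 0}.ncard using Nat.strong_induction_on generalizing r with
  | _ n ih =>
    by_cases hγ : ∃ γ, N.IsTopPath {e | r e ≠ 0} γ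
    · obtain ⟨γ, hγ⟩ := hγ
      obtain ⟨m, hm⟩ : ∃ m, IsLeast (r '' (γ : Set E)) m := by
        obtain ⟨e, he, hmin⟩ := γ.exists_min_image r (nonempty_of_mem_abPaths hγ.2.1)
        exact ⟨r e, ⟨e, he, rfl⟩, by rintro _ ⟨e', he', rfl⟩; exact hmin e' he'⟩
      have hlt : {e | r e - m * usage γ e ≠ 0}.ncard < n := by
        rw [← hn]
        refine ncard_lt_ncard ⟨support_subset hγ, fun hsub => ?_⟩
        obtain ⟨e, he, he0⟩ := exists_eq_zero hm
        exact hsub (hγ.1 (Finset.mem_coe.2 he)) he0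
      obtain ⟨out, hout⟩ := ih _ hlt (hr.sub_isLeast hγ hm) rfl
      exact ⟨_, .step r γ m out hγ hm hout⟩
    · exact ⟨[], .halt r hγ⟩

end IsBalanced

namespace AlgorithmRun

variable [Finite V] [Fintype E] {out : List (Finset E × ℝ)}

theorem pos_and_isUpCrossing (hrun : N.AlgorithmRun r out) (hr : N.IsBalanced h r) :
    ∀ p ∈ out, 0 < p.2 ∧ N.IsUpCrossing {e | r e ≠ 0} h p.1 := by
  induction hrun with
  | halt => simp
  | step r γ m out hγ hm _ ih =>
    rintro p (_ | ⟨_, hp⟩)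
    · exact ⟨hr.pos_of_isLeast hγ hm, hr.isFlow.isUpCrossing_of_isTopPath hγ⟩
    · obtain ⟨h1, h2⟩ := ih (hr.sub_isLeast hγ hm) p hp
      exact ⟨h1, h2.mono (h2.subset.trans (IsBalanced.support_subset hγ))⟩

theorem pairwise (hrun : N.AlgorithmRun r out) (hr : N.IsBalanced h r) :
    (out.map Prod.fst).Pairwise fun γ γ' => γ ≠ γ' ∧ ∀ e ∈ γ', N.EdgeBelow e γ := by
  induction hrun with
  | halt => simp
  | step r γ m out hγ hm hout ih =>
    have hr' := hr.sub_isLeast hγ hm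
    rw [List.map_cons, List.pairwise_cons]
    refine ⟨fun γ' hγ' => ?_, ih hr'⟩
    obtain ⟨p, hp, rfl⟩ := List.mem_map.1 hγ'
    have h1 := (hout.pos_and_isUpCrossing hr' p hp).2.subset
    constructor
    · rintro rfl
      obtain ⟨e, he, he0⟩ := IsBalanced.exists_eq_zero hm
      exact h1 (Finset.mem_coe.2 he) he0
    · exact fun e he => hγ.2.2.2.2 e (IsBalanced.support_subset hγ (h1 he))

theorem nodup (hrun : N.AlgorithmRun r out) (hr : N.IsBalanced h r) :
    (out.map Prod.fst).Nodup :=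
  (hrun.pairwise hr).imp And.left

theorem nonCrossing (hrun : N.AlgorithmRun r out) (hr : N.IsBalanced h r) :
    {γ | γ ∈ out.map Prod.fst}.Pairwise N.NonCrossing := by
  have : Std.Symm N.NonCrossing := ⟨fun _ _ => Or.symm⟩
  have h1 : (out.map Prod.fst).Pairwise N.NonCrossing :=
    (hrun.pairwise hr).imp fun h => .inl h.2
  exact fun γ hγ γ' hγ' hne => h1.forall hγ hγ' hne

theorem eq_sum (hrun : N.AlgorithmRun r out) (hr : N.IsBalanced h r) (e : E) :
    r e = (out.map fun p => p.2 * usage p.1 e).sum := by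
  induction hrun with
  | halt r h0 => exact hr.eq_zero_of_forall_not_isTopPath h0 e
  | step r γ m out hγ hm hout ih =>
    rw [List.map_cons, List.sum_cons, ← ih (hr.sub_isLeast hγ hm)]
    ring

/-- The weights found by the algorithm form the only decomposition of `r` into non-crossing
monotone paths. -/
theorem decomposition_unique (hrun : N.AlgorithmRun r out) (hr : N.IsBalanced h r)
    {w : Finset E → ℝ} (hw : ∀ γ, 0 ≤ w γ) (hsum : ∀ e, r e = ∑ γ, w γ * usage γ e)
    (hUp : ∀ γ, w γ ≠ 0 → N.IsUpCrossing {e | r e ≠ 0} h γ)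
    (hnc : {γ | w γ ≠ 0}.Pairwise N.NonCrossing) (γ : Finset E) :
    w γ = outMass out γ := by
  classical
  have hle : ∀ (w : Finset E → ℝ), (∀ γ, 0 ≤ w γ) → ∀ γ, ∀ e ∈ γ, w γ ≤ ∑ γ, w γ * usage γ e := by
    intro w hw γ e he
    refine le_trans ?_ (Finset.single_le_sum (f := fun γ => w γ * usage γ e)
      (fun γ' _ => mul_nonneg (hw γ') (usage_nonneg _ _)) (Finset.mem_univ γ))
    simp only [usage_of_mem he, mul_one, le_refl]
  induction hrun generalizing w with
  | halt r h0 =>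
    by_contra hne
    obtain ⟨e, he⟩ := nonempty_of_mem_abPaths (hUp γ hne).mem_abPaths
    exact (hUp γ hne).subset (Finset.mem_coe.2 he) (hr.eq_zero_of_forall_not_isTopPath h0 e)
  | step r γ₀ m out hγ hm hout ih =>
    have hm0 := hr.pos_of_isLeast hγ hm
    have hF := hr.isFlow
    -- the highest path of the decomposition is the top path
    have highest : ∀ S : Finset (Finset E), (∀ γ ∈ S, w γ ≠ 0) → (∀ e ∈ γ₀, ∃ γ ∈ S, e ∈ γ) →
        γ₀ ∈ S := by
      intro S hS hcov
      have hγ₀ := hF.isUpCrossing_of_isTopPath hγ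
      obtain ⟨e₀, he₀⟩ := nonempty_of_mem_abPaths hγ.2.1
      obtain ⟨γ₂, hγ₂, hmax⟩ := hF.exists_highest (S := S)
        (by obtain ⟨γ, hγ, -⟩ := hcov e₀ he₀; exact ⟨γ, hγ⟩)
        (fun γ hγ => hUp γ (hS γ hγ)) (hnc.mono fun γ hγ => hS γ hγ)
      have heq := hF.eq_of_le_of_le hγ₀ (hUp γ₂ (hS γ₂ hγ₂))
        (fun e he => by obtain ⟨γ, hγ, heγ⟩ := hcov e he; exact hmax γ hγ e heγ)
        (fun e he => hγ.2.2.2.2 e ((hUp γ₂ (hS γ₂ hγ₂)).subset he))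
      exact heq ▸ hγ₂
    obtain ⟨e₁, he₁, hem⟩ := hm.1
    have hle' : w γ₀ ≤ m := by
      rw [← hem, hsum]
      exact hle w hw γ₀ e₁ he₁
    have heq : w γ₀ = m := by
      refine hle'.antisymm (le_of_not_gt fun hlt => ?_)
      refine absurd (highest (Finset.univ.filter fun γ => w γ ≠ 0 ∧ γ ≠ γ₀)
        (fun γ hγ => (Finset.mem_filter.1 hγ).2.1) ?_) (by simp)
      intro e he
      by_contra! hcon
      have h1 : r e = w γ₀ := by
        rw [hsum, Finset.sum_eq_single γ₀, usage_of_mem he, mul_one]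
        · intro γ _ hne
          by_cases hwγ : w γ = 0
          · rw [hwγ, zero_mul]
          · rw [usage_of_notMem (hcon γ (by simp [hwγ, hne])), mul_zero]
        · simp
      have h2 := hm.2 (mem_image_of_mem r (Finset.mem_coe.2 he))
      linarith
    have hr' := hr.sub_isLeast hγ hm
    have hw' : ∀ γ, 0 ≤ Function.update w γ₀ 0 γ := by
      intro γ
      rcases eq_or_ne γ γ₀ with rfl | hne
      · rw [Function.update_self]
      · rw [Function.update_of_ne hne]; exact hw γ
    have hsum' : ∀ e, r e - m * usage γ₀ e = ∑ γ, Function.update w γ₀ 0 γ * usage γ e := by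
      intro e
      rw [hsum e, ← heq, ← Finset.add_sum_erase _ _ (Finset.mem_univ γ₀), add_sub_cancel_left,
        ← Finset.add_sum_erase Finset.univ (fun γ => Function.update w γ₀ 0 γ * usage γ e)
          (Finset.mem_univ γ₀), Function.update_self, zero_mul, zero_add]
      refine Finset.sum_congr rfl fun γ hγ => ?_
      rw [Function.update_of_ne (Finset.ne_of_mem_erase hγ)]
    have hne' : ∀ γ, Function.update w γ₀ 0 γ ≠ 0 → γ ≠ γ₀ ∧ w γ ≠ 0 := by
      intro γ hγ
      rcases eq_or_ne γ γ₀ with rfl | hne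
      · rw [Function.update_self] at hγ
        exact absurd rfl hγ
      · rw [Function.update_of_ne hne] at hγ
        exact ⟨hne, hγ⟩
    have key := ih hr' hw' hsum' (fun γ hγ => (hUp γ (hne' γ hγ).2).mono fun e he => by
        have h1 := hle _ hw' γ e he
        rw [← hsum'] at h1
        exact (((hw' γ).lt_of_ne' hγ).trans_le h1).ne')
      (hnc.mono fun γ hγ => (hne' γ hγ).2)
    rw [outMass_cons, ← key]
    rcases eq_or_ne γ γ₀ with rfl | hne
    · rw [Function.update_self, if_pos rfl, heq, add_zero]
    · rw [Function.update_of_ne hne, if_neg hne.symm, zero_add]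

end AlgorithmRun

end PlaneNetwork

namespace Network

variable {V E : Type*} (G : Network V E)

variable [Fintype E] {Γ Γ' : Set (Finset E)} {μ ν : Finset E → ℝ} {ρ : E → ℝ}

/-- The objective function of the probabilistic interpretation of the modulus. -/
noncomputable def usageEnergy (μ : Finset E → ℝ) : ℝ :=
  ∑ e, (G.σ e)⁻¹ * expectedUsage μ e ^ 2

theorem sum_expectedUsage_mul (μ : Finset E → ℝ) (f : E → ℝ) :
    ∑ e, expectedUsage μ e * f e = ∑ γ, μ γ * ∑ e, usage γ e * f e := by
  simp only [expectedUsage, Finset.sum_mul, Finset.mul_sum]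
  rw [Finset.sum_comm]
  simp only [mul_assoc]

theorem expectedUsage_single (γ : Finset E) [DecidableEq (Finset E)] (e : E) :
    expectedUsage (Pi.single γ 1) e = usage γ e := by
  rw [expectedUsage, Finset.sum_eq_single γ]
  · rw [Pi.single_eq_same, one_mul]
  · intro γ' _ hne
    rw [Pi.single_eq_of_ne hne, zero_mul]
  · simp

theorem expectedUsage_nonneg (hμ : μ ∈ pmfs Γ) (e : E) : 0 ≤ expectedUsage μ e :=
  Finset.sum_nonneg fun γ _ => mul_nonneg (hμ.1.1 γ) (usage_nonneg γ e)

theorem le_expectedUsage (hμ : μ ∈ pmfs Γ) {γ : Finset E} {e : E} (he : e ∈ γ) :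
    μ γ ≤ expectedUsage μ e := by
  refine le_trans ?_ (Finset.single_le_sum (f := fun γ => μ γ * usage γ e)
    (fun γ' _ => mul_nonneg (hμ.1.1 γ') (usage_nonneg _ _)) (Finset.mem_univ γ))
  simp only [usage_of_mem he, mul_one, le_refl]

theorem single_mem_pmfs [DecidableEq (Finset E)] {γ : Finset E} (hγ : γ ∈ Γ) :
    Pi.single γ 1 ∈ pmfs Γ := by
  refine ⟨single_mem_stdSimplex ℝ γ, fun γ' hγ' => Pi.single_eq_of_ne ?_ _⟩
  rintro rfl
  exact hγ' hγ

theorem isCompact_pmfs (Γ : Set (Finset E)) : IsCompact (pmfs Γ) := by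
  have : pmfs Γ = stdSimplex ℝ (Finset E) ∩ ⋂ γ, ⋂ (_ : γ ∉ Γ), {μ | μ γ = 0} := by
    ext μ
    simp [pmfs]
  rw [this]
  refine (isCompact_stdSimplex ℝ (Finset E)).inter_right (isClosed_iInter fun γ =>
    isClosed_iInter fun _ => isClosed_eq (continuous_apply γ) continuous_const)

theorem exists_isOptimalPMF (hne : Γ.Nonempty) : ∃ μ, G.IsOptimalPMF Γ μ := by
  classical
  obtain ⟨γ, hγ⟩ := hne
  obtain ⟨μ, hμ, hmin⟩ := (isCompact_pmfs Γ).exists_isMinOn ⟨_, single_mem_pmfs hγ⟩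
    (f := fun ν : Finset E → ℝ => ∑ e, (G.σ e)⁻¹ * expectedUsage ν e ^ 2)
    (by unfold expectedUsage; fun_prop)
  exact ⟨μ, hμ, hmin⟩

variable {G}

theorem usageEnergy_pos (hΓ : ∀ γ ∈ Γ, γ.Nonempty) (hμ : μ ∈ pmfs Γ) : 0 < G.usageEnergy μ := by
  have h0 : ∀ e, 0 ≤ (G.σ e)⁻¹ * expectedUsage μ e ^ 2 := fun e =>
    mul_nonneg (inv_nonneg.2 (G.σ_pos e).le) (sq_nonneg _)
  obtain ⟨γ, -, hγ⟩ : ∃ γ ∈ Finset.univ, μ γ ≠ 0 :=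
    Finset.exists_ne_zero_of_sum_ne_zero (by rw [hμ.1.2]; exact one_ne_zero)
  obtain ⟨e, he⟩ := hΓ γ (not_not.1 fun h => hγ (hμ.2 γ h))
  refine Finset.sum_pos' (fun e _ => h0 e) ⟨e, Finset.mem_univ e, ?_⟩
  exact mul_pos (inv_pos.2 (G.σ_pos e))
    (pow_pos (((hμ.1.1 γ).lt_of_ne' hγ).trans_le (le_expectedUsage hμ he)) 2)

theorem IsOptimalPMF.usageEnergy_le (hμ : G.IsOptimalPMF Γ μ) (hν : ν ∈ pmfs Γ) :
    G.usageEnergy μ ≤ ∑ e, (G.σ e)⁻¹ * expectedUsage μ e * expectedUsage ν e := by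
  set b : ℝ := ∑ e, (G.σ e)⁻¹ * expectedUsage μ e * expectedUsage ν e with hb
  set p := G.usageEnergy μ
  set c : ℝ := ∑ e, (G.σ e)⁻¹ * (expectedUsage ν e - expectedUsage μ e) ^ 2 with hc
  have hc0 : 0 ≤ c := Finset.sum_nonneg fun e _ =>
    mul_nonneg (inv_nonneg.2 (G.σ_pos e).le) (sq_nonneg _)
  have key : ∀ t ∈ Ioc (0 : ℝ) 1, 0 ≤ 2 * (b - p) + t * c := by
    intro t ht
    have hmem : (1 - t) • μ + t • ν ∈ pmfs Γ := by
      refine ⟨convex_stdSimplex ℝ _ hμ.1.1 hν.1 (sub_nonneg.2 ht.2) ht.1.le (sub_add_cancel 1 t),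
        fun γ hγ => ?_⟩
      simp [hμ.1.2 γ hγ, hν.2 γ hγ]
    have h1 : p ≤ G.usageEnergy ((1 - t) • μ + t • ν) := hμ.2 hmem
    have h2 : G.usageEnergy ((1 - t) • μ + t • ν) = p + t * (2 * (b - p) + t * c) := by
      have h3 : ∀ e, expectedUsage ((1 - t) • μ + t • ν) e =
          expectedUsage μ e + t * (expectedUsage ν e - expectedUsage μ e) := by
        intro e
        simp only [expectedUsage, ← Finset.sum_sub_distrib, Finset.mul_sum,
          ← Finset.sum_add_distrib]
        refine Finset.sum_congr rfl fun γ _ => ?_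
        simp only [Pi.add_apply, Pi.smul_apply, smul_eq_mul]
        ring
      simp only [usageEnergy, p, hb, hc, h3, mul_sub, mul_add, Finset.mul_sum,
        ← Finset.sum_sub_distrib, ← Finset.sum_add_distrib]
      refine Finset.sum_congr rfl fun e _ => ?_
      ring
    have h3 : 0 ≤ t * (2 * (b - p) + t * c) := by linarith
    exact nonneg_of_mul_nonneg_right h3 ht.1
  by_contra! hlt
  have hd : 0 < p - b := sub_pos.2 hlt
  have h1 := key (min 1 ((p - b) / (c + 1)))
    ⟨lt_min one_pos (div_pos hd (by linarith)), min_le_left _ _⟩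
  have h2 : min 1 ((p - b) / (c + 1)) * c ≤ p - b := by
    refine (mul_le_mul_of_nonneg_right (min_le_right _ _) hc0).trans ?_
    rw [div_mul_eq_mul_div, div_le_iff₀ (by linarith)]
    nlinarith
  linarith

theorem sum_sq_sub_eq (c : ℝ) (ρ : E → ℝ) :
    ∑ e, G.σ e * (ρ e - c * ((G.σ e)⁻¹ * expectedUsage μ e)) ^ 2 =
      ∑ e, G.σ e * ρ e ^ 2 - 2 * c * ∑ e, expectedUsage μ e * ρ e + c ^ 2 * G.usageEnergy μ := by
  rw [usageEnergy, Finset.mul_sum, Finset.mul_sum, ← Finset.sum_sub_distrib,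
    ← Finset.sum_add_distrib]
  refine Finset.sum_congr rfl fun e _ => ?_
  have := (G.σ_pos e).ne'
  field_simp
  ring

theorem sum_sq_eq (hp : 0 < G.usageEnergy μ) :
    ∑ e, G.σ e * ((G.usageEnergy μ)⁻¹ * ((G.σ e)⁻¹ * expectedUsage μ e)) ^ 2 =
      (G.usageEnergy μ)⁻¹ := by
  have h1 := sum_sq_sub_eq (G := G) (μ := μ) (G.usageEnergy μ)⁻¹ 0
  have h2 : (G.usageEnergy μ)⁻¹ ^ 2 * G.usageEnergy μ = (G.usageEnergy μ)⁻¹ := by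
    rw [sq, mul_assoc, inv_mul_cancel₀ hp.ne', mul_one]
  rw [h2] at h1
  simpa using h1

theorem IsOptimalPMF.of_expectedUsage_eq (hμ : G.IsOptimalPMF Γ μ) (hν : ν ∈ pmfs Γ)
    (h : ∀ e, expectedUsage ν e = expectedUsage μ e) :
    G.IsOptimalPMF Γ ν := by
  refine ⟨hν, fun κ hκ => ?_⟩
  have : G.usageEnergy μ ≤ G.usageEnergy κ := hμ.2 hκ
  simpa only [mem_ofPred_eq, usageEnergy, h] using this

theorem Admissible.one_le_sum (hρ : Admissible Γ ρ) (hμ : μ ∈ pmfs Γ) :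
    1 ≤ ∑ e, expectedUsage μ e * ρ e := by
  rw [sum_expectedUsage_mul, ← hμ.1.2]
  refine Finset.sum_le_sum fun γ _ => ?_
  by_cases hγ : γ ∈ Γ
  · exact le_mul_of_one_le_right (hμ.1.1 γ) (hρ.2 γ hγ)
  · rw [hμ.2 γ hγ, zero_mul]

namespace IsOptimalPMF

variable (hμ : G.IsOptimalPMF Γ μ) (hΓ : ∀ γ ∈ Γ, γ.Nonempty)
include hμ hΓ

theorem admissible :
    Admissible Γ fun e => (G.usageEnergy μ)⁻¹ * ((G.σ e)⁻¹ * expectedUsage μ e) := by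
  classical
  have hp := usageEnergy_pos (G := G) hΓ hμ.1
  refine ⟨fun e => mul_nonneg (inv_nonneg.2 hp.le)
    (mul_nonneg (inv_nonneg.2 (G.σ_pos e).le) (expectedUsage_nonneg hμ.1 e)), fun γ hγ => ?_⟩
  have h1 := hμ.usageEnergy_le (single_mem_pmfs hγ)
  simp only [expectedUsage_single] at h1
  rw [← inv_mul_cancel₀ hp.ne']
  refine (mul_le_mul_of_nonneg_left h1 (inv_nonneg.2 hp.le)).trans_eq ?_
  rw [Finset.mul_sum]
  exact Finset.sum_congr rfl fun e _ => by ring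

theorem sum_sq_sub_le (hρ : Admissible Γ ρ) :
    ∑ e, G.σ e * (ρ e - (G.usageEnergy μ)⁻¹ * ((G.σ e)⁻¹ * expectedUsage μ e)) ^ 2 ≤
      ∑ e, G.σ e * ρ e ^ 2 - (G.usageEnergy μ)⁻¹ := by
  have hp := usageEnergy_pos (G := G) hΓ hμ.1
  set p := G.usageEnergy μ with hpdef
  have h2 : p⁻¹ ^ 2 * p = p⁻¹ := by rw [sq, mul_assoc, inv_mul_cancel₀ hp.ne', mul_one]
  have h3 := mul_le_mul_of_nonneg_left (hρ.one_le_sum hμ.1) (inv_nonneg.2 hp.le)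
  rw [sum_sq_sub_eq, ← hpdef, h2]
  linarith

theorem modulus_eq : G.modulus Γ = (G.usageEnergy μ)⁻¹ := by
  refine IsLeast.csInf_eq ⟨⟨_, hμ.admissible hΓ, sum_sq_eq (usageEnergy_pos hΓ hμ.1)⟩, ?_⟩
  · rintro _ ⟨ρ, hρ, rfl⟩
    have h1 := hμ.sum_sq_sub_le hΓ hρ
    have h2 : 0 ≤ ∑ e, G.σ e * (ρ e - (G.usageEnergy μ)⁻¹ * ((G.σ e)⁻¹ * expectedUsage μ e)) ^ 2 :=
      Finset.sum_nonneg fun e _ => mul_nonneg (G.σ_pos e).le (sq_nonneg _)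
    simp only
    linarith

theorem modulus_pos : 0 < G.modulus Γ := by
  rw [hμ.modulus_eq hΓ]
  exact inv_pos.2 (usageEnergy_pos hΓ hμ.1)

theorem isExtremal_iff :
    G.IsExtremal Γ ρ ↔ ∀ e, G.σ e * ρ e = G.modulus Γ * expectedUsage μ e := by
  have key : (∀ e, G.σ e * ρ e = G.modulus Γ * expectedUsage μ e) ↔
      ρ = fun e => (G.usageEnergy μ)⁻¹ * ((G.σ e)⁻¹ * expectedUsage μ e) := by
    rw [funext_iff, hμ.modulus_eq hΓ]
    refine forall_congr' fun e => ?_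
    have h1 := (G.σ_pos e).ne'
    constructor
    · intro h
      rw [mul_left_comm, ← h, inv_mul_cancel_left₀ h1]
    · intro h
      rw [h, mul_left_comm, mul_inv_cancel_left₀ h1]
  rw [key]
  constructor
  · rintro ⟨hρ, hE⟩
    have h1 := hμ.sum_sq_sub_le hΓ hρ
    rw [hE, hμ.modulus_eq hΓ, sub_self] at h1
    have h0 : ∀ e ∈ Finset.univ, 0 ≤ G.σ e *
        (ρ e - (G.usageEnergy μ)⁻¹ * ((G.σ e)⁻¹ * expectedUsage μ e)) ^ 2 :=
      fun e _ => mul_nonneg (G.σ_pos e).le (sq_nonneg _)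
    have h2 := (Finset.sum_eq_zero_iff_of_nonneg h0).1 (h1.antisymm (Finset.sum_nonneg h0))
    funext e
    have h3 := (mul_eq_zero.1 (h2 e (Finset.mem_univ e))).resolve_left (G.σ_pos e).ne'
    exact sub_eq_zero.1 (pow_eq_zero_iff two_ne_zero |>.1 h3)
  · rintro rfl
    exact ⟨hμ.admissible hΓ, (sum_sq_eq (usageEnergy_pos hΓ hμ.1)).trans (hμ.modulus_eq hΓ).symm⟩

theorem length_eq_one (hρ : G.IsExtremal Γ ρ) {γ : Finset E} (hγ : μ γ ≠ 0) :
    ∑ e, usage γ e * ρ e = 1 := by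
  have h1 : ∑ γ, μ γ * ∑ e, usage γ e * ρ e = 1 := by
    rw [← sum_expectedUsage_mul]
    refine mul_left_cancel₀ (hμ.modulus_pos hΓ).ne' ?_
    rw [mul_one, ← hρ.2, Finset.mul_sum]
    refine Finset.sum_congr rfl fun e _ => ?_
    rw [hρ.2, ← mul_assoc, ← (hμ.isExtremal_iff hΓ).1 hρ e]
    ring
  have h2 : ∑ γ, μ γ * (∑ e, usage γ e * ρ e - 1) = 0 := by
    simp only [mul_sub, mul_one, Finset.sum_sub_distrib]
    rw [h1, hμ.1.1.2, sub_self]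
  have h3 := (Finset.sum_eq_zero_iff_of_nonneg fun γ _ => ?_).1 h2 γ (Finset.mem_univ γ)
  · exact sub_eq_zero.1 ((mul_eq_zero.1 h3).resolve_left hγ)
  · by_cases hγ' : γ ∈ Γ
    · exact mul_nonneg (hμ.1.1.1 γ) (sub_nonneg.2 (hρ.1.2 γ hγ'))
    · rw [hμ.1.2 γ hγ', zero_mul]

theorem modulus_eq_of_subset (hsub : Γ' ⊆ Γ) (hμ' : ∀ γ, γ ∉ Γ' → μ γ = 0) :
    G.modulus Γ' = G.modulus Γ := by
  have h1 : G.IsOptimalPMF Γ' μ :=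
    ⟨⟨hμ.1.1, hμ'⟩, fun κ hκ => hμ.2 ⟨hκ.1, fun γ hγ => hκ.2 γ fun h => hγ (hsub h)⟩⟩
  rw [h1.modulus_eq fun γ hγ => hΓ γ (hsub hγ), hμ.modulus_eq hΓ]

theorem of_modulus_eq (hsub : Γ' ⊆ Γ) (hmod : G.modulus Γ' = G.modulus Γ)
    (hν : G.IsOptimalPMF Γ' ν) : G.IsOptimalPMF Γ ν := by
  rw [hν.modulus_eq fun γ hγ => hΓ γ (hsub hγ), hμ.modulus_eq hΓ, inv_inj] at hmod
  refine ⟨⟨hν.1.1, fun γ hγ => hν.1.2 γ fun h => hγ (hsub h)⟩, fun κ hκ => ?_⟩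
  have : G.usageEnergy ν ≤ G.usageEnergy κ := hmod ▸ hμ.2 hκ
  exact this

end IsOptimalPMF

theorem modulus_nonneg (Γ : Set (Finset E)) : 0 ≤ G.modulus Γ := by
  refine Real.sInf_nonneg ?_
  rintro _ ⟨ρ, -, rfl⟩
  exact Finset.sum_nonneg fun e _ => mul_nonneg (G.σ_pos e).le (sq_nonneg _)

theorem modulus_empty : G.modulus ∅ = 0 := by
  refine le_antisymm (csInf_le ⟨0, ?_⟩ ⟨0, ⟨fun _ => le_rfl, fun _ h => h.elim⟩, by simp⟩)
    (modulus_nonneg _)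
  rintro _ ⟨ρ, -, rfl⟩
  exact Finset.sum_nonneg fun e _ => mul_nonneg (G.σ_pos e).le (sq_nonneg _)

theorem modulus_mono (hsub : Γ' ⊆ Γ) (hΓ : ∀ γ ∈ Γ, γ.Nonempty) :
    G.modulus Γ' ≤ G.modulus Γ := by
  rcases Γ.eq_empty_or_nonempty with rfl | hne
  · rw [subset_empty_iff.1 hsub]
  obtain ⟨μ, hμ⟩ := G.exists_isOptimalPMF hne
  refine csInf_le_csInf ⟨0, ?_⟩ ⟨_, _, hμ.admissible hΓ, rfl⟩
    (image_mono fun ρ hρ => ⟨hρ.1, fun γ hγ => hρ.2 γ (hsub hγ)⟩)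
  rintro _ ⟨ρ, -, rfl⟩
  exact Finset.sum_nonneg fun e _ => mul_nonneg (G.σ_pos e).le (sq_nonneg _)

end Network

namespace PlaneNetwork

variable {V E : Type*} {N : PlaneNetwork V E}

open Network

variable [Fintype E] {ρ : E → ℝ}

/-- The `ρ`-distance from `A`, truncated at `1`. -/
noncomputable def distA (N : PlaneNetwork V E) (ρ : E → ℝ) (v : V) : ℝ :=
  sInf (insert 1 {l | ∃ a ∈ N.A, ∃ γ W, SPath N.Joins a v γ W ∧ l = ∑ e, γ.indicator ρ e})

theorem sum_usage_mul_eq_indicator (γ : Finset E) (ρ : E → ℝ) :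
    ∑ e, usage γ e * ρ e = ∑ e, (γ : Set E).indicator ρ e := by
  refine Finset.sum_congr rfl fun e _ => ?_
  by_cases he : e ∈ (γ : Set E)
  · simp only [usage, indicator_of_mem he, one_mul]
  · simp only [usage, indicator_of_notMem he, zero_mul]

theorem sum_indicator_insert {e : E} {γ : Set E} (he : e ∉ γ) :
    ∑ e', (insert e γ).indicator ρ e' = ρ e + ∑ e', γ.indicator ρ e' := by
  classical
  rw [insert_eq, indicator_union_of_disjoint (disjoint_singleton_left.2 he),
    Finset.sum_add_distrib]
  congr 1
  rw [Finset.sum_eq_single e, indicator_of_mem (mem_singleton e)]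
  · exact fun e' _ hne => indicator_of_notMem (mt mem_singleton_iff.1 hne) _
  · simp

section

variable (hρ : ∀ e, 0 ≤ ρ e)
include hρ

theorem sum_indicator_mono {γ γ' : Set E} (h : γ ⊆ γ') :
    ∑ e, γ.indicator ρ e ≤ ∑ e, γ'.indicator ρ e :=
  Finset.sum_le_sum fun e _ => indicator_le_indicator_of_subset h hρ e

theorem distA_mem_lowerBounds (v : V) :
    0 ∈ lowerBounds (insert 1
      {l | ∃ a ∈ N.A, ∃ γ W, SPath N.Joins a v γ W ∧ l = ∑ e, γ.indicator ρ e}) := by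
  rintro l (rfl | ⟨a, -, γ, W, -, rfl⟩)
  · exact zero_le_one
  · exact Finset.sum_nonneg fun e _ => indicator_nonneg (fun e _ => hρ e) e

theorem distA_nonneg (v : V) : 0 ≤ N.distA ρ v :=
  le_csInf (insert_nonempty _ _) (distA_mem_lowerBounds hρ v)

theorem distA_le_one (v : V) : N.distA ρ v ≤ 1 :=
  csInf_le ⟨0, distA_mem_lowerBounds hρ v⟩ (mem_insert _ _)

theorem distA_le {a v : V} {γ : Set E} {W : Set V} (ha : a ∈ N.A) (h : SPath N.Joins a v γ W) :
    N.distA ρ v ≤ ∑ e, γ.indicator ρ e :=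
  csInf_le ⟨0, distA_mem_lowerBounds hρ v⟩ (.inr ⟨a, ha, γ, W, h, rfl⟩)

theorem distA_eq_zero {a : V} (ha : a ∈ N.A) : N.distA ρ a = 0 :=
  ((distA_le hρ ha (.nil a)).trans (by simp)).antisymm (distA_nonneg hρ a)

theorem distA_sub_le {e : E} {x y : V} (he : N.Joins e x y) :
    N.distA ρ y - N.distA ρ x ≤ ρ e := by
  rw [sub_le_iff_le_add, ← sub_le_iff_le_add']
  refine le_csInf (insert_nonempty _ _) ?_
  rintro l (rfl | ⟨a, ha, γ, W, h, rfl⟩)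
  · linarith [distA_le_one (N := N) hρ y, hρ e]
  · rw [sub_le_iff_le_add']
    by_cases hy : y ∈ W
    · obtain ⟨γ₁, W₁, γ₂, W₂, h₁, -, -, rfl, -⟩ := h.split hy
      have h1 := distA_le hρ ha h₁
      have h2 := sum_indicator_mono hρ (subset_union_left (s := γ₁) (t := γ₂))
      linarith [hρ e]
    · have h1 : SPath N.Joins a y (γ ∪ insert e ∅) (W ∪ insert x {y}) :=
        h.append (.cons he he.ne (.nil y)) (by
          rintro v ⟨hv, rfl | hv'⟩
          · rfl
          · rw [mem_singleton_iff] at hv'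
            exact absurd (hv' ▸ hv) hy)
      have h2 := distA_le hρ ha h1
      rw [union_insert, union_empty, sum_indicator_insert (notMem_edges h he.symm hy)] at h2
      exact h2

end

theorem distA_eq_one (hρ : Admissible N.abPaths ρ) {b : V} (hb : b ∈ N.B) :
    N.distA ρ b = 1 := by
  refine (distA_le_one hρ.1 b).antisymm (le_csInf (insert_nonempty _ _) ?_)
  rintro l (rfl | ⟨a, ha, γ, W, h, rfl⟩)
  · exact le_rfl
  · have h1 := hρ.2 h.finite_edges.toFinset
      (N.mem_abPaths_iff.2 ⟨a, ha, b, hb, W, by simpa using h⟩)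
    rwa [sum_usage_mul_eq_indicator, Finite.coe_toFinset] at h1

/-- Along a path whose length is at most the increment of a `1`-Lipschitz function, every step is
geodesic. -/
theorem sPath_of_length_le {φ : V → ℝ} (hφ : ∀ e u v, N.Joins e u v → φ v - φ u ≤ ρ e) {x y : V}
    {γ : Set E} {W : Set V} (h : SPath N.Joins x y γ W) :
    φ y - φ x ≤ ∑ e, γ.indicator ρ e ∧ (∑ e, γ.indicator ρ e ≤ φ y - φ x →
      SPath (fun e u v => N.Joins e u v ∧ φ v - φ u = ρ e) x y γ W) := by
  induction h with
  | nil => exact ⟨by simp, fun _ => .nil _⟩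
  | @cons e x y z γ W he hx h' ih =>
    rw [sum_indicator_insert (notMem_edges h' he hx)]
    have h1 := hφ e x y he
    exact ⟨by linarith [ih.1], fun hle => .cons ⟨he, by linarith [ih.1]⟩ hx
      (ih.2 (by linarith))⟩

variable {μ : Finset E → ℝ} (hμ : N.toNetwork.IsOptimalPMF N.abPaths μ)
  (hρ : N.toNetwork.IsExtremal N.abPaths ρ)
include hμ hρ

theorem exists_sPath_of_ne_zero {γ : Finset E} (hγ : μ γ ≠ 0) : ∃ a ∈ N.A, ∃ b ∈ N.B, ∃ W,
    SPath (fun e u v => N.Joins e u v ∧ N.distA ρ v - N.distA ρ u = ρ e) a b (γ : Set E) W := by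
  obtain ⟨a, ha, b, hb, W, hW⟩ := N.mem_abPaths_iff.1 (not_not.1 fun h => hγ (hμ.1.2 γ h))
  refine ⟨a, ha, b, hb, W,
    (sPath_of_length_le (fun e u v h => distA_sub_le hρ.1.1 h) hW).2 ?_⟩
  rw [← sum_usage_mul_eq_indicator,
    hμ.length_eq_one (fun γ hγ => nonempty_of_mem_abPaths hγ) hρ hγ, distA_eq_one hρ.1 hb,
    distA_eq_zero hρ.1.1 ha, sub_zero]

theorem exists_distA_sub_eq {e : E} (he : ρ e ≠ 0) :
    ∃ u v, N.Joins e u v ∧ N.distA ρ v - N.distA ρ u = ρ e := by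
  have hΓ : ∀ γ ∈ N.abPaths, γ.Nonempty := fun γ hγ => nonempty_of_mem_abPaths hγ
  have h1 : expectedUsage μ e ≠ 0 := fun h0 => by
    have h2 := (hμ.isExtremal_iff hΓ).1 hρ e
    rw [h0, mul_zero] at h2
    exact he ((mul_eq_zero.1 h2).resolve_left (N.σ_pos e).ne')
  obtain ⟨γ, -, hγ⟩ := Finset.exists_ne_zero_of_sum_ne_zero h1
  have heγ : e ∈ γ := not_not.1 fun h => right_ne_zero_of_mul hγ (usage_of_notMem h)
  obtain ⟨a, -, b, -, W, hW⟩ := exists_sPath_of_ne_zero hμ hρ (left_ne_zero_of_mul hγ)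
  obtain ⟨u, -, v, -, huv⟩ := hW.exists_step (Finset.mem_coe.2 heγ)
  exact ⟨u, v, huv⟩

theorem isUpCrossing_of_ne_zero {γ : Finset E} (hγ : μ γ ≠ 0) :
    N.IsUpCrossing {e | N.σ e * ρ e ≠ 0} (N.distA ρ) γ := by
  have hΓ : ∀ γ ∈ N.abPaths, γ.Nonempty := fun γ hγ => nonempty_of_mem_abPaths hγ
  obtain ⟨a, ha, b, hb, W, hW⟩ := exists_sPath_of_ne_zero hμ hρ hγ
  refine ⟨a, ha, b, hb, W, hW.mono fun e he u v huv => ?_⟩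
  have h1 : 0 < N.σ e * ρ e := by
    rw [(hμ.isExtremal_iff hΓ).1 hρ e]
    exact mul_pos (hμ.modulus_pos hΓ)
      (((hμ.1.1.1 γ).lt_of_ne' hγ).trans_le (le_expectedUsage hμ.1 he))
  have h2 := pos_of_mul_pos_right h1 (N.σ_pos e).le
  exact ⟨h1.ne', huv.1, by linarith [huv.2]⟩

theorem isBalanced_distA : N.IsBalanced (N.distA ρ) fun e => N.σ e * ρ e where
  nonneg e := mul_nonneg (N.σ_pos e).le (hρ.1.1 e)
  min_A v hv u := (distA_eq_zero hρ.1.1 hv).trans_le (distA_nonneg hρ.1.1 u)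
  max_B v hv u := (distA_le_one hρ.1.1 u).trans_eq (distA_eq_one hρ.1 hv).symm
  orient e he := by
    have h0 := right_ne_zero_of_mul he
    obtain ⟨u, v, huv, h1⟩ := exists_distA_sub_eq hμ hρ h0
    have h2 : N.distA ρ v ≠ N.distA ρ u := fun h => h0 (by rw [← h1, h, sub_self])
    rcases huv with ⟨rfl, rfl⟩ | ⟨rfl, rfl⟩
    · exact h2.symm
    · exact h2
  conserve φ hA hB := by
    have hΓ : ∀ γ ∈ N.abPaths, γ.Nonempty := fun γ hγ => nonempty_of_mem_abPaths hγ
    simp only [(hμ.isExtremal_iff hΓ).1 hρ, mul_assoc]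
    rw [← Finset.mul_sum, sum_expectedUsage_mul, Finset.sum_eq_zero, mul_zero]
    intro γ _
    by_cases hγ : μ γ = 0
    · rw [hγ, zero_mul]
    · rw [sum_usage_mul_increment (isUpCrossing_of_ne_zero hμ hρ hγ) hA hB, mul_zero]

theorem IsUpCrossing.length_eq_one {γ : Finset E}
    (hγ : N.IsUpCrossing {e | N.σ e * ρ e ≠ 0} (N.distA ρ) γ) : ∑ e, usage γ e * ρ e = 1 := by
  obtain ⟨a, ha, b, hb, W, hW⟩ := hγ
  rw [sum_usage_mul (φ := N.distA ρ) (fun e u v h => h.2.1) ?_ hW, distA_eq_one hρ.1 hb,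
    distA_eq_zero hρ.1.1 ha, sub_zero]
  intro e u v huv
  have h0 := right_ne_zero_of_mul huv.1
  obtain ⟨u', v', hJ, h1⟩ := exists_distA_sub_eq hμ hρ h0
  rcases huv.2.1.eq_or_eq hJ with ⟨rfl, rfl⟩ | ⟨rfl, rfl⟩
  · exact h1.symm
  · linarith [huv.2.2, hρ.1.1 e]

end PlaneNetwork

namespace PlaneNetwork

variable {V E : Type*} {N : PlaneNetwork V E}

open Network

section

variable [Finite V] [Fintype E] {ρ : E → ℝ} {μ ν : Finset E → ℝ} {out : List (Finset E × ℝ)}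
  (hμ : N.toNetwork.IsOptimalPMF N.abPaths μ) (hρ : N.toNetwork.IsExtremal N.abPaths ρ)
  (hrun : N.AlgorithmRun (fun e => N.σ e * ρ e) out)
include hμ hρ hrun

theorem outMass_eq_zero_or_isUpCrossing (γ : Finset E) : outMass out γ = 0 ∨
    (0 < outMass out γ ∧ N.IsUpCrossing {e | N.σ e * ρ e ≠ 0} (N.distA ρ) γ) := by
  have hr := isBalanced_distA hμ hρ
  by_cases hγ : γ ∈ out.map Prod.fst
  · obtain ⟨p, hp, rfl⟩ := List.mem_map.1 hγ
    rw [outMass_of_mem (hrun.nodup hr) hp]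
    exact .inr (hrun.pos_and_isUpCrossing hr p hp)
  · exact .inl (outMass_of_notMem hγ)

theorem sum_outMass_mul_usage (e : E) : ∑ γ, outMass out γ * usage γ e = N.σ e * ρ e := by
  rw [sum_outMass_mul, ← hrun.eq_sum (isBalanced_distA hμ hρ)]

theorem sum_outMass : ∑ γ, outMass out γ = N.modulus N.abPaths := by
  have h1 : ∑ e, (∑ γ, outMass out γ * usage γ e) * ρ e = N.modulus N.abPaths := by
    rw [← hρ.2]
    refine Finset.sum_congr rfl fun e _ => ?_
    rw [sum_outMass_mul_usage hμ hρ hrun]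
    ring
  have h2 := sum_expectedUsage_mul (outMass out) ρ
  rw [← h1]
  refine Eq.trans ?_ h2.symm
  refine Finset.sum_congr rfl fun γ _ => ?_
  rcases outMass_eq_zero_or_isUpCrossing hμ hρ hrun γ with h | ⟨-, h⟩
  · rw [h, zero_mul]
  · rw [h.length_eq_one hμ hρ, mul_one]

theorem isOptimalPMF_outMass_div :
    N.toNetwork.IsOptimalPMF N.abPaths fun γ => outMass out γ / N.modulus N.abPaths := by
  have hΓ : ∀ γ ∈ N.abPaths, γ.Nonempty := fun γ hγ => nonempty_of_mem_abPaths hγ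
  have hM := hμ.modulus_pos hΓ
  have hcases := outMass_eq_zero_or_isUpCrossing hμ hρ hrun
  refine hμ.of_expectedUsage_eq ⟨⟨fun γ => div_nonneg ?_ hM.le, ?_⟩, fun γ hγ => ?_⟩ fun e => ?_
  · rcases hcases γ with h | h
    · exact h.ge
    · exact h.1.le
  · rw [← Finset.sum_div, sum_outMass hμ hρ hrun, div_self hM.ne']
  · rcases hcases γ with h | h
    · simp only [h, zero_div]
    · exact absurd h.2.mem_abPaths hγ
  · simp only [expectedUsage, div_mul_eq_mul_div]
    rw [← Finset.sum_div, sum_outMass_mul_usage hμ hρ hrun, (hμ.isExtremal_iff hΓ).1 hρ,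
      mul_div_cancel_left₀ _ hM.ne', expectedUsage]

/-- There is only one optimal pmf that charges no pair of crossing paths. -/
theorem eq_outMass_div (hnc : {γ | μ γ ≠ 0}.Pairwise N.NonCrossing) :
    μ = fun γ => outMass out γ / N.modulus N.abPaths := by
  have hΓ : ∀ γ ∈ N.abPaths, γ.Nonempty := fun γ hγ => nonempty_of_mem_abPaths hγ
  have hM := hμ.modulus_pos hΓ
  funext γ
  rw [eq_div_iff hM.ne', mul_comm]
  refine hrun.decomposition_unique (isBalanced_distA hμ hρ)
    (w := fun γ => N.modulus N.abPaths * μ γ)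
    (fun γ => mul_nonneg hM.le (hμ.1.1.1 γ)) (fun e => ?_)
    (fun γ hγ => isUpCrossing_of_ne_zero hμ hρ (right_ne_zero_of_mul hγ))
    (hnc.mono fun γ hγ => right_ne_zero_of_mul hγ) γ
  rw [(hμ.isExtremal_iff hΓ).1 hρ, expectedUsage, Finset.mul_sum]
  exact Finset.sum_congr rfl fun γ _ => (mul_assoc _ _ _).symm

end

end PlaneNetwork

end

open PlaneNetwork Network

theorem proposition1 {V E : Type*} [Finite V] [Fintype E] (N : PlaneNetwork V E)
    (hpath : N.abPaths.Nonempty) :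
    ∃ (Γ : Set (Finset E)) (μ : Finset E → ℝ),
      -- `Γ` is a subfamily of `Γ(A, B)` with the properties (i), (ii), (iii)
      Γ ⊆ N.abPaths ∧
      Γ.Pairwise N.NonCrossing ∧
      (N.toNetwork.IsOptimalPMF N.abPaths μ ∧ ∀ γ, γ ∉ Γ → μ γ = 0) ∧
      N.toNetwork.IsMinimalSubfamily Γ N.abPaths ∧
      -- `Γ` is the only such subfamily
      (∀ Γ' ⊆ N.abPaths, Γ'.Pairwise N.NonCrossing →
        (∃ μ', N.toNetwork.IsOptimalPMF N.abPaths μ' ∧ ∀ γ, γ ∉ Γ' → μ' γ = 0) →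
        N.toNetwork.IsMinimalSubfamily Γ' N.abPaths → Γ' = Γ) ∧
      -- `μ` is the only optimal pmf supported on `Γ`
      (∀ μ', N.toNetwork.IsOptimalPMF N.abPaths μ' → (∀ γ, γ ∉ Γ → μ' γ = 0) → μ' = μ) ∧
      -- started from the extremal density, the algorithm terminates with a well-defined output,
      -- and the output is `Γ` and `μ`
      ∃ (ρ : E → ℝ) (out : List (Finset E × ℝ)),
        (∀ ρ', N.toNetwork.IsExtremal N.abPaths ρ' ↔ ρ' = ρ) ∧
        (∀ out', N.AlgorithmRun (fun e => N.σ e * ρ e) out' ↔ out' = out) ∧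
        (out.map Prod.fst).Nodup ∧
        (∀ γ, γ ∈ Γ ↔ γ ∈ out.map Prod.fst) ∧
        (∀ p ∈ out, 0 < p.2 ∧ μ p.1 = p.2 / (out.map Prod.snd).sum) ∧
        (out.map Prod.snd).sum = N.toNetwork.modulus Γ := by
  have hΓ : ∀ γ ∈ N.abPaths, γ.Nonempty := fun γ hγ => nonempty_of_mem_abPaths hγ
  obtain ⟨μ₀, hμ₀⟩ := N.toNetwork.exists_isOptimalPMF hpath
  have hM := hμ₀.modulus_pos hΓ
  obtain ⟨ρ, hρ⟩ : ∃ ρ, N.IsExtremal N.abPaths ρ :=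
    ⟨fun e => (N.σ e)⁻¹ * (N.modulus N.abPaths * expectedUsage μ₀ e),
      (hμ₀.isExtremal_iff hΓ).2 fun e => mul_inv_cancel_left₀ (N.σ_pos e).ne' _⟩
  have hr := isBalanced_distA hμ₀ hρ
  obtain ⟨out, hrun⟩ := hr.exists_algorithmRun
  have hnodup := hrun.nodup hr
  set Γ : Set (Finset E) := {γ | γ ∈ out.map Prod.fst} with hΓdef
  set μ : Finset E → ℝ := fun γ => outMass out γ / N.modulus N.abPaths with hμdef
  have hμ : N.IsOptimalPMF N.abPaths μ := isOptimalPMF_outMass_div hμ₀ hρ hrun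
  have hμΓ : ∀ γ, γ ∉ Γ → μ γ = 0 := fun γ hγ => by
    rw [hμdef]
    simp only
    rw [outMass_of_notMem hγ, zero_div]
  have hμmem : ∀ p ∈ out, μ p.1 = p.2 / N.modulus N.abPaths := fun p hp => by
    rw [hμdef]
    simp only
    rw [outMass_of_mem hnodup hp]
  have hμpos : ∀ γ ∈ Γ, μ γ ≠ 0 := fun γ hγ => by
    obtain ⟨p, hp, rfl⟩ := List.mem_map.1 hγ
    rw [hμmem p hp]
    exact (div_pos (hrun.pos_and_isUpCrossing hr p hp).1 hM).ne'
  have hsub : Γ ⊆ N.abPaths := fun γ hγ => by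
    obtain ⟨p, hp, rfl⟩ := List.mem_map.1 hγ
    exact (hrun.pos_and_isUpCrossing hr p hp).2.mem_abPaths
  have hnc : Γ.Pairwise N.NonCrossing := hrun.nonCrossing hr
  have huniq : ∀ {Γ' : Set (Finset E)} {μ' : Finset E → ℝ}, Γ'.Pairwise N.NonCrossing →
      N.IsOptimalPMF N.abPaths μ' → (∀ γ, γ ∉ Γ' → μ' γ = 0) → μ' = μ :=
    fun hnc' hμ' hsupp => eq_outMass_div hμ' hρ hrun
      (hnc'.mono fun γ hγ => not_not.1 fun h => hγ (hsupp γ h))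
  have hmod : N.modulus Γ = N.modulus N.abPaths := hμ.modulus_eq_of_subset hΓ hsub hμΓ
  have hsum : (out.map Prod.snd).sum = N.modulus N.abPaths := by
    rw [← sum_outMass hμ₀ hρ hrun]
    simpa using (sum_outMass_mul out fun _ => 1).symm
  refine ⟨Γ, μ, hsub, hnc, ⟨hμ, hμΓ⟩, ⟨hsub, hmod, fun γ hγ => ?_⟩, ?_,
    fun μ' hμ' hsupp => huniq hnc hμ' hsupp, ρ, out, fun ρ' => ?_, fun out' => ?_, hnodup,
    fun γ => Iff.rfl, fun p hp => ?_, hsum.trans hmod.symm⟩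
  · have hsub' : Γ \ {γ} ⊆ N.abPaths := Set.sdiff_subset.trans hsub
    refine (modulus_mono hsub' hΓ).lt_of_ne fun heq => ?_
    rcases (Γ \ {γ}).eq_empty_or_nonempty with h0 | hne
    · rw [h0, modulus_empty] at heq
      exact hM.ne heq
    · obtain ⟨ν, hν⟩ := N.toNetwork.exists_isOptimalPMF hne
      have h1 := huniq (hnc.mono Set.sdiff_subset) (hμ.of_modulus_eq hΓ hsub' heq hν) hν.1.2
      exact hμpos γ hγ (h1 ▸ hν.1.2 γ fun h => h.2 rfl)
  · rintro Γ' hsub' hnc' ⟨μ', hμ', hsupp⟩ ⟨-, -, hlt⟩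
    obtain rfl := huniq hnc' hμ' hsupp
    refine Set.Subset.antisymm (fun γ hγ => ?_)
      fun γ hγ => not_not.1 fun h => hμpos γ hγ (hsupp γ h)
    by_contra hγΓ
    refine (hlt γ hγ).ne (hμ.modulus_eq_of_subset hΓ (Set.sdiff_subset.trans hsub')
      fun γ' hγ' => ?_)
    by_cases h : γ' = γ
    · rw [h, hμΓ γ hγΓ]
    · exact hsupp γ' fun h' => hγ' ⟨h', h⟩
  · constructor
    · intro hρ'
      funext e
      refine mul_left_cancel₀ (N.σ_pos e).ne' ?_
      rw [(hμ₀.isExtremal_iff hΓ).1 hρ', (hμ₀.isExtremal_iff hΓ).1 hρ]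
    · rintro rfl
      exact hρ
  · constructor
    · exact fun h => h.eq hrun
    · rintro rfl
      exact hrun
  · rw [hsum]
    exact ⟨(hrun.pos_and_isUpCrossing hr p hp).1, hμmem p hp⟩
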